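/- **Ribbon graphs.** A ribbon graph is a tuple $\Gamma=(\mathfrak h,\sigma_0,\sigma_1,B)$ where $\mathfrak h$ is a finite set of half-edges, $\sigma_0,\sigma_1$ are permutations of $\mathfrak h$, $\sigma_1$ is a fixed-point-free involution, $\sigma_0$ has no cycles of length $1$ or $2$, and, with $\sigma_2=\sigma_0^{-1}\sigma_1$, the subset $B\subset\mathfrak h$ satisfies $\sigma_2(B)\subset B$ and $\sigma_1(B)\cap B=\emptyset$. Vertices, edges, and faces/boundaries are the cycles of $\sigma_0$, of $\sigma_1$, and of $\sigma_2$ outside/inside $B$. $\Gamma$ is connected if $\mathfrak h\ne\emptyset$ and $\langle\sigma_0,\sigma_1\rangle$ acts transitively on $\mathfrak h$, and trivalent if all cycles of $\sigma_0$ have length $3$. A connected $\Gamma$ has type $((g,b),n)$, with $g,b,n\ge 0$ integers, if it has $n$ faces, $b$ boundaries and $|v(\Gamma)|-|e(\Gamma)|+n+b=2-2g$. An $X$-coloring $c$ is a map from the faces to $X$; $\Gamma$ is face-marked if $X=\{1,\dots,n\}$ and $c$ is bijective. Isomorphisms preserve $\sigma_0,\sigma_1,B,c$. For $\lambda:X\to\mathbb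 R_{>0}$ put $\tilde\lambda_e=\lambda_{c(e_+)}+\lambda_{c(e_-)}$ if the edge $e$ has the faces $e_\pm$ on its two sides, $\tilde\lambda_e=\lambda_{c(e)}$ if $e$ has a boundary on one side and a face of color $c(e)$ on the other, and $$w_\lambda(\Gamma)=\frac{2^{|e(\Gamma)|-|v(\Gamma)|}}{|\mathrm{Aut}\,\Gamma|}\prod_{e}\frac1{\tilde\lambda_e}.$$ **Volumes.** On the space $\mathbb R_{>0}^{e(\Gamma)}$ of edge lengths let $\Omega=\frac12\sum_k\sum_{i<j}d\ell^{[k]}_i\wedge d\ell^{[k]}_j$, where $k$ runs over all face and boundary cycles and $\ell_1^{[k]},\ell_2^{[k]},\dots$ are the lengths of the successive edges along cycle $k$, from a chosen starting half-edge. Let $\mathrm{Vol}_{(g,b),n}(\vec x;\vec y)=\frac1{b!}\int\frac{\Omega^d}{d!}$, $d=3g-3+n+b$, be the orbifold integral over the part of the complex of connected face-marked metric ribbon graphs of type $((g,b),n)$ with labelled boundaries where the faces have perimeters $\vec x$ and the boundaries have perimeters $\vec y$ (only the top-dimensional cells, those of trivalent graphs, contribute), and let $$W_{(g,b),n}(\vec\mu)=\int_{\mathbb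 R_{>0}^n\times\mathbb R_{>0}^b}e^{-\vec\mu\cdot\vec x}\,\mathrm{Vol}_{(g,b),n}(\vec x;\vec y)\,d\vec x\,d\vec y .$$ **The Kontsevich–Penner model.** Let $N\ge0$, $\Lambda=\mathrm{diag}(\lambda_1,\dots,\lambda_N)$ with all $\lambda_i>0$, $Q\in\mathbb C$, and let $\langle f\rangle_\Lambda=\int_{\mathcal H_N}f(X)e^{-\mathrm{Tr}X^2\Lambda/2}dX\big/\int_{\mathcal H_N}e^{-\mathrm{Tr}X^2\Lambda/2}dX$ over Hermitian matrices. The asymptotic expansion for large $\Lambda$ of $\tau_Q=\det(\Lambda)^Q\,\frac{\int_{\mathcal H_N}\exp(-\mathrm{Tr}(X^3/3!+X^2\Lambda/2+Q\log(X+\Lambda)))dX}{\int_{\mathcal H_N}\exp(-\mathrm{Tr}X^2\Lambda/2)dX}$ is the formal power series $$\tau_Q=\Big\langle\exp\mathrm{Tr}\Big(-t\frac{X^3}{3!}+\sum_{k\ge1}\frac Qk(-t\Lambda^{-1}X)^k\Big)\Big\rangle_\Lambda\in\mathbb C[[t]],$$ the expectation being taken coefficientwise. Here $t$ records the order of the expansion: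 the series arises by replacing $\Lambda$ by $t^{-2/3}\Lambda$ and substituting $t^{1/3}X$ for $X$, so that the coefficient of $t^m$ is the part of degree $-3m/2$ in $\Lambda$. **Statement.** The integrals that define the coefficients of $\tau_Q$ converge, $\tau_Q$ has constant term $1$, and $F_Q=\log\tau_Q\in\mathbb C[[t]]$ satisfies the following for every $m\ge0$. 1. $[t^m]F_Q=\sum_{\Gamma}Q^{|b(\Gamma)|}\,w_\lambda(\Gamma)$, the sum over the isomorphism classes of connected trivalent $\{1,\dots,N\}$-colored ribbon graphs with $m$ vertices, where $b(\Gamma)$ is the set of boundaries of $\Gamma$. 2. $F_Q=\sum_{g,b,n}\frac{Q^b}{n!}\sum_{\phi:\{1,\dots,n\}\to\{1,\dots,N\}}W_{(g,b),n}(\lambda_{\phi(1)},\dots,\lambda_{\phi(n)})$ order by order: $[t^m]F_Q$ is the (finite) sum of the terms with $g,b,n\ge0$ and $4g-4+2b+2n=m$. 3. For all $g,b,n\ge 0$ and $\vec\mu\in\mathbb R_{>0}^n$ the integral that defines $W_{(g,b),n}(\vec\mu)$ converges absolutely, and $W_{(g,b),n}(\vec\mu)=\sum_\Gamma w_{\mu}(\Gamma)$,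 the sum over the isomorphism classes of trivalent face-marked ribbon graphs of type $((g,b),n)$ (connected by definition). In particular $W_{(g,b),n}(s\vec\mu)=s^{-(6g-6+3b+3n)}W_{(g,b),n}(\vec\mu)$ for $s>0$. -/

import Mathlib

open scoped BigOperators

namespace KontsevichPenner

noncomputable section

/-! ## Ribbon graphs with boundary -/

/-- The set of cycles of a permutation (fixed points count as cycles of length one). -/
abbrev PermCycle {H : Type} (σ : Equiv.Perm H) : Type :=
  Quotient (Equiv.Perm.SameCycle.setoid σ)

instance {H : Type} [Finite H] (σ : Equiv.Perm H) : Fintype (PermCycle σ) :=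
  Fintype.ofFinite _

/-- A ribbon graph with set of half-edges `H` (to be used with `H` finite). -/
structure RibbonGraph (H : Type) where
  /-- rotation around the vertices -/
  σ₀ : Equiv.Perm H
  /-- exchange of the two half-edges of an edge -/
  σ₁ : Equiv.Perm H
  /-- the set of boundary half-edges -/
  B : Set H
  σ₁_invol : ∀ x, σ₁ (σ₁ x) = x
  σ₁_ne : ∀ x, σ₁ x ≠ x
  B_cycle : ∀ x ∈ B, σ₀⁻¹ (σ₁ x) ∈ B
  B_edge : ∀ x ∈ B, σ₁ x ∉ B
  /-- no vertex has degree one or two -/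
  degree : ∀ x, σ₀ x ≠ x ∧ σ₀ (σ₀ x) ≠ x

namespace RibbonGraph

variable {H : Type} (G : RibbonGraph H)

/-- The permutation whose cycles are the face cycles and the boundary cycles. -/
def σ₂ : Equiv.Perm H := G.σ₀⁻¹ * G.σ₁

abbrev Vertex : Type := PermCycle G.σ₀

abbrev Edge : Type := PermCycle G.σ₁

/-- Face cycles and boundary cycles together. -/
abbrev Cycle : Type := PermCycle G.σ₂

/-- The edge that contains a half-edge. -/
def edge (x : H) : G.Edge := Quotient.mk _ x

/-- The (face or boundary) cycle that contains a half-edge. -/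
def cycle (x : H) : G.Cycle := Quotient.mk _ x

/-- The face cycles: cycles of `σ₂` outside `B`. -/
abbrev Face : Type := {q : G.Cycle // ∃ x, x ∉ G.B ∧ G.cycle x = q}

/-- The boundary cycles: cycles of `σ₂` inside `B`. -/
abbrev Boundary : Type := {q : G.Cycle // ∃ x, x ∈ G.B ∧ G.cycle x = q}

def numVertices : ℕ := Nat.card G.Vertex

def numEdges : ℕ := Nat.card G.Edge

def numFaces : ℕ := Nat.card G.Face

def numBoundaries : ℕ := Nat.card G.Boundary

def Trivalent : Prop := ∀ x, G.σ₀ (G.σ₀ (G.σ₀ x)) = x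

/-- Connected: `⟨σ₀, σ₁⟩` acts transitively on the non-empty set of half-edges. -/
def Connected : Prop :=
  Nonempty H ∧ ∀ x y : H, ∃ τ ∈ Subgroup.closure {G.σ₀, G.σ₁}, τ x = y

/-- `G` is connected of type `((g, b), n)`: it has `n` faces, `b` boundary cycles, and the closed
surface obtained by filling in all cycles has genus `g`, that is,
`#V - #E + (n + b) = 2 - 2g`. -/
def HasType (g b n : ℕ) : Prop :=
  G.Connected ∧ G.numFaces = n ∧ G.numBoundaries = b ∧
    (G.numVertices : ℤ) - G.numEdges + (n + b) = 2 - 2 * g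

/-! ### Perimeters, the Kontsevich form, and the induced volume -/

open Classical in
/-- The linear map that sends edge lengths `ℓ` to the perimeters of all the face and boundary
cycles. An edge that a cycle runs through twice is counted twice. -/
def perimeter [Fintype H] : (G.Edge → ℝ) →ₗ[ℝ] (G.Cycle → ℝ) where
  toFun ℓ q := ∑ x : H, if G.cycle x = q then ℓ (G.edge x) else 0
  map_add' ℓ ℓ' := by
    funext q
    simp only [Pi.add_apply, ← Finset.sum_add_distrib]
    exact Finset.sum_congr rfl fun x _ => by split_ifs <;> simp
  map_smul' c ℓ := by
    funext q
    simp only [Pi.smul_apply, smul_eq_mul, RingHom.id_apply, Finset.mul_sum]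
    exact Finset.sum_congr rfl fun x _ => by split_ifs <;> simp

/-- The number of half-edges in a cycle. -/
def cycleLength (q : G.Cycle) : ℕ := Nat.card {x : H // G.cycle x = q}

/-- The `i`-th edge along a cycle, counted from a chosen distinguished half-edge. -/
def cycleEdge (q : G.Cycle) (i : ℕ) : G.Edge := G.edge ((G.σ₂ ^ i) q.out)

/-- The Kontsevich 2-form `Ω = ½ ∑_k ∑_{i<j} dℓ_i^{[k]} ∧ dℓ_j^{[k]}` on the space of edge
lengths; `k` runs over all the face and boundary cycles. -/
def kontsevichForm [Fintype H] (u v : G.Edge → ℝ) : ℝ :=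
  (1 / 2) * ∑ q : G.Cycle, ∑ j ∈ Finset.range (G.cycleLength q), ∑ i ∈ Finset.range j,
    (u (G.cycleEdge q i) * v (G.cycleEdge q j) - u (G.cycleEdge q j) * v (G.cycleEdge q i))

/-- The volume `∫_S Ω^d / d!` of a subset `S` of a level set of `perimeter`, of dimension `2d`.
In linear coordinates `a` on the level set, given by a base point `ℓ₀` and a basis `v₁, …, v_{2d}`
of the kernel of `perimeter`, the density of `Ω^d / d!` is
`|(Ω^d / d!)(v₁, …, v_{2d})| = |Pf (Ω (vᵢ, vⱼ))| = √|det (Ω (vᵢ, vⱼ))|`.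
The volume does not depend on the base point; the supremum is only a way not to choose one
(it is `0` if `S` is empty). -/
def symplecticVolume [Fintype H] (S : Set (G.Edge → ℝ)) : ENNReal :=
  let K := LinearMap.ker G.perimeter
  let v : Fin (Module.finrank ℝ K) → (G.Edge → ℝ) := fun i => (Module.finBasis ℝ K i : G.Edge → ℝ)
  ENNReal.ofReal (Real.sqrt |(Matrix.of fun i j => G.kontsevichForm (v i) (v j)).det|) *
    ⨆ ℓ₀ ∈ S, MeasureTheory.volume {a : Fin (Module.finrank ℝ K) → ℝ | ℓ₀ + ∑ i, a i • v i ∈ S}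

end RibbonGraph

/-! ## Colored ribbon graphs and their isomorphism classes -/

/-- An `X`-colored ribbon graph: a ribbon graph with a map from its set of faces to `X`, given as
a map on the half-edges outside `B` that is invariant under `σ₂`. The half-edges are numbered;
only isomorphism classes will matter. -/
structure ColoredRibbonGraph (X : Type) where
  size : ℕ
  graph : RibbonGraph (Fin size)
  color : {x : Fin size // x ∉ graph.B} → X
  color_cycle : ∀ x y : {x : Fin size // x ∉ graph.B},
    graph.σ₂ (x : Fin size) = (y : Fin size) → color x = color y

namespace ColoredRibbonGraph

variable {X : Type}

/-- `a` is an isomorphism of colored ribbon graphs. -/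
def IsIso (Γ Γ' : ColoredRibbonGraph X) (a : Fin Γ.size ≃ Fin Γ'.size) : Prop :=
  (∀ x, a (Γ.graph.σ₀ x) = Γ'.graph.σ₀ (a x)) ∧
  (∀ x, a (Γ.graph.σ₁ x) = Γ'.graph.σ₁ (a x)) ∧
  (∀ x, a x ∈ Γ'.graph.B ↔ x ∈ Γ.graph.B) ∧
  (∀ x (hx : x ∉ Γ.graph.B) (hx' : a x ∉ Γ'.graph.B), Γ'.color ⟨a x, hx'⟩ = Γ.color ⟨x, hx⟩)

instance isoSetoid (X : Type) : Setoid (ColoredRibbonGraph X) where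
  r Γ Γ' := ∃ a, IsIso Γ Γ' a
  iseqv :=
    { refl := fun Γ => ⟨Equiv.refl _, by simp [IsIso]⟩
      symm := by
        rintro Γ Γ' ⟨a, h0, h1, hB, hc⟩
        refine ⟨a.symm, fun x => ?_, fun x => ?_, fun x => ?_, fun x hx hx' => ?_⟩
        · rw [Equiv.symm_apply_eq, h0, Equiv.apply_symm_apply]
        · rw [Equiv.symm_apply_eq, h1, Equiv.apply_symm_apply]
        · rw [← hB, Equiv.apply_symm_apply]
        · have := hc (a.symm x) hx' (by simpa using hx)
          rw [← this]
          simp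
      trans := by
        rintro Γ Γ' Γ'' ⟨a, h0, h1, hB, hc⟩ ⟨a', h0', h1', hB', hc'⟩
        refine ⟨a.trans a', fun x => ?_, fun x => ?_, fun x => ?_, fun x hx hx' => ?_⟩
        · simp [h0, h0']
        · simp [h1, h1']
        · simp [hB, hB']
        · exact (hc' (a x) (fun h => hx ((hB x).1 h)) hx').trans (hc x hx _) }

/-- Isomorphism classes of `X`-colored ribbon graphs. -/
abbrev IsoClass (X : Type) : Type := Quotient (isoSetoid X)

/-- The order of the automorphism group. -/
def autCard (Γ : ColoredRibbonGraph X) : ℕ := Nat.card {a // IsIso Γ Γ a}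

/-- The coloring is a bijection from the set of faces to `X`. -/
def FaceMarked (Γ : ColoredRibbonGraph X) : Prop :=
  Function.Surjective Γ.color ∧
    ∀ x y, Γ.color x = Γ.color y → Γ.graph.cycle (x : Fin Γ.size) = Γ.graph.cycle y

open Classical in
/-- The edge weight: the sum of `lam (c x)` over those half-edges `x` of the edge `e` that lie on
a face. It is `lam (c e₊) + lam (c e₋)` for an internal edge, and `lam (c e)` for a boundary
edge, which has a face on exactly one side. -/
def edgeWeight (Γ : ColoredRibbonGraph X) (lam : X → ℝ) (e : Γ.graph.Edge) : ℝ :=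
  ∑ x : {x : Fin Γ.size // x ∉ Γ.graph.B}, if Γ.graph.edge x = e then lam (Γ.color x) else 0

/-- The contribution `2^(#E - #V) / #Aut · ∏_e 1 / λ̃_e` of a colored ribbon graph. -/
def weight (Γ : ColoredRibbonGraph X) (lam : X → ℝ) : ℝ :=
  (2 : ℝ) ^ ((Γ.graph.numEdges : ℤ) - Γ.graph.numVertices) / Γ.autCard *
    ∏ e : Γ.graph.Edge, (Γ.edgeWeight lam e)⁻¹

/-- The metrics on a colored graph with labelled boundary cycles for which the faces of color `i`
have perimeter `x i` and the boundary with label `j` has perimeter `y j`. -/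
def metricFiber {n b : ℕ} (Γ : ColoredRibbonGraph (Fin n)) (β : Γ.graph.Boundary ≃ Fin b)
    (x : Fin n → ℝ) (y : Fin b → ℝ) : Set (Γ.graph.Edge → ℝ) :=
  {ℓ | (∀ e, 0 < ℓ e) ∧
    (∀ h : {h : Fin Γ.size // h ∉ Γ.graph.B},
      Γ.graph.perimeter ℓ (Γ.graph.cycle h) = x (Γ.color h)) ∧
    ∀ q : Γ.graph.Boundary, Γ.graph.perimeter ℓ q = y (β q)}

end ColoredRibbonGraph

/-! ## Volumes of the open ribbon graph complex and their Laplace transforms -/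

/-- The trivalent face-marked ribbon graphs of type `((g, b), n)`. -/
def IsTopCell (g b n : ℕ) (Γ : ColoredRibbonGraph (Fin n)) : Prop :=
  Γ.graph.HasType g b n ∧ Γ.FaceMarked ∧ Γ.graph.Trivalent

/-- `Vol_{(g,b),n}(x; y) = (1 / b!) ∫ Ω^d / d!` over the level set `(x; y)` of the perimeter map on
the complex of face-marked metric ribbon graphs with labelled boundaries. This is an orbifold
integral over the top-dimensional cells, which belong to the trivalent graphs `Γ`: the part over
`Γ` of the `b!`-fold cover by boundary labellings is (metrics × labellings) / `Aut Γ`. -/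
def openVol (g b n : ℕ) (x : Fin n → ℝ) (y : Fin b → ℝ) : ℝ :=
  (1 / (b.factorial : ℝ)) *
    ∑ᶠ (q : ColoredRibbonGraph.IsoClass (Fin n)) (_ : IsTopCell g b n q.out),
      (1 / (q.out.autCard : ℝ)) * ∑ᶠ β : q.out.graph.Boundary ≃ Fin b,
        (q.out.graph.symplecticVolume (q.out.metricFiber β x y)).toReal

/-- The positive orthant in the space of all perimeters `(x; y)`. -/
def orthant (n b : ℕ) : Set ((Fin n → ℝ) × (Fin b → ℝ)) :=
  {z | (∀ i, 0 < z.1 i) ∧ ∀ j, 0 < z.2 j}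

/-- The integrand `exp (-μ · x) Vol_{(g,b),n}(x; y)`. -/
def laplaceIntegrand (g b n : ℕ) (μ : Fin n → ℝ) (z : (Fin n → ℝ) × (Fin b → ℝ)) : ℝ :=
  Real.exp (-∑ i, μ i * z.1 i) * openVol g b n z.1 z.2

/-- `W_{(g,b),n}(μ)`, the integral of `exp (-μ · x) Vol_{(g,b),n}(x; y)` over all positive
`x` and `y`. -/
def openW (g b n : ℕ) (μ : Fin n → ℝ) : ℝ :=
  ∫ z in orthant n b, laplaceIntegrand g b n μ z

/-! ## The Kontsevich–Penner model -/

/-- The Hermitian `N × N` matrix with real coordinates `u`: diagonal entries `u (i, i)`, and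
entries `u (i, j) ± √-1 u (j, i)` for `i < j` above, respectively below, the diagonal. This is a
linear bijection onto the space of Hermitian matrices, so that Lebesgue measure in `u` is `dX`
up to a constant that cancels in the normalized expectation. -/
def hermitian {N : ℕ} (u : Fin N × Fin N → ℝ) : Matrix (Fin N) (Fin N) ℂ :=
  Matrix.of fun i j =>
    if i = j then (u (i, i) : ℂ)
    else if i < j then (u (i, j) : ℂ) + Complex.I * u (j, i)
    else (u (j, i) : ℂ) - Complex.I * u (i, j)

/-- The diagonal matrix `Λ`. -/
def diagMatrix {N : ℕ} (lam : Fin N → ℝ) : Matrix (Fin N) (Fin N) ℂ :=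
  Matrix.diagonal fun i => (lam i : ℂ)

/-- The Gaussian weight `exp (-½ Tr (X² Λ))`. -/
def gaussianWeight {N : ℕ} (lam : Fin N → ℝ) (M : Matrix (Fin N) (Fin N) ℂ) : ℂ :=
  Complex.exp (-(1 / 2) * (M ^ 2 * diagMatrix lam).trace)

/-- The normalized Gaussian expectation over Hermitian matrices. -/
def expectation {N : ℕ} (lam : Fin N → ℝ) (f : Matrix (Fin N) (Fin N) ℂ → ℂ) : ℂ :=
  (∫ u : Fin N × Fin N → ℝ, f (hermitian u) * gaussianWeight lam (hermitian u)) /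
    ∫ u : Fin N × Fin N → ℝ, gaussianWeight lam (hermitian u)

/-- The interaction `Tr (-t X³ / 3! + ∑_{k ≥ 1} (Q / k) (-t Λ⁻¹ X)^k)`, that is,
`-Tr (t X³ / 3! + Q log (1 + t Λ⁻¹ X))`, as a power series in `t`.

The variable `t` records the order of the expansion for large `Λ`: replacing `Λ` by `t^(-2/3) Λ`
and substituting `t^(1/3) X` for `X` turns
`Tr (X³ / 3! + X² Λ / 2 + Q log (X + Λ)) - Q Tr log Λ` into
`Tr (t X³ / 3! + X² Λ / 2 + Q log (1 + t Λ⁻¹ X))`. -/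
def interaction {N : ℕ} (lam : Fin N → ℝ) (Q : ℂ) (M : Matrix (Fin N) (Fin N) ℂ) :
    PowerSeries ℂ :=
  PowerSeries.mk fun k =>
    (if k = 1 then -(M ^ 3).trace / 6 else 0) +
      if k = 0 then 0 else (Q / k) * ((-(diagMatrix (fun i => (lam i)⁻¹) * M)) ^ k).trace

/-- The power series in `t` of the exponential of the interaction. -/
def expInteraction {N : ℕ} (lam : Fin N → ℝ) (Q : ℂ) (M : Matrix (Fin N) (Fin N) ℂ) :
    PowerSeries ℂ :=
  (PowerSeries.exp ℂ).subst (interaction lam Q M)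

/-- The asymptotic expansion of the Kontsevich–Penner integral `τ_Q` for large `Λ`: the
exponential of the interaction is expanded in `t` and integrated term by term. The coefficient of
`t^m` is homogeneous in `Λ` of degree `-3m/2`. -/
def tau {N : ℕ} (lam : Fin N → ℝ) (Q : ℂ) : PowerSeries ℂ :=
  PowerSeries.mk fun m => expectation lam fun M => PowerSeries.coeff m (expInteraction lam Q M)

/-- The free energy `F_Q = log τ_Q`. -/
def freeEnergy {N : ℕ} (lam : Fin N → ℝ) (Q : ℂ) : PowerSeries ℂ :=
  PowerSeries.logOf (tau lam Q)

end

end KontsevichPenner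

open KontsevichPenner

namespace KontsevichPenner

/-! ## Exponential and logarithm of power series -/

/-! Both the matrix integral and the volumes expand over trivalent ribbon graphs; the content lies
in the matching of the powers of 2 and of the symmetry factors. Write `V`, `E`, `C` for the numbers
of vertices, edges and cycles of `σ₂`.

Matrix side. The exponential of `∑ (Q/k) t^k Tr A^k` has coefficients `1/r! ∑_π Q^(cycles of π) ∏ Tr
A^(length)`, with `π` in the symmetric group on `r` points (`coeff_expInteraction`). A factor `Tr
X³` is a trivalent vertex off the boundaries, a point of `π` is a trivalent vertex with one corner
on a boundary, and the cycles of `π` are the boundaries. The choice of `r` among `m` vertices and of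
a corner at each produces the common prefactor `1/(m! 6^m)`. Wick's theorem
(`gaussianExp_prod_linForm`) pairs the remaining half-edges, and the index equations of the
covariance say that colors are constant along faces. Thus `m! 6^m [t^m] τ` is the sum of `Q^b ∏
2/λ̃_e` over all colored graph structures on `m` fixed triangles (`coeff_tau_eq_sum`). Splitting off
the component of one vertex (`strTotal_fin_succ`) is the equation `τ' = τ F'`, so `F` is the same
sum over connected structures. An isomorphism class contains `m! 3^m / |Aut|` structures
(`card_str_mul_autCard`), which leaves the weight `2^(E-V) / |Aut| ∏ 1/λ̃_e`.

Volume side. For a trivalent graph, `Ω^d/d!` on the level sets of the perimeter map times Lebesgue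
measure of the perimeters is `2^(E-V)` times Lebesgue measure of the edge lengths
(`lintegral_symplecticVolume`). Since `∑ μ_i x_i = ∑ λ̃_e ℓ_e`, the Laplace transform of a cell is
`2^(E-V) ∏ 1/λ̃_e`. The constant comes from the Kontsevich matrix bordered by the perimeter map:
`det (1 - AB) = det (1 - BA)` turns its determinant into that of `P_σ₁ + P_σ₂ = P_σ₁ (1 + P_σ₀ᵀ)`,
which is `±2^V` because each 3-cycle contributes 2. Finally `V = 2 (E - V)`.

Comparison. A coloring of a graph with `n` faces is a marking followed by a map of colors in `n!`
ways (`card_marked_of_map`). A connected trivalent graph has a genus in `ℕ` (`exists_genus`):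
nonnegative because coboundaries of vertex functions and of cycle functions are orthogonal, integral
because the skew Kontsevich form is nondegenerate on a space of dimension `E - C`. -/

theorem constantCoeff_subst_of_constantCoeff_zero {f g : PowerSeries ℂ}
    (hg : PowerSeries.constantCoeff g = 0) :
    PowerSeries.constantCoeff (f.subst g) = PowerSeries.constantCoeff f := by
  have hs := PowerSeries.HasSubst.of_constantCoeff_zero' hg
  have h : f = PowerSeries.C (PowerSeries.constantCoeff f) +
      (f - PowerSeries.C (PowerSeries.constantCoeff f)) := by ring
  have h2 : PowerSeries.constantCoeff
      ((f - PowerSeries.C (PowerSeries.constantCoeff f)).subst g) = 0 :=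
    PowerSeries.constantCoeff_subst_eq_zero hg _ (by simp)
  have h3 (a : ℂ) : (PowerSeries.C a).subst g = (PowerSeries.C a : PowerSeries ℂ) := by
    have := (PowerSeries.substAlgHom hs).commutes a
    rwa [PowerSeries.coe_substAlgHom] at this
  conv_lhs => rw [h, PowerSeries.subst_add hs, map_add, h2, h3]
  simp

/-- The equation expresses `n + 1` times the coefficient of degree `n + 1` through those of degree
at most `n`. Exponentials and logarithms are identified below through such equations, without
expanding substitutions. -/
theorem linear_ode_unique {f f' h : PowerSeries ℂ}
    (h0 : PowerSeries.constantCoeff f = PowerSeries.constantCoeff f')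
    (hf : PowerSeries.derivative ℂ f = f * h) (hf' : PowerSeries.derivative ℂ f' = f' * h) :
    f = f' := by
  ext n
  induction n using Nat.strong_induction_on with
  | _ n ih =>
    cases n with
    | zero => simpa using h0
    | succ n =>
      have e1 := congrArg (PowerSeries.coeff n) hf
      have e2 := congrArg (PowerSeries.coeff n) hf'
      rw [PowerSeries.coeff_derivative, PowerSeries.coeff_mul] at e1 e2
      have h3 : (n : ℂ) + 1 ≠ 0 := by exact_mod_cast Nat.succ_ne_zero n
      refine mul_right_cancel₀ h3 (e1.trans (Eq.trans ?_ e2.symm))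
      refine Finset.sum_congr rfl fun p hp => ?_
      rw [ih p.1 (by have := Finset.HasAntidiagonal.mem_antidiagonal.1 hp; omega)]

theorem eq_exp_subst {f g : PowerSeries ℂ} (hf : PowerSeries.constantCoeff f = 1)
    (hg : PowerSeries.constantCoeff g = 0)
    (h : PowerSeries.derivative ℂ f = f * PowerSeries.derivative ℂ g) :
    f = (PowerSeries.exp ℂ).subst g := by
  have hs := PowerSeries.HasSubst.of_constantCoeff_zero' hg
  refine linear_ode_unique ?_ h ?_
  · rw [hf, constantCoeff_subst_of_constantCoeff_zero hg, PowerSeries.constantCoeff_exp]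
  · rw [PowerSeries.derivative_subst hs, PowerSeries.derivative_exp]

/-- Substituting `f - 1` into `log' · (1 + X) = 1` shows that `log f` has the derivative `f' / f`,
which is that of `F`. The hypothesis `h` has the shape of the recursion that removes one connected
component. -/
theorem logOf_eq_of_derivative {f F : PowerSeries ℂ} (hf : PowerSeries.constantCoeff f = 1)
    (hF : PowerSeries.constantCoeff F = 0)
    (h : PowerSeries.derivative ℂ f = f * PowerSeries.derivative ℂ F) :
    PowerSeries.logOf f = F := by
  have hs : PowerSeries.HasSubst (f - 1) := PowerSeries.HasSubst.of_constantCoeff_zero' (by simp [hf])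
  have hl : PowerSeries.derivative ℂ (PowerSeries.log ℂ) * (1 + PowerSeries.X) = 1 := by
    rw [PowerSeries.deriv_log]
    ext n
    rw [mul_add, mul_one, map_add]
    cases n with
    | zero => simp
    | succ n => rw [PowerSeries.coeff_succ_mul_X]; simp [PowerSeries.coeff_one, pow_succ]
  have h1 : (PowerSeries.derivative ℂ (PowerSeries.log ℂ)).subst (f - 1) * f = 1 := by
    have := congrArg (PowerSeries.subst (f - 1)) hl
    rw [PowerSeries.subst_mul hs, PowerSeries.subst_add hs, PowerSeries.subst_X hs] at this
    have h1 : PowerSeries.subst (f - 1) (1 : PowerSeries ℂ) = 1 := by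
      rw [← PowerSeries.coe_substAlgHom hs, map_one]
    rw [h1] at this
    simpa using this
  have hd : PowerSeries.derivative ℂ (PowerSeries.logOf f) = PowerSeries.derivative ℂ F := by
    rw [PowerSeries.logOf_eq, PowerSeries.derivative_subst hs, map_sub, h]
    simp only [Derivation.map_one_eq_zero, sub_zero, ← mul_assoc]
    rw [h1, one_mul]
  exact PowerSeries.derivative.ext hd (by rw [PowerSeries.constantCoeff_logOf hf, hF])

/-! ## Counting cycles of permutations -/

open Equiv.Perm in
-- The map need not intertwine the permutations, so it may skip or collapse points; with `σ' = 1` it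
-- says that a `σ`-invariant function is constant on cycles.
theorem sameCycle_map {α β : Type*} {σ : Equiv.Perm α} {σ' : Equiv.Perm β} (f : α → β)
    (hf : ∀ x, SameCycle σ' (f x) (f (σ x))) {x y : α} (h : SameCycle σ x y) :
    SameCycle σ' (f x) (f y) := by
  obtain ⟨i, rfl⟩ := h
  induction i with
  | zero => exact SameCycle.refl _ _
  | succ i ih =>
    have := ih.trans (hf _)
    rwa [← mul_apply, ← zpow_one_add, add_comm] at this
  | pred i ih =>
    refine ih.trans (SameCycle.symm ?_)
    have := hf ((σ ^ (-(i : ℤ) - 1)) x)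
    rwa [← mul_apply, ← zpow_one_add, add_sub_cancel] at this

open Equiv.Perm in
theorem sameCycle_map_iff {α β : Type*} {σ : Equiv.Perm α} {σ' : Equiv.Perm β} {f : α → β}
    (hinj : Function.Injective f) (hf : ∀ x, f (σ x) = σ' (f x)) {x y : α} :
    SameCycle σ' (f x) (f y) ↔ SameCycle σ x y := by
  refine ⟨?_, sameCycle_map f fun x => by rw [hf]; exact (SameCycle.refl _ _).apply_right⟩
  have hz : ∀ (i : ℤ) (x : α), f ((σ ^ i) x) = (σ' ^ i) (f x) := by
    intro i
    induction i with
    | zero => simp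
    | succ i ih => intro x; rw [zpow_add_one, zpow_add_one, mul_apply, mul_apply, ih, hf]
    | pred i ih =>
      intro x
      rw [zpow_sub_one, zpow_sub_one, mul_apply, mul_apply, ih]
      congr 1
      rw [eq_inv_iff_eq, ← hf, ← mul_apply, mul_inv_cancel, one_apply]
  rintro ⟨i, hi⟩
  exact ⟨i, hinj (by rw [hz, hi])⟩

/-- The cycles of `σ` that contain an element satisfying `p`. -/
abbrev CyclesIn {α : Type} (σ : Equiv.Perm α) (p : α → Prop) : Type :=
  {q : PermCycle σ // ∃ x, p x ∧ Quotient.mk (Equiv.Perm.SameCycle.setoid σ) x = q}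

open Equiv.Perm in
theorem card_cyclesIn_congr {α β : Type} {σ : Equiv.Perm α} {σ' : Equiv.Perm β} {p : α → Prop}
    {p' : β → Prop} (f : α → β) (hp : ∀ x, p x → p' (f x))
    (hiff : ∀ x y, p x → p y → (SameCycle σ' (f x) (f y) ↔ SameCycle σ x y))
    (hsurj : ∀ y, p' y → ∃ x, p x ∧ SameCycle σ' (f x) y) :
    Nat.card (CyclesIn σ p) = Nat.card (CyclesIn σ' p') := by
  have hc : ∀ q : CyclesIn σ p, ∃ x, p x ∧ Quotient.mk (SameCycle.setoid σ) x = q := fun q => q.2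
  choose r hr hr' using hc
  refine Nat.card_eq_of_bijective (fun q => ⟨Quotient.mk _ (f (r q)), f (r q), hp _ (hr q), rfl⟩)
    ⟨fun q q' h => ?_, fun q => ?_⟩
  · have h1 : SameCycle σ' (f (r q)) (f (r q')) := Quotient.exact (congrArg Subtype.val h)
    rw [hiff _ _ (hr q) (hr q')] at h1
    exact Subtype.ext ((hr' q).symm.trans ((Quotient.sound h1).trans (hr' q')))
  · obtain ⟨q, y, hy, rfl⟩ := q
    obtain ⟨x, hx, hxy⟩ := hsurj y hy
    let q0 : CyclesIn σ p := ⟨Quotient.mk _ x, x, hx, rfl⟩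
    have h2 : SameCycle σ (r q0) x := Quotient.exact (hr' q0)
    exact ⟨q0, Subtype.ext (Quotient.sound (((hiff _ _ (hr q0) hx).2 h2).trans hxy))⟩

theorem card_permCycle_eq_cyclesIn {α : Type} (σ : Equiv.Perm α) :
    Nat.card (PermCycle σ) = Nat.card (CyclesIn σ fun _ => True) := by
  refine Nat.card_congr (Equiv.subtypeUnivEquiv fun q => ?_).symm
  induction q using Quotient.inductionOn with
  | h x => exact ⟨x, trivial, rfl⟩

open Equiv.Perm in
theorem card_permCycle_congr {α β : Type} {σ : Equiv.Perm α} {σ' : Equiv.Perm β} (f : α → β)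
    (hiff : ∀ x y, SameCycle σ' (f x) (f y) ↔ SameCycle σ x y)
    (hsurj : ∀ y, ∃ x, SameCycle σ' (f x) y) :
    Nat.card (PermCycle σ) = Nat.card (PermCycle σ') := by
  rw [card_permCycle_eq_cyclesIn, card_permCycle_eq_cyclesIn]
  exact card_cyclesIn_congr f (fun _ _ => trivial) (fun x y _ _ => hiff x y)
    fun y _ => (hsurj y).imp fun x hx => ⟨trivial, hx⟩

theorem card_permCycle_conj {α β : Type} {σ : Equiv.Perm α} {σ' : Equiv.Perm β} (f : α ≃ β)
    (hf : ∀ x, f (σ x) = σ' (f x)) : Nat.card (PermCycle σ) = Nat.card (PermCycle σ') :=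
  card_permCycle_congr f (fun _ _ => sameCycle_map_iff f.injective hf)
    fun y => ⟨f.symm y, by rw [f.apply_symm_apply]⟩

/-- Cycles inside a disjoint union of two invariant subsets. -/
theorem card_cyclesIn_sum {α β : Type} [Finite α] [Finite β] (σ : Equiv.Perm α)
    (σ' : Equiv.Perm β) (p : α ⊕ β → Prop) :
    Nat.card (CyclesIn (Equiv.Perm.sumCongr σ σ') p) =
      Nat.card (CyclesIn σ fun x => p (Sum.inl x)) +
        Nat.card (CyclesIn σ' fun x => p (Sum.inr x)) := by
  classical
  let τ := Equiv.Perm.sumCongr σ σ'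
  have hl : ∀ x y, Equiv.Perm.SameCycle τ (Sum.inl x) (Sum.inl y) ↔ Equiv.Perm.SameCycle σ x y :=
    fun x y => sameCycle_map_iff Sum.inl_injective fun x => rfl
  have hr : ∀ x y, Equiv.Perm.SameCycle τ (Sum.inr x) (Sum.inr y) ↔ Equiv.Perm.SameCycle σ' x y :=
    fun x y => sameCycle_map_iff Sum.inr_injective fun x => rfl
  -- `Sum.isLeft` is invariant under `τ`, hence constant along its cycles.
  have hlr : ∀ x y, ¬ Equiv.Perm.SameCycle τ (Sum.inl x) (Sum.inr y) := fun x y h => by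
    have := sameCycle_map (σ := τ) (σ' := (1 : Equiv.Perm Bool)) Sum.isLeft
      (by rintro (x | x) <;> exact Equiv.Perm.SameCycle.refl _ _) h
    simp at this
  have h1 : Nat.card (CyclesIn σ fun x => p (Sum.inl x)) =
      Nat.card (CyclesIn τ fun z => p z ∧ z.isLeft) :=
    card_cyclesIn_congr Sum.inl (fun x hx => ⟨hx, rfl⟩) (fun x y _ _ => hl x y) (by
      rintro (y | y) hy
      · exact ⟨y, hy.1, Equiv.Perm.SameCycle.refl _ _⟩
      · simp at hy)
  have h2 : Nat.card (CyclesIn σ' fun x => p (Sum.inr x)) =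
      Nat.card (CyclesIn τ fun z => p z ∧ z.isRight) :=
    card_cyclesIn_congr Sum.inr (fun x hx => ⟨hx, rfl⟩) (fun x y _ _ => hr x y) (by
      rintro (y | y) hy
      · simp at hy
      · exact ⟨y, hy.1, Equiv.Perm.SameCycle.refl _ _⟩)
  rw [h1, h2, ← Nat.card_sum]
  have hd : Disjoint
      (fun q : PermCycle τ => ∃ z, (p z ∧ z.isLeft) ∧ Quotient.mk (Equiv.Perm.SameCycle.setoid τ) z = q)
      (fun q => ∃ z, (p z ∧ z.isRight) ∧ Quotient.mk (Equiv.Perm.SameCycle.setoid τ) z = q) := by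
    rw [Pi.disjoint_iff]
    intro q
    rw [Prop.disjoint_iff, not_and]
    rintro ⟨x | x, hx, rfl⟩ ⟨y | y, hy, h⟩
    · simp at hy
    · exact hlr _ _ (Quotient.exact h).symm
    · simp at hx
    · simp at hx
  refine Nat.card_congr (Equiv.trans (Equiv.subtypeEquivRight fun q => ?_) (subtypeOrEquiv _ _ hd))
  constructor
  · rintro ⟨x | x, hx, h⟩
    · exact Or.inl ⟨_, ⟨hx, rfl⟩, h⟩
    · exact Or.inr ⟨_, ⟨hx, rfl⟩, h⟩
  · rintro (⟨x, hx, h⟩ | ⟨x, hx, h⟩)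
    · exact ⟨x, hx.1, h⟩
    · exact ⟨x, hx.1, h⟩

theorem card_permCycle_optionCongr {α : Type} [Finite α] (π : Equiv.Perm α) :
    Nat.card (PermCycle (Equiv.optionCongr π)) = Nat.card (PermCycle π) + 1 := by
  have h := card_permCycle_conj (σ := Equiv.optionCongr π)
    (σ' := Equiv.Perm.sumCongr π (1 : Equiv.Perm PUnit.{1})) (Equiv.optionEquivSumPUnit.{0} α)
    (by rintro (_ | x) <;> simp)
  rw [h, card_permCycle_eq_cyclesIn, card_cyclesIn_sum, ← card_permCycle_eq_cyclesIn,
    ← card_permCycle_eq_cyclesIn]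
  congr 1
  rw [Nat.card_eq_one_iff_unique]
  exact ⟨⟨fun a b => by
    induction a using Quotient.inductionOn
    induction b using Quotient.inductionOn
    rfl⟩, ⟨Quotient.mk _ PUnit.unit⟩⟩

section

variable {α : Type} [DecidableEq α]

/-- The permutation of `Option α` obtained from `π` by inserting `none` after `k`. -/
def insertAfter (π : Equiv.Perm α) (k : α) : Equiv.Perm (Option α) :=
  Equiv.swap none (some (π k)) * Equiv.optionCongr π

theorem insertAfter_none (π : Equiv.Perm α) (k : α) : insertAfter π k none = some (π k) := by
  simp [insertAfter]

theorem insertAfter_some_self (π : Equiv.Perm α) (k : α) : insertAfter π k (some k) = none := by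
  simp [insertAfter]

theorem insertAfter_some_of_ne (π : Equiv.Perm α) {k a : α} (h : a ≠ k) :
    insertAfter π k (some a) = some (π a) := by
  simp only [insertAfter, Equiv.Perm.coe_mul, Function.comp_apply, Equiv.optionCongr_apply,
    Option.map_some]
  exact Equiv.swap_apply_of_ne_of_ne (by simp) (by simpa using h)

/-- Splicing in a point lengthens a cycle and creates none. The inclusion `some` respects cycles,
and the retraction sending `none` to `π k` shows that it merges no two of them. -/
theorem card_permCycle_insertAfter (π : Equiv.Perm α) (k : α) :
    Nat.card (PermCycle (insertAfter π k)) = Nat.card (PermCycle π) := by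
  symm
  have hs : ∀ x, Equiv.Perm.SameCycle (insertAfter π k) (some x) (some (π x)) := by
    intro x
    by_cases hx : x = k
    · subst hx
      refine ⟨2, ?_⟩
      rw [zpow_two, Equiv.Perm.mul_apply, insertAfter_some_self, insertAfter_none]
    · exact ⟨1, by rw [zpow_one, insertAfter_some_of_ne _ hx]⟩
  refine card_permCycle_congr some (fun x y => ⟨fun h => ?_, sameCycle_map some hs⟩) ?_
  · refine sameCycle_map (fun o : Option α => o.getD (π k)) ?_ h
    rintro (_ | a)
    · rw [insertAfter_none]; exact Equiv.Perm.SameCycle.refl _ _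
    · by_cases ha : a = k
      · subst ha
        rw [insertAfter_some_self]
        exact (Equiv.Perm.SameCycle.refl _ _).apply_right
      · rw [insertAfter_some_of_ne _ ha]
        exact (Equiv.Perm.SameCycle.refl _ _).apply_right
  · rintro (_ | y)
    · exact ⟨k, 1, by rw [zpow_one, insertAfter_some_self]⟩
    · exact ⟨y, Equiv.Perm.SameCycle.refl _ _⟩

end

/-! ## Sums over permutations weighted by traces along the cycles -/

section PermSum

variable {R : Type*} [CommRing R] {n : Type} [Fintype n]

/-- `∑_π Q^(number of cycles) ∏_(cycles) Tr (product of the matrices along the cycle)`. -/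
noncomputable def permSum (α : Type) [Fintype α] [DecidableEq α] (Q : R) (M : α → Matrix n n R) :
    R :=
  ∑ π : Equiv.Perm α, Q ^ Nat.card (PermCycle π) * ∑ i : α → n, ∏ a, M a (i (π a)) (i a)

theorem permSum_equiv {α β : Type} [Fintype α] [DecidableEq α] [Fintype β] [DecidableEq β]
    (e : α ≃ β) (Q : R) (M : β → Matrix n n R) :
    permSum α Q (fun a => M (e a)) = permSum β Q M := by
  unfold permSum
  refine Fintype.sum_equiv e.permCongr _ _ fun π => ?_
  refine congrArg₂ (· * ·) (congrArg (Q ^ ·) ?_) ?_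
  · exact card_permCycle_conj e fun x => by simp
  · refine Fintype.sum_equiv (e.arrowCongr (Equiv.refl n)) _ _ fun i => ?_
    refine Fintype.prod_equiv e _ _ fun a => by simp [Equiv.arrowCongr]

/-- Either `none` is fixed, a new cycle with factor `Q * D.trace`, or it is inserted after a unique
`k`; the sum over the index at `none` then multiplies `M k` by `D` on the left. -/
theorem permSum_option {α : Type} [Fintype α] [DecidableEq α] (Q : R) (M : α → Matrix n n R)
    (D : Matrix n n R) :
    permSum (Option α) Q (fun o => o.elim D M) =
      Q * D.trace * permSum α Q M + ∑ k, permSum α Q (Function.update M k (D * M k)) := by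
  unfold permSum
  rw [← Equiv.Perm.decomposeOption.symm.sum_comp, Fintype.sum_prod_type, Fintype.sum_option]
  simp only [Equiv.Perm.decomposeOption_symm_apply]
  congr 1
  · rw [Finset.mul_sum]
    refine Finset.sum_congr rfl fun π _ => ?_
    rw [Equiv.swap_self, ← Equiv.Perm.one_def, one_mul, card_permCycle_optionCongr,
      ← (Equiv.piOptionEquivProd (α := α) (β := fun _ => n)).symm.sum_comp, Fintype.sum_prod_type,
      pow_succ]
    simp only [Fintype.prod_option, Equiv.optionCongr_apply, Option.map_none, Option.map_some,
      Option.elim_none, Option.elim_some, Equiv.piOptionEquivProd_symm_apply]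
    simp only [← Finset.mul_sum, ← Finset.sum_mul, Matrix.trace, Matrix.diag_apply]
    ring
  · rw [Finset.sum_comm, Finset.sum_comm (s := (Finset.univ : Finset α))]
    refine Finset.sum_congr rfl fun π _ => ?_
    -- `decomposeOption` records the image of `none`; the substitution `π k` for it passes to the
    -- predecessor `k`.
    rw [← Equiv.sum_comp π]
    refine Finset.sum_congr rfl fun k _ => ?_
    change Q ^ Nat.card (PermCycle (insertAfter π k)) * (∑ i : Option α → n, ∏ a,
      (a.elim D M : Matrix n n R) (i (insertAfter π k a)) (i a)) = _
    rw [card_permCycle_insertAfter]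
    congr 1
    rw [← (Equiv.piOptionEquivProd (α := α) (β := fun _ => n)).symm.sum_comp,
      Fintype.sum_prod_type, Finset.sum_comm]
    refine Finset.sum_congr rfl fun i _ => ?_
    simp only [Fintype.prod_option, Option.elim_none, Option.elim_some]
    rw [← Finset.mul_prod_erase Finset.univ _ (Finset.mem_univ k)]
    simp only [Function.update_self, Matrix.mul_apply, Finset.sum_mul]
    refine Finset.sum_congr rfl fun x _ => ?_
    rw [← Finset.mul_prod_erase Finset.univ _ (Finset.mem_univ k), insertAfter_none,
      insertAfter_some_self, ← mul_assoc]
    congr 1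
    refine Finset.prod_congr rfl fun a ha => ?_
    have hak := (Finset.mem_erase.1 ha).1
    rw [Function.update_of_ne hak, insertAfter_some_of_ne _ hak]
    rfl

theorem permSum_fin_zero (Q : R) (M : Fin 0 → Matrix n n R) : permSum (Fin 0) Q M = 1 := by
  have : IsEmpty (PermCycle (1 : Equiv.Perm (Fin 0))) := ⟨fun q => by
    induction q using Quotient.inductionOn with | h x => exact x.elim0⟩
  simp [permSum, Subsingleton.elim _ (1 : Equiv.Perm (Fin 0))]

theorem permSum_map {S : Type*} [CommRing S] (f : R →+* S) {α : Type} [Fintype α] [DecidableEq α]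
    (Q : R) (M : α → Matrix n n R) :
    f (permSum α Q M) = permSum α (f Q) (fun a => (M a).map f) := by
  simp [permSum]

variable [DecidableEq n]

/-- Iteration of `permSum_option`: the cycle of `none`, which already carries `A ^ p`, absorbs `k`
further points before it closes, and `r.descFactorial k` counts the ordered choices of these points.
-/
theorem permSum_option_pow (Q : R) (A : Matrix n n R) (r p : ℕ) :
    permSum (Option (Fin r)) Q (fun o => o.elim (A ^ p) fun _ => A) =
      ∑ k ∈ Finset.range (r + 1), (r.descFactorial k : R) * (Q * (A ^ (p + k)).trace) *
        permSum (Fin (r - k)) Q (fun _ => A) := by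
  induction r generalizing p with
  | zero => rw [permSum_option]; simp
  | succ r ih =>
    rw [permSum_option, Finset.sum_range_succ']
    have h : ∀ k : Fin (r + 1), permSum (Fin (r + 1)) Q (Function.update (fun _ => A) k (A ^ p * A)) =
        permSum (Option (Fin r)) Q (fun o => o.elim (A ^ (p + 1)) fun _ => A) := fun k => by
      rw [← permSum_equiv (finSuccEquiv' k)]
      congr 1
      funext a
      refine Fin.succAboveCases k ?_ (fun j => ?_) a
      · simp [pow_succ]
      · simp
    simp only [h, Finset.sum_const, Finset.card_univ, Fintype.card_fin, ih, nsmul_eq_mul]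
    rw [add_comm, Finset.mul_sum]
    congr 1
    · refine Finset.sum_congr rfl fun k _ => ?_
      rw [Nat.succ_descFactorial_succ, Nat.succ_sub_succ, show p + 1 + k = p + (k + 1) by ring]
      push_cast
      ring
    · simp

theorem permSum_succ (Q : R) (A : Matrix n n R) (r : ℕ) :
    permSum (Fin (r + 1)) Q (fun _ => A) =
      ∑ k ∈ Finset.range (r + 1), (r.descFactorial k : R) * (Q * (A ^ (k + 1)).trace) *
        permSum (Fin (r - k)) Q (fun _ => A) := by
  have h := permSum_option_pow Q A r 1
  rw [← permSum_equiv (finSuccEquiv' 0)] at h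
  have h2 : (fun a : Fin (r + 1) => ((finSuccEquiv' 0 a).elim (A ^ 1) fun _ => A)) = fun _ => A := by
    funext a
    refine Fin.cases ?_ (fun j => ?_) a <;> simp [finSuccEquiv']
  rw [h2] at h
  simpa only [add_comm] using h

end PermSum

/-! ## The coefficients of the exponential of the interaction -/

theorem derivative_exp_smul (a : ℂ) :
    PowerSeries.derivative ℂ (PowerSeries.mk fun p => a ^ p / (p.factorial : ℂ)) =
      (PowerSeries.mk fun p => a ^ p / (p.factorial : ℂ)) * PowerSeries.C a := by
  ext n
  rw [PowerSeries.coeff_derivative, PowerSeries.coeff_mul_C, PowerSeries.coeff_mk,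
    PowerSeries.coeff_mk, Nat.factorial_succ]
  have h1 : (n : ℂ) + 1 ≠ 0 := by exact_mod_cast Nat.succ_ne_zero n
  have h2 : (n.factorial : ℂ) ≠ 0 := by exact_mod_cast n.factorial_ne_zero
  push_cast
  field_simp
  ring

/-- This is `permSum_succ` divided by `r!`, where `r.descFactorial k / r! = 1 / (r - k)!`. It
identifies the series as the exponential of `∑ (Q/k) t^k Tr A^k`. -/
theorem derivative_permSum_series {n : Type} [Fintype n] [DecidableEq n] (Q : ℂ)
    (A : Matrix n n ℂ) :
    PowerSeries.derivative ℂ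
        (PowerSeries.mk fun r => permSum (Fin r) Q (fun _ => A) / (r.factorial : ℂ)) =
      (PowerSeries.mk fun r => permSum (Fin r) Q (fun _ => A) / (r.factorial : ℂ)) *
        PowerSeries.mk fun k => Q * (A ^ (k + 1)).trace := by
  ext r
  have h1 : (r : ℂ) + 1 ≠ 0 := by exact_mod_cast Nat.succ_ne_zero r
  have h2 : (r.factorial : ℂ) ≠ 0 := by exact_mod_cast r.factorial_ne_zero
  rw [PowerSeries.coeff_derivative, PowerSeries.coeff_mul, PowerSeries.coeff_mk, permSum_succ,
    mul_comm, Nat.factorial_succ]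
  simp only [PowerSeries.coeff_mk]
  have h3 := Finset.Nat.sum_antidiagonal_eq_sum_range_succ (fun k j =>
    permSum (Fin j) Q (fun _ => A) / (j.factorial : ℂ) * (Q * (A ^ (k + 1)).trace)) r
  rw [← Finset.Nat.sum_antidiagonal_swap] at h3
  refine Eq.trans ?_ h3.symm
  rw [Finset.sum_div, Finset.mul_sum]
  refine Finset.sum_congr rfl fun k hk => ?_
  have hk' : k ≤ r := Nat.lt_succ_iff.1 (Finset.mem_range.1 hk)
  have h4 : (((r - k).factorial : ℕ) : ℂ) ≠ 0 := by exact_mod_cast (r - k).factorial_ne_zero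
  have h5 : ((r - k).factorial : ℂ) * (r.descFactorial k : ℂ) = r.factorial := by
    exact_mod_cast Nat.factorial_mul_descFactorial hk'
  push_cast
  field_simp
  rw [← h5]
  ring

/-- The cubic term and the logarithmic term contribute separate exponential factors; by the product
rule the logarithmic derivative of their product is the derivative of the interaction. -/
theorem coeff_expInteraction {N : ℕ} (lam : Fin N → ℝ) (Q : ℂ) (M : Matrix (Fin N) (Fin N) ℂ)
    (m : ℕ) :
    PowerSeries.coeff m (expInteraction lam Q M) =
      ∑ p ∈ Finset.HasAntidiagonal.antidiagonal m, (-(M ^ 3).trace / 6) ^ p.1 / (p.1.factorial : ℂ) *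
        (permSum (Fin p.2) Q (fun _ => -(diagMatrix (fun i => (lam i)⁻¹) * M)) /
          (p.2.factorial : ℂ)) := by
  set a := -(M ^ 3).trace / 6 with ha
  set A := -(diagMatrix (fun i => (lam i)⁻¹) * M) with hA
  have h : (PowerSeries.mk fun p => a ^ p / (p.factorial : ℂ)) *
      (PowerSeries.mk fun r => permSum (Fin r) Q (fun _ => A) / (r.factorial : ℂ)) =
        expInteraction lam Q M := by
    refine eq_exp_subst ?_ ?_ ?_
    · simp [permSum_fin_zero]
    · simp [interaction]
    · rw [Derivation.leibniz, smul_eq_mul, smul_eq_mul, derivative_exp_smul,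
        derivative_permSum_series]
      have h2 : PowerSeries.derivative ℂ (interaction lam Q M) =
          PowerSeries.C a + PowerSeries.mk fun k => Q * (A ^ (k + 1)).trace := by
        ext k
        have h1 : (k : ℂ) + 1 ≠ 0 := by exact_mod_cast Nat.succ_ne_zero k
        rw [PowerSeries.coeff_derivative, interaction, PowerSeries.coeff_mk, map_add,
          PowerSeries.coeff_mk, ← hA, PowerSeries.coeff_C, add_mul]
        congr 1
        · rcases k with _ | k <;> simp [ha]
        · rw [if_neg k.succ_ne_zero]
          push_cast
          field_simp
      rw [h2]
      ring
  rw [← h, PowerSeries.coeff_mul]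
  simp only [PowerSeries.coeff_mk]

/-! ## Gaussian expectations of polynomials -/

section Gaussian

open MeasureTheory

theorem integrable_pow_mul_gaussian {s : ℝ} (hs : 0 < s) (k : ℕ) :
    Integrable fun x : ℝ => (x : ℂ) ^ k * Complex.exp (-(s / 2) * (x : ℂ) ^ 2) := by
  have h := (integrable_rpow_mul_exp_neg_mul_sq (half_pos hs) (s := k)
    (by have : (0 : ℝ) ≤ k := k.cast_nonneg
        linarith)).ofReal (𝕜 := ℂ)
  refine h.congr (Filter.Eventually.of_forall fun x => ?_)
  simp [Real.rpow_natCast]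

/-- Integration by parts: the derivative of `x ^ k` times the Gaussian integrates to zero. For `k =
0` the truncated exponent `k - 1` is multiplied by zero. -/
theorem integral_pow_succ_mul_gaussian {s : ℝ} (hs : 0 < s) (k : ℕ) :
    (s : ℂ) * ∫ x : ℝ, (x : ℂ) ^ (k + 1) * Complex.exp (-(s / 2) * (x : ℂ) ^ 2) =
      k * ∫ x : ℝ, (x : ℂ) ^ (k - 1) * Complex.exp (-(s / 2) * (x : ℂ) ^ 2) := by
  have hd : ∀ x : ℝ, HasDerivAt
      (fun x : ℝ => (x : ℂ) ^ k * Complex.exp (-(s / 2) * (x : ℂ) ^ 2))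
      (k * ((x : ℂ) ^ (k - 1) * Complex.exp (-(s / 2) * (x : ℂ) ^ 2)) -
        s * ((x : ℂ) ^ (k + 1) * Complex.exp (-(s / 2) * (x : ℂ) ^ 2))) x := by
    intro x
    have h1 : HasDerivAt (fun z : ℂ => z ^ k * Complex.exp (-(s / 2) * z ^ 2))
        (k * ((x : ℂ) ^ (k - 1) * Complex.exp (-(s / 2) * (x : ℂ) ^ 2)) -
        s * ((x : ℂ) ^ (k + 1) * Complex.exp (-(s / 2) * (x : ℂ) ^ 2))) x := by
      have h2 : HasDerivAt (fun z : ℂ => -((s : ℂ) / 2) * z ^ 2) (-((s : ℂ) / 2) * (2 * (x : ℂ))) (x : ℂ) := by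
        simpa using (hasDerivAt_pow 2 (x : ℂ)).const_mul (-((s : ℂ) / 2))
      have h3 := (hasDerivAt_pow k (x : ℂ)).mul h2.cexp
      refine h3.congr_deriv ?_
      ring
    exact h1.comp_ofReal
  have h0 := integral_eq_zero_of_hasDerivAt_of_integrable hd
    (((integrable_pow_mul_gaussian hs (k - 1)).const_mul _).sub
      ((integrable_pow_mul_gaussian hs (k + 1)).const_mul _)) (integrable_pow_mul_gaussian hs k)
  rw [integral_sub ((integrable_pow_mul_gaussian hs (k - 1)).const_mul _)
      ((integrable_pow_mul_gaussian hs (k + 1)).const_mul _), integral_const_mul,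
      integral_const_mul, sub_eq_zero] at h0
  exact h0.symm

/-! ### Independent Gaussian variables and Wick's theorem -/

variable {ι : Type} [Fintype ι] [DecidableEq ι]

/-- The evaluation of a complex polynomial at a real point. -/
noncomputable abbrev realEval (u : ι → ℝ) : MvPolynomial ι ℂ →ₐ[ℂ] ℂ :=
  MvPolynomial.aeval fun p => (u p : ℂ)

/-- The product Gaussian weight with inverse variances `s`. -/
noncomputable def prodGaussian (s : ι → ℝ) (u : ι → ℝ) : ℂ :=
  ∏ p, Complex.exp (-(s p / 2) * (u p : ℂ) ^ 2)

omit [DecidableEq ι] in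
theorem realEval_monomial_mul_prodGaussian (s : ι → ℝ) (d : ι →₀ ℕ) (c : ℂ) (u : ι → ℝ) :
    realEval u (MvPolynomial.monomial d c) * prodGaussian s u =
      c * ∏ p, ((u p : ℂ) ^ d p * Complex.exp (-(s p / 2) * (u p : ℂ) ^ 2)) := by
  rw [MvPolynomial.aeval_monomial, prodGaussian, Finset.prod_mul_distrib, mul_assoc,
    Finsupp.prod_fintype _ _ (fun _ => pow_zero _)]
  rfl

variable {s : ι → ℝ} (hs : ∀ p, 0 < s p)
include hs

omit [DecidableEq ι] in
theorem integrable_realEval_mul_prodGaussian (f : MvPolynomial ι ℂ) :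
    Integrable fun u : ι → ℝ => realEval u f * prodGaussian s u := by
  induction f using MvPolynomial.induction_on' with
  | monomial d c =>
    simp only [realEval_monomial_mul_prodGaussian]
    exact (Integrable.fintype_prod
      (f := fun p (x : ℝ) => (x : ℂ) ^ d p * Complex.exp (-(s p / 2) * (x : ℂ) ^ 2))
      fun p => integrable_pow_mul_gaussian (hs p) (d p)).const_mul c
  | add f g hf hg =>
    simp only [map_add, add_mul]
    exact hf.add hg

theorem integral_X_mul_prodGaussian (p : ι) (f : MvPolynomial ι ℂ) :
    (s p : ℂ) * ∫ u : ι → ℝ, realEval u (MvPolynomial.X p * f) * prodGaussian s u =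
      ∫ u : ι → ℝ, realEval u (MvPolynomial.pderiv p f) * prodGaussian s u := by
  induction f using MvPolynomial.induction_on' with
  | monomial d c =>
    rw [MvPolynomial.pderiv_monomial, MvPolynomial.X, MvPolynomial.monomial_mul, one_mul]
    simp only [realEval_monomial_mul_prodGaussian, integral_const_mul]
    rw [integral_fintype_prod_volume_eq_prod
        (f := fun q (x : ℝ) => (x : ℂ) ^ (Finsupp.single p 1 + d : ι →₀ ℕ) q *
          Complex.exp (-(s q / 2) * (x : ℂ) ^ 2)),
      integral_fintype_prod_volume_eq_prod
        (f := fun q (x : ℝ) => (x : ℂ) ^ (d - Finsupp.single p 1 : ι →₀ ℕ) q *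
          Complex.exp (-(s q / 2) * (x : ℂ) ^ 2)),
      ← Finset.mul_prod_erase Finset.univ _ (Finset.mem_univ p),
      ← Finset.mul_prod_erase Finset.univ _ (Finset.mem_univ p)]
    have h1 := integral_pow_succ_mul_gaussian (hs p) (d p)
    have h2 : ∀ q ∈ Finset.univ.erase p, (Finsupp.single p 1 + d : ι →₀ ℕ) q = d q := fun q hq => by
      simp [(Finset.ne_of_mem_erase hq).symm]
    have h3 : ∀ q ∈ Finset.univ.erase p, (d - Finsupp.single p 1 : ι →₀ ℕ) q = d q := fun q hq => by
      simp [(Finset.ne_of_mem_erase hq).symm]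
    have h6 : ∀ e : ι →₀ ℕ, (∀ q ∈ Finset.univ.erase p, e q = d q) →
        ∏ q ∈ Finset.univ.erase p, ∫ x : ℝ, (x : ℂ) ^ e q * Complex.exp (-(s q / 2) * (x : ℂ) ^ 2) =
        ∏ q ∈ Finset.univ.erase p, ∫ x : ℝ, (x : ℂ) ^ d q * Complex.exp (-(s q / 2) * (x : ℂ) ^ 2) :=
      fun e he => Finset.prod_congr rfl fun q hq => by rw [he q hq]
    rw [h6 _ h2, h6 _ h3]
    have h4 : (Finsupp.single p 1 + d : ι →₀ ℕ) p = d p + 1 := by simp [add_comm]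
    have h5 : (d - Finsupp.single p 1 : ι →₀ ℕ) p = d p - 1 := by simp
    rw [h4, h5]
    linear_combination (c * ∏ q ∈ Finset.univ.erase p, ∫ x : ℝ, (x : ℂ) ^ d q *
          Complex.exp (-(s q / 2) * (x : ℂ) ^ 2)) * h1
  | add f g hf hg =>
    simp only [mul_add, map_add, add_mul]
    rw [integral_add (integrable_realEval_mul_prodGaussian hs _)
      (integrable_realEval_mul_prodGaussian hs _), integral_add (integrable_realEval_mul_prodGaussian hs _)
      (integrable_realEval_mul_prodGaussian hs _), mul_add, hf, hg]

omit [DecidableEq ι] in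
theorem integral_prodGaussian_ne_zero : ∫ u : ι → ℝ, prodGaussian s u ≠ 0 := by
  unfold prodGaussian
  rw [integral_fintype_prod_volume_eq_prod
    (f := fun q (x : ℝ) => Complex.exp (-(s q / 2) * (x : ℂ) ^ 2)), Finset.prod_ne_zero_iff]
  intro p _
  have h : ∫ x : ℝ, Complex.exp (-(s p / 2) * (x : ℂ) ^ 2) =
      ((∫ x : ℝ, Real.exp (-(s p / 2) * x ^ 2) : ℝ) : ℂ) := by
    rw [← integral_complex_ofReal]
    simp
  rw [h, integral_gaussian]
  have : 0 < s p / 2 := half_pos (hs p)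
  exact_mod_cast (Real.sqrt_pos.2 (by positivity)).ne'

omit hs in
/-- The normalized Gaussian expectation of a polynomial. -/
noncomputable def gaussianExp (s : ι → ℝ) (f : MvPolynomial ι ℂ) : ℂ :=
  (∫ u : ι → ℝ, realEval u f * prodGaussian s u) / ∫ u : ι → ℝ, prodGaussian s u

omit [DecidableEq ι] in
theorem gaussianExp_one : gaussianExp s 1 = 1 := by
  simp [gaussianExp, integral_prodGaussian_ne_zero hs]

omit [DecidableEq ι] in
theorem gaussianExp_sum {κ : Type*} (S : Finset κ) (f : κ → MvPolynomial ι ℂ) :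
    gaussianExp s (∑ k ∈ S, f k) = ∑ k ∈ S, gaussianExp s (f k) := by
  simp only [gaussianExp, map_sum, Finset.sum_mul, ← Finset.sum_div]
  rw [integral_finsetSum _ fun k _ => integrable_realEval_mul_prodGaussian hs (f k)]

omit [DecidableEq ι] hs in
theorem gaussianExp_C_mul (c : ℂ) (f : MvPolynomial ι ℂ) :
    gaussianExp s (MvPolynomial.C c * f) = c * gaussianExp s f := by
  simp only [gaussianExp, map_mul, MvPolynomial.aeval_C, Algebra.algebraMap_self, RingHom.id_apply,
    mul_assoc, integral_const_mul, mul_div_assoc]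

theorem gaussianExp_X_mul (p : ι) (f : MvPolynomial ι ℂ) :
    gaussianExp s (MvPolynomial.X p * f) = gaussianExp s (MvPolynomial.pderiv p f) / s p := by
  have h : (s p : ℂ) ≠ 0 := by exact_mod_cast (hs p).ne'
  rw [gaussianExp, gaussianExp, ← integral_X_mul_prodGaussian hs]
  field_simp

/-- The linear form with coefficients `a`. -/
noncomputable def linForm (a : ι → ℂ) : MvPolynomial ι ℂ :=
  ∑ p, MvPolynomial.C (a p) * MvPolynomial.X p

omit hs in
theorem pderiv_linForm (a : ι → ℂ) (p : ι) :
    MvPolynomial.pderiv p (linForm a) = MvPolynomial.C (a p) := by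
  simp [linForm, MvPolynomial.pderiv_X, Pi.single_apply]

omit hs [Fintype ι] [DecidableEq ι] in
theorem pderiv_prod {H : Type*} [DecidableEq H] (p : ι) (f : H → MvPolynomial ι ℂ)
    (S : Finset H) :
    MvPolynomial.pderiv p (∏ h ∈ S, f h) =
      ∑ k ∈ S, MvPolynomial.pderiv p (f k) * ∏ h ∈ S.erase k, f h := by
  induction S using Finset.induction_on with
  | empty => simp
  | insert a S ha ih =>
    rw [Finset.prod_insert ha, Derivation.leibniz, ih, Finset.sum_insert ha,
      Finset.erase_insert ha, add_comm, smul_eq_mul, smul_eq_mul, Finset.mul_sum, mul_comm]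
    congr 1
    refine Finset.sum_congr rfl fun k hk => ?_
    have hak : a ≠ k := fun h => ha (h ▸ hk)
    rw [Finset.erase_insert_of_ne hak, Finset.prod_insert fun h => ha (Finset.mem_of_mem_erase h)]
    ring

/-- Integration by parts turns each variable of `linForm a0` into a derivative, and the product rule
lets it contract with one remaining factor at a time; the coefficient is the covariance of the two
forms. -/
theorem gaussianExp_linForm_mul {H : Type*} [DecidableEq H] (a0 : ι → ℂ) (a : H → ι → ℂ)
    (S : Finset H) :
    gaussianExp s (linForm a0 * ∏ h ∈ S, linForm (a h)) =
      ∑ k ∈ S, (∑ p, a0 p * a k p / s p) * gaussianExp s (∏ h ∈ S.erase k, linForm (a h)) := by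
  rw [linForm, Finset.sum_mul, gaussianExp_sum hs]
  simp only [mul_assoc, gaussianExp_C_mul, gaussianExp_X_mul hs, pderiv_prod,
    pderiv_linForm, gaussianExp_sum hs]
  simp only [Finset.sum_div, Finset.mul_sum, Finset.sum_mul]
  rw [Finset.sum_comm]
  refine Finset.sum_congr rfl fun k _ => Finset.sum_congr rfl fun p _ => ?_
  ring

omit hs in
-- Together with `involution_swap_mul_self` this is the bijection behind the induction in Wick's
-- theorem: a pairing amounts to the partner `k` of `h` and a pairing of the remaining points.
theorem involution_swap_mul {H : Type*} [Fintype H] [DecidableEq H] {τ : Equiv.Perm H} {h k : H}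
    (hhk : h ≠ k) (hτ : τ * τ = 1) (hh : τ h = h) (hk : τ k = k) :
    (Equiv.swap h k * τ) * (Equiv.swap h k * τ) = 1 ∧
      (Equiv.swap h k * τ).support = insert h (insert k τ.support) := by
  have h1 : ∀ x, x ≠ h → x ≠ k → (Equiv.swap h k * τ) x = τ x := fun x hx hx' =>
    Equiv.swap_apply_of_ne_of_ne (fun h' => hx (τ.injective (h'.trans hh.symm)))
      fun h' => hx' (τ.injective (h'.trans hk.symm))
  have h2 : (Equiv.swap h k * τ) h = k := by simp [hh]
  have h3 : (Equiv.swap h k * τ) k = h := by simp [hk]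
  constructor
  · ext x
    rw [Equiv.Perm.mul_apply, Equiv.Perm.one_apply]
    by_cases hx : x = h
    · rw [hx, h2, h3]
    by_cases hx' : x = k
    · rw [hx', h3, h2]
    rw [h1 x hx hx', h1, ← Equiv.Perm.mul_apply, hτ, Equiv.Perm.one_apply]
    · exact fun h' => hx (τ.injective (h'.trans hh.symm))
    · exact fun h' => hx' (τ.injective (h'.trans hk.symm))
  · ext x
    simp only [Equiv.Perm.mem_support, Finset.mem_insert]
    by_cases hx : x = h
    · simp [hx, hh, hhk.symm]
    by_cases hx' : x = k
    · simp [hx', hk, hhk]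
    rw [h1 x hx hx']
    simp [hx, hx']

omit hs in
theorem involution_swap_mul_self {H : Type*} [Fintype H] [DecidableEq H] {τ : Equiv.Perm H}
    (h : H) (hτ : τ * τ = 1) :
    (Equiv.swap h (τ h) * τ) * (Equiv.swap h (τ h) * τ) = 1 ∧
      (Equiv.swap h (τ h) * τ).support = (τ.support.erase h).erase (τ h) := by
  have h0 : τ (τ h) = h := by rw [← Equiv.Perm.mul_apply, hτ, Equiv.Perm.one_apply]
  have h1 : ∀ x, x ≠ h → x ≠ τ h → (Equiv.swap h (τ h) * τ) x = τ x := fun x hx hx' =>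
    Equiv.swap_apply_of_ne_of_ne (fun h' => hx' (τ.injective (h'.trans h0.symm)))
      fun h' => hx (τ.injective h')
  have h2 : (Equiv.swap h (τ h) * τ) h = h := by simp
  have h3 : (Equiv.swap h (τ h) * τ) (τ h) = τ h := by simp [h0]
  constructor
  · ext x
    rw [Equiv.Perm.mul_apply, Equiv.Perm.one_apply]
    by_cases hx : x = h
    · rw [hx, h2, h2]
    by_cases hx' : x = τ h
    · rw [hx', h3, h3]
    rw [h1 x hx hx', h1, ← Equiv.Perm.mul_apply, hτ, Equiv.Perm.one_apply]
    · exact fun h' => hx' (τ.injective (h'.trans h0.symm))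
    · exact fun h' => hx (τ.injective h')
  · ext x
    simp only [Equiv.Perm.mem_support, Finset.mem_erase]
    by_cases hx : x = h
    · simp [hx, h2]
    by_cases hx' : x = τ h
    · simp [hx', h0]
    rw [h1 x hx hx']
    simp [hx', hx]

/-- **Wick's theorem** for linear forms in independent Gaussian variables. -/
theorem gaussianExp_prod_linForm {H : Type*} [Fintype H] [DecidableEq H] (a : H → ι → ℂ)
    (g : H → H → ℂ) (hg : ∀ h k, h ≠ k → g h k * g k h = ∑ p, a h p * a k p / s p)
    (S : Finset H) :
    gaussianExp s (∏ h ∈ S, linForm (a h)) =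
      ∑ τ : Equiv.Perm H with τ * τ = 1 ∧ τ.support = S, ∏ h ∈ S, g h (τ h) := by
  induction S using Finset.strongInduction with
  | H S ih =>
    rcases S.eq_empty_or_nonempty with rfl | ⟨h0, hh0⟩
    · have : (Finset.univ.filter fun τ : Equiv.Perm H => τ * τ = 1 ∧ τ.support = ∅) = {1} := by
        ext τ
        simp only [Finset.mem_filter, Finset.mem_univ, true_and, Finset.mem_singleton,
          Equiv.Perm.support_eq_empty_iff]
        exact ⟨fun h => h.2, fun h => ⟨by simp [h], h⟩⟩
      rw [this]
      simp [gaussianExp_one hs]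
    · rw [← Finset.mul_prod_erase S _ hh0, gaussianExp_linForm_mul hs]
      have h1 : ∀ k ∈ S.erase h0, (S.erase h0).erase k ⊂ S := fun k _ =>
        (Finset.erase_subset _ _).trans_ssubset (Finset.erase_ssubset hh0)
      -- The covariance of a pair is split as `g h0 k * g k h0`, one factor for each member, so that
      -- a product over pairs becomes a product over points.
      rw [Finset.sum_congr rfl fun k hk => by
        rw [ih _ (h1 k hk), ← hg h0 k (Finset.ne_of_mem_erase hk).symm, Finset.mul_sum]]
      rw [Finset.sum_sigma']
      refine Finset.sum_bij' (fun x _ => Equiv.swap h0 x.1 * x.2)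
        (fun τ _ => ⟨τ h0, Equiv.swap h0 (τ h0) * τ⟩) ?_ ?_ ?_ ?_ ?_
      · rintro ⟨k, τ⟩ hx
        simp only [Finset.mem_sigma, Finset.mem_filter, Finset.mem_univ, true_and] at hx
        obtain ⟨hk, hτ, hS⟩ := hx
        have hh : τ h0 = h0 := by rw [← Equiv.Perm.notMem_support, hS]; simp
        have hk' : τ k = k := by rw [← Equiv.Perm.notMem_support, hS]; simp
        have := involution_swap_mul (Finset.ne_of_mem_erase hk).symm hτ hh hk'
        simp only [Finset.mem_filter, Finset.mem_univ, true_and, this.1, this.2]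
        rw [hS, Finset.insert_erase hk, Finset.insert_erase hh0]
      · intro τ hx
        simp only [Finset.mem_filter, Finset.mem_univ, true_and] at hx
        obtain ⟨hτ, hS⟩ := hx
        have hh : τ h0 ≠ h0 := by rwa [← Equiv.Perm.mem_support, hS]
        have := involution_swap_mul_self h0 hτ
        simp only [Finset.mem_sigma, Finset.mem_filter, Finset.mem_univ, this.1, this.2,
          hS, Finset.mem_erase, and_true]
        exact ⟨hh, hS ▸ Equiv.Perm.apply_mem_support.2 (hS ▸ hh0)⟩
      · rintro ⟨k, τ⟩ hx
        simp only [Finset.mem_sigma, Finset.mem_filter, Finset.mem_univ, true_and] at hx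
        obtain ⟨hk, hτ, hS⟩ := hx
        have hh : τ h0 = h0 := by rw [← Equiv.Perm.notMem_support, hS]; simp
        simp [hh]
      · intro τ hx
        simp
      · rintro ⟨k, τ⟩ hx
        simp only [Finset.mem_sigma, Finset.mem_filter, Finset.mem_univ, true_and] at hx
        obtain ⟨hk, hτ, hS⟩ := hx
        have hh : τ h0 = h0 := by rw [← Equiv.Perm.notMem_support, hS]; simp
        have hk' : τ k = k := by rw [← Equiv.Perm.notMem_support, hS]; simp
        rw [← Finset.mul_prod_erase S _ hh0, ← Finset.mul_prod_erase _ _ hk, ← mul_assoc]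
        congr 1
        · simp [hh, hk']
        · refine Finset.prod_congr rfl fun x hx => ?_
          have hx1 := Finset.ne_of_mem_erase hx
          have hx2 := Finset.ne_of_mem_erase (Finset.mem_of_mem_erase hx)
          rw [Equiv.Perm.mul_apply, Equiv.swap_apply_of_ne_of_ne]
          · exact fun h' => hx2 (τ.injective (h'.trans hh.symm))
          · exact fun h' => hx1 (τ.injective (h'.trans hk'.symm))

end Gaussian
/-! ## The Gaussian Hermitian matrix model -/

section MatrixModel

open MeasureTheory

variable {N : ℕ}

/-- Inverse variances of the coordinates of a random Hermitian matrix. -/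
def hermVar (lam : Fin N → ℝ) (p : Fin N × Fin N) : ℝ :=
  if p.1 = p.2 then lam p.1 else lam p.1 + lam p.2

theorem hermVar_pos {lam : Fin N → ℝ} (hlam : ∀ i, 0 < lam i) (p : Fin N × Fin N) :
    0 < hermVar lam p := by
  unfold hermVar
  split_ifs
  · exact hlam _
  · exact add_pos (hlam _) (hlam _)

/-- The entry `(i, j)` of a Hermitian matrix as a linear form in the coordinates. -/
noncomputable def hermCoeff (i j : Fin N) : Fin N × Fin N → ℂ :=
  if i = j then Pi.single (i, i) 1
  else if i < j then Pi.single (i, j) 1 + Pi.single (j, i) Complex.I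
  else Pi.single (j, i) 1 - Pi.single (i, j) Complex.I

/-- The generic Hermitian matrix. -/
noncomputable def hermPoly (N : ℕ) :
    Matrix (Fin N) (Fin N) (MvPolynomial (Fin N × Fin N) ℂ) :=
  Matrix.of fun i j => linForm (hermCoeff i j)

theorem realEval_linForm {ι : Type} [Fintype ι] (a : ι → ℂ) (u : ι → ℝ) :
    realEval u (linForm a) = ∑ p, a p * u p := by
  simp [linForm]

theorem realEval_hermPoly (u : Fin N × Fin N → ℝ) :
    (hermPoly N).map (realEval u) = hermitian u := by
  ext i j
  rw [Matrix.map_apply, hermPoly, Matrix.of_apply, realEval_linForm, hermitian, Matrix.of_apply,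
    hermCoeff]
  split_ifs <;>
  simp [add_mul, sub_mul, Finset.sum_add_distrib, Finset.sum_sub_distrib, Pi.single_apply, *]

theorem hermitian_mul_swap (u : Fin N × Fin N → ℝ) (i j : Fin N) :
    hermitian u i j * hermitian u j i =
      if i = j then (u (i, i) : ℂ) ^ 2 else (u (i, j) : ℂ) ^ 2 + (u (j, i) : ℂ) ^ 2 := by
  simp only [hermitian, Matrix.of_apply]
  rcases lt_trichotomy i j with h | h | h
  · simp only [h.ne, h.ne', h, h.not_gt, if_true, if_false]
    linear_combination -(u (j, i) : ℂ) ^ 2 * Complex.I_sq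
  · subst h; simp [sq]
  · simp only [h.ne, h.ne', h, h.not_gt, if_true, if_false]
    linear_combination -(u (i, j) : ℂ) ^ 2 * Complex.I_sq

/-- `Tr (X² Λ) = ∑ λ_i |x_ij|²`. The squares of both the real and the imaginary part of an
off-diagonal entry occur with `λ_i` from the pair `(i, j)` and with `λ_j` from `(j, i)`. -/
theorem gaussianWeight_hermitian (lam : Fin N → ℝ) (u : Fin N × Fin N → ℝ) :
    gaussianWeight lam (hermitian u) = prodGaussian (hermVar lam) u := by
  rw [gaussianWeight, prodGaussian, ← Complex.exp_sum]
  congr 1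
  have h1 : (hermitian u ^ 2 * diagMatrix lam).trace =
      ∑ i, ∑ j, (lam i : ℂ) * (hermitian u i j * hermitian u j i) := by
    simp only [Matrix.trace, Matrix.diag_apply, diagMatrix, Matrix.mul_diagonal, sq]
    simp only [Matrix.mul_apply, Finset.sum_mul]
    exact Finset.sum_congr rfl fun i _ => Finset.sum_congr rfl fun j _ => mul_comm _ _
  have h2 : ∀ i j, (lam i : ℂ) * (hermitian u i j * hermitian u j i) =
      (if i = j then (lam i : ℂ) * (u (i, j) : ℂ) ^ 2 else (lam i : ℂ) * (u (i, j) : ℂ) ^ 2) +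
        if i = j then 0 else (lam i : ℂ) * (u (j, i) : ℂ) ^ 2 := by
    intro i j
    rw [hermitian_mul_swap]
    split_ifs with h
    · subst h; ring
    · ring
  have h3 : ∑ i, ∑ j, (if i = j then 0 else (lam i : ℂ) * (u (j, i) : ℂ) ^ 2) =
      ∑ i, ∑ j, if i = j then 0 else (lam j : ℂ) * (u (i, j) : ℂ) ^ 2 := by
    rw [Finset.sum_comm]
    simp only [eq_comm]
  rw [h1]
  simp only [h2, Finset.sum_add_distrib]
  rw [h3, Fintype.sum_prod_type]
  simp only [← Finset.sum_add_distrib, Finset.mul_sum]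
  refine Finset.sum_congr rfl fun i _ => Finset.sum_congr rfl fun j _ => ?_
  unfold hermVar
  split_ifs
  · ring
  · push_cast; ring

theorem hermCoeff_eq_zero {k l : Fin N} {p : Fin N × Fin N} (h : p ≠ (k, l)) (h' : p ≠ (l, k)) :
    hermCoeff k l p = 0 := by
  unfold hermCoeff
  split_ifs with e
  · subst e; simp [h]
  · simp [h, h']
  · simp [h, h']

/-- Off the diagonal, the contributions of real and imaginary part add up for an entry and its
transpose, and cancel by `I² = -1` for an entry and itself. On the diagonal the value `1/λ_i` equals
`2/(λ_i + λ_i)`. -/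
theorem hermCoeff_covariance {lam : Fin N → ℝ} (hlam : ∀ i, 0 < lam i) (i j k l : Fin N) :
    ∑ p, hermCoeff i j p * hermCoeff k l p / hermVar lam p =
      if i = l ∧ j = k then (2 / (lam i + lam j) : ℂ) else 0 := by
  have h0 : ∀ i, (lam i : ℂ) ≠ 0 := fun i => by exact_mod_cast (hlam i).ne'
  have h1 : ∀ i j, (lam i : ℂ) + lam j ≠ 0 := fun i j => by
    exact_mod_cast (add_pos (hlam i) (hlam j)).ne'
  have hs : ∀ (q : Fin N × Fin N) (c : ℂ) (b : Fin N × Fin N → ℂ),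
      ∑ p, (Pi.single q c : Fin N × Fin N → ℂ) p * b p / hermVar lam p =
        c * b q / hermVar lam q := by
    intro q c b
    rw [Finset.sum_eq_single q]
    · simp
    · intro p _ hp; simp [hp]
    · simp
  have hsum : ∀ b : Fin N × Fin N → ℂ, ∑ p, hermCoeff i j p * b p / hermVar lam p =
      if i = j then b (i, i) / lam i else if i < j then
        (b (i, j) + Complex.I * b (j, i)) / (lam i + lam j)
        else (b (j, i) - Complex.I * b (i, j)) / (lam i + lam j) := by
    intro b
    unfold hermCoeff
    split_ifs with h h'
    · rw [hs]; simp [hermVar]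
    · simp only [Pi.add_apply, add_mul, add_div, Finset.sum_add_distrib, hs]
      simp [hermVar, h, Ne.symm h, add_comm]
    · simp only [Pi.sub_apply, sub_mul, sub_div, Finset.sum_sub_distrib, hs]
      simp [hermVar, h, Ne.symm h, add_comm]
  rw [hsum]
  have hI : Complex.I * Complex.I = -1 := Complex.I_mul_I
  by_cases e1 : i = l ∧ j = k
  · obtain ⟨rfl, rfl⟩ := e1
    rw [if_pos (And.intro rfl rfl)]
    have := h0 i
    have := h1 i j
    rcases lt_trichotomy i j with h | h | h
    · simp only [hermCoeff, h.ne, h.ne', h, h.not_gt, if_true, if_false, Pi.sub_apply,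
        Pi.single_apply, Prod.mk.injEq, and_self, false_and, and_false]
      congr 1
      linear_combination -hI
    · subst h
      simp [hermCoeff]
      field_simp
      norm_num
    · simp only [hermCoeff, h.ne, h.ne', h, h.not_gt, if_true, if_false, Pi.add_apply,
        Pi.single_apply, Prod.mk.injEq, and_self, false_and, and_false]
      congr 1
      linear_combination -hI
  rw [if_neg e1]
  by_cases e2 : i = k ∧ j = l
  · obtain ⟨rfl, rfl⟩ := e2
    rcases lt_trichotomy i j with h | h | h
    · simp only [hermCoeff, h.ne, h.ne', h, if_true, if_false, Pi.add_apply,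
        Pi.single_apply, Prod.mk.injEq, and_self]
      rw [div_eq_zero_iff]
      left
      linear_combination hI
    · exact absurd ⟨h, h.symm⟩ e1
    · simp only [hermCoeff, h.ne, h.ne', h.not_gt, if_true, if_false, Pi.sub_apply,
        Pi.single_apply, Prod.mk.injEq, and_self]
      rw [div_eq_zero_iff]
      left
      linear_combination hI
  have hij : hermCoeff k l (i, j) = 0 := hermCoeff_eq_zero
    (fun h => e2 (Prod.mk.inj h)) fun h => e1 (Prod.mk.inj h)
  have hji : hermCoeff k l (j, i) = 0 := hermCoeff_eq_zero
    (fun h => e1 (Prod.mk.inj h).symm) fun h => e2 (Prod.mk.inj h).symm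
  split_ifs with h h'
  · subst h; simp [hij]
  · simp [hij, hji]
  · simp [hij, hji]

/-- The Wick contraction of the entries of a Hermitian matrix. -/
theorem gaussianExp_prod_hermPoly {lam : Fin N → ℝ} (hlam : ∀ i, 0 < lam i) {H : Type*}
    [Fintype H] [DecidableEq H] (a b : H → Fin N) (g : H → H → ℂ)
    (hg : ∀ h k, h ≠ k → g h k * g k h =
      if a h = b k ∧ b h = a k then (2 / (lam (a h) + lam (b h)) : ℂ) else 0) (S : Finset H) :
    gaussianExp (hermVar lam) (∏ h ∈ S, hermPoly N (a h) (b h)) =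
      ∑ τ : Equiv.Perm H with τ * τ = 1 ∧ τ.support = S, ∏ h ∈ S, g h (τ h) :=
  gaussianExp_prod_linForm (hermVar_pos hlam) (fun h => hermCoeff (a h) (b h)) g
    (fun h k hhk => by rw [hg h k hhk, hermCoeff_covariance hlam]) S

/-! ### The exponential of the interaction as a polynomial in the matrix coordinates -/

theorem permSum_smul {R : Type*} [CommRing R] {n : Type} [Fintype n] (α : Type) [Fintype α]
    [DecidableEq α] (Q c : R) (M : α → Matrix n n R) :
    permSum α Q (fun a => c • M a) = c ^ Fintype.card α * permSum α Q M := by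
  simp only [permSum, Matrix.smul_apply, smul_eq_mul, Finset.prod_mul_distrib, Finset.prod_const,
    Finset.card_univ, ← Finset.mul_sum]
  rw [Finset.mul_sum]
  exact Finset.sum_congr rfl fun _ _ => by ring

/-- Sums over the ways to choose a subset together with one of three corners at each element. -/
theorem sum_option_zmod3 {R : Type*} [CommRing R] (V : Type) [Fintype V] [DecidableEq V]
    (f : ℕ → R) :
    ∑ β : V → Option (ZMod 3), f (Fintype.card {v // β v ≠ none}) =
      ∑ r ∈ Finset.range (Fintype.card V + 1), ((Fintype.card V).choose r : R) * 3 ^ r * f r := by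
  have h1 : ∀ β : V → Option (ZMod 3), Fintype.card {v // β v ≠ none} =
      (Finset.univ.filter fun v => β v ≠ none).card := fun β => Fintype.card_subtype _
  simp only [h1]
  rw [← Finset.sum_fiberwise_of_maps_to (s := Finset.univ) (t := (Finset.univ : Finset V).powerset)
    (g := fun β : V → Option (ZMod 3) => Finset.univ.filter fun v => β v ≠ none)
    (fun β _ => Finset.mem_powerset.2 (Finset.subset_univ _))]
  have h2 : ∀ S : Finset V, ∑ β : V → Option (ZMod 3) with
      (Finset.univ.filter fun v => β v ≠ none) = S,
        f (Finset.univ.filter fun v => β v ≠ none).card = 3 ^ S.card * f S.card := by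
    intro S
    rw [Finset.sum_congr rfl fun β hβ => by rw [(Finset.mem_filter.1 hβ).2], Finset.sum_const,
      nsmul_eq_mul]
    congr 1
    have h3 : (Finset.univ.filter fun β : V → Option (ZMod 3) =>
        (Finset.univ.filter fun v => β v ≠ none) = S) =
        Fintype.piFinset fun v => if v ∈ S then Finset.univ.erase none else {none} := by
      ext β
      simp only [Finset.mem_filter, Finset.mem_univ, true_and, Fintype.mem_piFinset,
        Finset.ext_iff]
      refine forall_congr' fun v => ?_
      by_cases hv : v ∈ S <;> simp [hv]
    rw [h3, Fintype.card_piFinset]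
    have h4 : ∀ v, (if v ∈ S then Finset.univ.erase none else {none} :
        Finset (Option (ZMod 3))).card = if v ∈ S then 3 else 1 := by
      intro v
      split_ifs
      · rw [Finset.card_erase_of_mem (Finset.mem_univ _), Finset.card_univ, Fintype.card_option,
          ZMod.card]
      · simp
    simp only [h4]
    rw [Finset.prod_ite_mem]
    simp
  rw [Finset.sum_congr rfl fun S _ => h2 S,
    Finset.sum_powerset_apply_card (fun r => (3 : R) ^ r * f r), Finset.card_univ]
  exact Finset.sum_congr rfl fun r _ => by rw [nsmul_eq_mul, mul_assoc]

/-- The matrix `2 Λ⁻¹ X` for the generic Hermitian matrix `X`. -/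
noncomputable def weightedHermPoly (lam : Fin N → ℝ) :
    Matrix (Fin N) (Fin N) (MvPolynomial (Fin N × Fin N) ℂ) :=
  Matrix.of fun i j => MvPolynomial.C (2 / (lam i : ℂ)) * hermPoly N i j

/-- The coefficient of `t ^ m` of the exponential of the interaction, as a polynomial in the
coordinates of the Hermitian matrix. -/
noncomputable def interactionPoly (lam : Fin N → ℝ) (Q : ℂ) (m : ℕ) :
    MvPolynomial (Fin N × Fin N) ℂ :=
  MvPolynomial.C ((-1 : ℂ) ^ m / ((m.factorial : ℂ) * 6 ^ m)) *
    ∑ β : Fin m → Option (ZMod 3), (hermPoly N ^ 3).trace ^ Fintype.card {v // ¬ β v ≠ none} *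
      permSum {v // β v ≠ none} (MvPolynomial.C Q) fun _ => weightedHermPoly lam

/-- With `p + r = m`, there are `m.choose r * 3 ^ r` choices of `r` vertices with a corner at each,
and `2 Λ⁻¹ X` supplies `2 ^ r`; division by `m! 6^m` leaves `1/(p! 6^p r!)`. The sign `(-1)^m`
collects those of `-Tr X³ / 6` and `-Λ⁻¹ X`. -/
theorem realEval_interactionPoly (lam : Fin N → ℝ) (Q : ℂ) (m : ℕ) (u : Fin N × Fin N → ℝ) :
    realEval u (interactionPoly lam Q m) =
      PowerSeries.coeff m (expInteraction lam Q (hermitian u)) := by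
  have hT : realEval u (hermPoly N ^ 3).trace = (hermitian u ^ 3).trace := by
    rw [← realEval_hermPoly u, ← AlgHom.mapMatrix_apply, ← map_pow, AlgHom.mapMatrix_apply]
    exact AddMonoidHom.map_trace (realEval u) _
  have hS : ∀ r, realEval u (permSum (Fin r) (MvPolynomial.C Q) fun _ => weightedHermPoly lam) =
      (-2 : ℂ) ^ r * permSum (Fin r) Q fun _ => -(diagMatrix (fun i => (lam i)⁻¹) * hermitian u) := by
    intro r
    have h1 := permSum_smul (Fin r) Q (-2)
      fun _ => -(diagMatrix (fun i => (lam i)⁻¹) * hermitian u)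
    rw [Fintype.card_fin] at h1
    rw [← h1]
    refine (permSum_map (realEval u).toRingHom _ _).trans ?_
    congr 1
    · simp
    · funext _
      ext i j
      rw [← realEval_hermPoly u]
      simp [weightedHermPoly, diagMatrix, Matrix.diagonal_mul]
      ring
  have hcard : ∀ β : Fin m → Option (ZMod 3), Fintype.card {v // ¬ β v ≠ none} =
      m - Fintype.card {v // β v ≠ none} := fun β => by
    rw [Fintype.card_subtype_compl, Fintype.card_fin]
  have hperm : ∀ β : Fin m → Option (ZMod 3),
      permSum {v // β v ≠ none} (MvPolynomial.C Q) (fun _ => weightedHermPoly lam) =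
      permSum (Fin (Fintype.card {v // β v ≠ none})) (MvPolynomial.C Q)
        (fun _ => weightedHermPoly lam) := fun β =>
    permSum_equiv (Fintype.equivFin _) _ (fun _ => weightedHermPoly lam)
  simp only [interactionPoly, hperm, hcard]
  rw [sum_option_zmod3 (Fin m) (fun r => (hermPoly N ^ 3).trace ^ (m - r) *
    permSum (Fin r) (MvPolynomial.C Q) fun _ => weightedHermPoly lam), Fintype.card_fin,
    coeff_expInteraction, map_mul, map_sum]
  rw [← Finset.Nat.sum_antidiagonal_swap]
  have h3 := Finset.Nat.sum_antidiagonal_eq_sum_range_succ (fun r p =>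
    (-(hermitian u ^ 3).trace / 6) ^ p / (p.factorial : ℂ) *
        (permSum (Fin r) Q (fun _ => -(diagMatrix (fun i => (lam i)⁻¹) * hermitian u)) /
          (r.factorial : ℂ))) m
  refine Eq.trans ?_ h3.symm
  rw [Finset.mul_sum]
  refine Finset.sum_congr rfl fun r hr => ?_
  have hr' : r ≤ m := Nat.lt_succ_iff.1 (Finset.mem_range.1 hr)
  simp only [map_mul, map_pow, hT, hS]
  obtain ⟨p, rfl⟩ := Nat.exists_eq_add_of_le hr'
  rw [Nat.add_sub_cancel_left]
  have h5 : ((r + p).choose r : ℂ) * r.factorial * p.factorial = (r + p).factorial := by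
    rw [Nat.choose_symm_add]
    exact_mod_cast Nat.add_choose_mul_factorial_mul_factorial r p
  have h6 : (r.factorial : ℂ) ≠ 0 := by exact_mod_cast r.factorial_ne_zero
  have h7 : (p.factorial : ℂ) ≠ 0 := by exact_mod_cast p.factorial_ne_zero
  have h8 : ((r + p).factorial : ℂ) ≠ 0 := by exact_mod_cast (r + p).factorial_ne_zero
  rw [MvPolynomial.aeval_C]
  simp only [map_natCast, map_ofNat, Algebra.algebraMap_self, RingHom.id_apply]
  generalize (hermitian u ^ 3).trace = T
  generalize permSum (Fin r) Q (fun _ => -(diagMatrix (fun i => (lam i)⁻¹) * hermitian u)) = S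
  have h9 : (-T / 6) ^ p = (-1) ^ p * T ^ p / 6 ^ p := by rw [← mul_pow, ← div_pow]; congr 1; ring
  have h10 : ((-1 : ℂ) ^ r) * (-1) ^ r = 1 := by rw [← mul_pow]; simp
  have h11 : (-2 : ℂ) ^ r = (-1) ^ r * 2 ^ r := by rw [← mul_pow]; norm_num
  have h12 : (6 : ℂ) ^ r = 3 ^ r * 2 ^ r := by rw [← mul_pow]; norm_num
  have h13 : ((r + p).choose r : ℂ) ≠ 0 := by
    exact_mod_cast (Nat.choose_pos (Nat.le_add_right r p)).ne'
  rw [h9, h11, ← h5, pow_add, pow_add, h12]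
  field_simp
  linear_combination T ^ p * S * h10

theorem integrable_coeff_expInteraction {lam : Fin N → ℝ} (hlam : ∀ i, 0 < lam i) (Q : ℂ) (m : ℕ) :
    Integrable fun u : Fin N × Fin N → ℝ =>
      PowerSeries.coeff m (expInteraction lam Q (hermitian u)) *
        gaussianWeight lam (hermitian u) := by
  simp only [← realEval_interactionPoly, gaussianWeight_hermitian]
  exact integrable_realEval_mul_prodGaussian (hermVar_pos hlam) _

theorem coeff_tau {lam : Fin N → ℝ} (hlam : ∀ i, 0 < lam i) (Q : ℂ) (m : ℕ) :
    PowerSeries.coeff m (tau lam Q) = (-1) ^ m / (m.factorial * 6 ^ m) *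
      ∑ β : Fin m → Option (ZMod 3), gaussianExp (hermVar lam)
        ((hermPoly N ^ 3).trace ^ Fintype.card {v // ¬ β v ≠ none} *
          permSum {v // β v ≠ none} (MvPolynomial.C Q) fun _ => weightedHermPoly lam) := by
  rw [← gaussianExp_sum (hermVar_pos hlam), ← gaussianExp_C_mul, tau, PowerSeries.coeff_mk,
    expectation, gaussianExp]
  simp only [gaussianWeight_hermitian, ← realEval_interactionPoly]
  rfl

end MatrixModel

/-! ## Colored ribbon graph structures on a fixed set of half-edges -/

section Structures

variable {H H' X : Type}

/-- `t` (exchange of half-edges) and `c` (coloring, with value `none` on boundary half-edges)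
form a colored ribbon graph with rotation `s`. -/
def IsStr (s t : Equiv.Perm H) (c : H → Option X) : Prop :=
  (∀ x, t (t x) = x) ∧ (∀ x, t x ≠ x) ∧ (∀ x, c (s⁻¹ (t x)) = c x) ∧
    ∀ x, c x = none → c (t x) ≠ none

/-- The colored ribbon graphs with rotation `s`. -/
abbrev Str (s : Equiv.Perm H) (X : Type) : Type :=
  {p : Equiv.Perm H × (H → Option X) // IsStr s p.1 p.2}

noncomputable instance [Finite H] [Finite X] (s : Equiv.Perm H) : Fintype (Str s X) :=
  Fintype.ofFinite _

/-- The number of boundary cycles. -/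
noncomputable def numBdry (s t : Equiv.Perm H) (c : H → Option X) : ℕ :=
  Nat.card (CyclesIn (s⁻¹ * t) fun x => c x = none)

/-- The square root of the contribution of an edge with the given colors at its two sides. -/
noncomputable def edgeFactor (lam : X → ℝ) (p q : Option X) : ℝ :=
  Real.sqrt (2 / (p.elim 0 lam + q.elim 0 lam))

theorem edgeFactor_comm (lam : X → ℝ) (p q : Option X) :
    edgeFactor lam p q = edgeFactor lam q p := by
  rw [edgeFactor, edgeFactor, add_comm]

theorem edgeFactor_mul_self {lam : X → ℝ} (hlam : ∀ i, 0 < lam i) (p q : Option X) :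
    edgeFactor lam p q * edgeFactor lam p q = 2 / (p.elim 0 lam + q.elim 0 lam) := by
  have h : ∀ p : Option X, 0 ≤ p.elim 0 lam := by
    rintro (_ | i)
    · exact le_rfl
    · exact (hlam i).le
  exact Real.mul_self_sqrt (div_nonneg zero_le_two (add_nonneg (h p) (h q)))

/-- `Q ^ (number of boundaries) * ∏ (edges) 2 / λ̃`. -/
noncomputable def strWeight [Fintype H] (lam : X → ℝ) (Q : ℂ) (s t : Equiv.Perm H)
    (c : H → Option X) : ℂ :=
  Q ^ numBdry s t c * ((∏ x, edgeFactor lam (c x) (c (t x)) : ℝ) : ℂ)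

/-- Every non-empty set of half-edges closed under rotation and exchange is everything. -/
def IsConn (s t : Equiv.Perm H) : Prop :=
  Nonempty H ∧ ∀ U : Set H, (∀ x ∈ U, s x ∈ U) → (∀ x ∈ U, t x ∈ U) → U.Nonempty → U = Set.univ

/-- Transport of structures along a bijection that respects the rotations. -/
def strEquiv {s : Equiv.Perm H} {s' : Equiv.Perm H'} (e : H ≃ H') (he : ∀ x, e (s x) = s' (e x)) :
    Str s X ≃ Str s' X where
  toFun p := ⟨(e.permCongr p.1.1, fun y => p.1.2 (e.symm y)), by
    have h' : ∀ y, e.symm (s'⁻¹ y) = s⁻¹ (e.symm y) := fun y => by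
      rw [Equiv.symm_apply_eq, Equiv.Perm.inv_eq_iff_eq, ← he]; simp
    obtain ⟨h1, h2, h3, h4⟩ := p.2
    refine ⟨fun x => by simp [h1], fun x hx => h2 (e.symm x) ?_, fun x => ?_, fun x hx => ?_⟩
    · simpa [Equiv.eq_symm_apply] using hx
    · dsimp only
      rw [h', Equiv.permCongr_apply, Equiv.symm_apply_apply, h3]
    · simpa using h4 _ hx⟩
  invFun p := ⟨(e.symm.permCongr p.1.1, fun y => p.1.2 (e y)), by
    have h' : ∀ y, e (s⁻¹ y) = s'⁻¹ (e y) := fun y => by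
      rw [Equiv.Perm.eq_inv_iff_eq, ← he]; simp
    obtain ⟨h1, h2, h3, h4⟩ := p.2
    refine ⟨fun x => by simp [h1], fun x hx => h2 (e x) ?_, fun x => ?_, fun x hx => ?_⟩
    · simpa [Equiv.symm_apply_eq] using hx
    · dsimp only
      rw [h', Equiv.permCongr_apply, Equiv.symm_symm, Equiv.apply_symm_apply, h3]
    · simpa using h4 _ hx⟩
  left_inv p := by
    apply Subtype.ext
    refine Prod.ext ?_ ?_
    · ext x; simp
    · funext x; simp
  right_inv p := by
    apply Subtype.ext
    refine Prod.ext ?_ ?_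
    · ext x; simp
    · funext x; simp

variable {s : Equiv.Perm H} {s' : Equiv.Perm H'} (e : H ≃ H') (he : ∀ x, e (s x) = s' (e x))

include he in
theorem numBdry_conj {t : Equiv.Perm H} {t' : Equiv.Perm H'} (ht : ∀ x, e (t x) = t' (e x))
    {c : H → Option X} {c' : H' → Option X} (hc : ∀ x, c' (e x) = c x) :
    numBdry s' t' c' = numBdry s t c := by
  have h' : ∀ y, e (s⁻¹ y) = s'⁻¹ (e y) := fun y => by
    rw [Equiv.Perm.eq_inv_iff_eq, ← he]; simp
  refine (card_cyclesIn_congr e (fun x hx => by rw [hc, hx]) (fun x y _ _ =>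
    sameCycle_map_iff e.injective fun x => ?_) fun y hy => ⟨e.symm y, ?_, ?_⟩).symm
  · rw [Equiv.Perm.mul_apply, Equiv.Perm.mul_apply, h', ht]
  · rw [← hc]; simpa using hy
  · rw [e.apply_symm_apply]

include he in
theorem strWeight_conj [Fintype H] [Fintype H'] (lam : X → ℝ) (Q : ℂ) {t : Equiv.Perm H}
    {t' : Equiv.Perm H'} (ht : ∀ x, e (t x) = t' (e x))
    {c : H → Option X} {c' : H' → Option X} (hc : ∀ x, c' (e x) = c x) :
    strWeight lam Q s' t' c' = strWeight lam Q s t c := by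
  rw [strWeight, strWeight, numBdry_conj e he ht hc, ← e.prod_comp]
  simp only [← ht, hc]

include he in
theorem isConn_conj {t : Equiv.Perm H} {t' : Equiv.Perm H'} (ht : ∀ x, e (t x) = t' (e x)) :
    IsConn s' t' ↔ IsConn s t := by
  constructor
  · rintro ⟨h0, h⟩
    refine ⟨e.nonempty_congr.2 h0, fun U hs htU hU => ?_⟩
    have := h (e '' U) (by rintro _ ⟨x, hx, rfl⟩; exact ⟨s x, hs x hx, he x⟩)
      (by rintro _ ⟨x, hx, rfl⟩; exact ⟨t x, htU x hx, ht x⟩) (hU.image _)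
    rw [Set.eq_univ_iff_forall] at this ⊢
    intro x
    exact e.injective.mem_set_image.1 (this (e x))
  · rintro ⟨h0, h⟩
    refine ⟨e.nonempty_congr.1 h0, fun U hs htU hU => ?_⟩
    have := h (e ⁻¹' U) (fun x hx => by
        rw [Set.mem_preimage, he]; exact hs _ hx)
      (fun x hx => by rw [Set.mem_preimage, ht]; exact htU _ hx) (hU.preimage e.surjective)
    rw [Set.eq_univ_iff_forall] at this ⊢
    intro x
    simpa using this (e.symm x)

theorem strEquiv_spec (p : Str s X) : (∀ x, e (p.1.1 x) = (strEquiv e he p).1.1 (e x)) ∧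
    ∀ x, (strEquiv e he p).1.2 (e x) = p.1.2 x := by
  constructor <;> intro x <;> simp [strEquiv]

/-- The rotation of a disjoint union of triangles. -/
def rot (V : Type) : Equiv.Perm (V × ZMod 3) :=
  Equiv.prodCongr (Equiv.refl V) (Equiv.addRight 1)

@[simp] theorem rot_apply (V : Type) (v : V) (i : ZMod 3) : rot V (v, i) = (v, i + 1) := rfl

@[simp] theorem rot_inv_apply (V : Type) (v : V) (i : ZMod 3) :
    (rot V)⁻¹ (v, i) = (v, i - 1) := by
  rw [Equiv.Perm.inv_eq_iff_eq]; simp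

/-- Two consecutive half-edges at a vertex are not both boundary half-edges. -/
theorem IsStr.not_consecutive {s t : Equiv.Perm H} {c : H → Option X} (h : IsStr s t c) {x : H}
    (hx : c x = none) : c (s x) ≠ none := by
  intro h'
  -- Since `s⁻¹ t` sends `t (s x)` to `x`, the half-edge `t (s x)` is on a boundary as well; then
  -- the edge of `s x` would have boundaries on both sides.
  have h1 := h.2.2.1 (t (s x))
  rw [h.1, Equiv.Perm.inv_eq_iff_eq.2 rfl, hx] at h1
  exact h.2.2.2 _ h' h1.symm

end Structures

/-! ## Structures with a prescribed set of boundary half-edges -/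

section Marked

theorem perm_apply_inv {α : Type*} (σ : Equiv.Perm α) (x : α) : σ (σ⁻¹ x) = x :=
  σ.apply_symm_apply x

variable (R U : Type)

/-- Half-edges of a disjoint union of triangles: for the vertices in `R` a distinguished half-edge,
its two successors, and the half-edges at the vertices in `U`. -/
abbrev Marked : Type := (R ⊕ R) ⊕ (R ⊕ U × ZMod 3)

/-- The rotation on `Marked R U`. -/
def markedRot : Equiv.Perm (Marked R U) where
  toFun
    | Sum.inl (Sum.inl v) => Sum.inl (Sum.inr v)
    | Sum.inl (Sum.inr v) => Sum.inr (Sum.inl v)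
    | Sum.inr (Sum.inl v) => Sum.inl (Sum.inl v)
    | Sum.inr (Sum.inr x) => Sum.inr (Sum.inr (rot U x))
  invFun
    | Sum.inl (Sum.inr v) => Sum.inl (Sum.inl v)
    | Sum.inr (Sum.inl v) => Sum.inl (Sum.inr v)
    | Sum.inl (Sum.inl v) => Sum.inr (Sum.inl v)
    | Sum.inr (Sum.inr x) => Sum.inr (Sum.inr ((rot U)⁻¹ x))
  left_inv := by rintro ((v | v) | (v | ⟨v, i⟩)) <;> simp
  right_inv := by rintro ((v | v) | (v | ⟨v, i⟩)) <;> simp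

variable {R U} {X : Type}

theorem markedRot_inv_inlr (v : R) :
    (markedRot R U)⁻¹ (Sum.inl (Sum.inr v)) = Sum.inl (Sum.inl v) := rfl

theorem markedRot_inv_inrl (v : R) :
    (markedRot R U)⁻¹ (Sum.inr (Sum.inl v)) = Sum.inl (Sum.inr v) := rfl

theorem markedRot_inv_inll (v : R) :
    (markedRot R U)⁻¹ (Sum.inl (Sum.inl v)) = Sum.inr (Sum.inl v) := rfl

theorem markedRot_inv_inrr (x : U × ZMod 3) :
    (markedRot R U)⁻¹ (Sum.inr (Sum.inr x)) = Sum.inr (Sum.inr ((rot U)⁻¹ x)) := rfl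

/-- The color of a half-edge that does not belong to a boundary edge. -/
def freeColor (i : R → X) (γ : U × ZMod 3 → X) (π : Equiv.Perm R) : R ⊕ U × ZMod 3 → X :=
  Sum.elim (fun v => i (π v)) γ

/-- The color of the predecessor of a half-edge that does not belong to a boundary edge. -/
def freePredColor (i : R → X) (γ : U × ZMod 3 → X) : R ⊕ U × ZMod 3 → X :=
  Sum.elim i fun x => γ ((rot U)⁻¹ x)

/-- The coloring with the given colors of the edges on the boundaries. -/
def markedColor (i : R → X) (γ : U × ZMod 3 → X) (π : Equiv.Perm R) : Marked R U → Option X :=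
  Sum.elim (Sum.elim (fun _ => none) fun v => some (i v)) fun h => some (freeColor i γ π h)

/-- The exchange of half-edges with boundary cycles given by `π` and other edges by `τ`. -/
def markedExchange (π : Equiv.Perm R) (τ : Equiv.Perm (R ⊕ U × ZMod 3)) :
    Equiv.Perm (Marked R U) :=
  Equiv.Perm.sumCongr ((Equiv.Perm.sumCongr π π⁻¹).trans (Equiv.sumComm R R)) τ

theorem markedExchange_inll (π : Equiv.Perm R) (τ : Equiv.Perm (R ⊕ U × ZMod 3)) (v : R) :
    markedExchange π τ (Sum.inl (Sum.inl v)) = Sum.inl (Sum.inr (π v)) := rfl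

theorem markedExchange_inlr (π : Equiv.Perm R) (τ : Equiv.Perm (R ⊕ U × ZMod 3)) (v : R) :
    markedExchange π τ (Sum.inl (Sum.inr v)) = Sum.inl (Sum.inl (π⁻¹ v)) := rfl

theorem markedExchange_inr (π : Equiv.Perm R) (τ : Equiv.Perm (R ⊕ U × ZMod 3))
    (h : R ⊕ U × ZMod 3) : markedExchange π τ (Sum.inr h) = Sum.inr (τ h) := rfl

theorem markedColor_pred (i : R → X) (γ : U × ZMod 3 → X) (π : Equiv.Perm R)
    (h : R ⊕ U × ZMod 3) :
    markedColor i γ π ((markedRot R U)⁻¹ (Sum.inr h)) = some (freePredColor i γ h) := by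
  rcases h with v | x
  · rw [markedRot_inv_inrl]; rfl
  · rw [markedRot_inv_inrr]; rfl

/-- At the half-edges of boundary edges the axioms hold by construction. What remains is that `τ`
pairs all the free half-edges and that colors are constant along faces there: exactly the index
equations of a Wick contraction. -/
theorem isStr_marked_iff [Fintype R] [Fintype U] [DecidableEq R] [DecidableEq U] (i : R → X)
    (γ : U × ZMod 3 → X) (π : Equiv.Perm R) (τ : Equiv.Perm (R ⊕ U × ZMod 3)) :
    IsStr (markedRot R U) (markedExchange π τ) (markedColor i γ π) ↔
      (τ * τ = 1 ∧ τ.support = Finset.univ) ∧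
        ∀ h, freeColor i γ π h = freePredColor i γ (τ h) := by
  constructor
  · rintro ⟨h1, h2, h3, -⟩
    refine ⟨⟨?_, ?_⟩, fun h => ?_⟩
    · ext h
      exact Sum.inr_injective (h1 (Sum.inr h))
    · rw [Finset.eq_univ_iff_forall]
      intro h
      rw [Equiv.Perm.mem_support]
      exact fun h' => h2 (Sum.inr h) (congrArg Sum.inr h')
    · have := h3 (Sum.inr h)
      rw [markedExchange_inr, markedColor_pred] at this
      exact (Option.some_injective _ this).symm
  · rintro ⟨⟨h1, h2⟩, h3⟩
    refine ⟨?_, ?_, ?_, ?_⟩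
    · rintro ((v | v) | h)
      · rw [markedExchange_inll, markedExchange_inlr, Equiv.Perm.inv_eq_iff_eq.2 rfl]
      · rw [markedExchange_inlr, markedExchange_inll, perm_apply_inv]
      · rw [markedExchange_inr, markedExchange_inr, ← Equiv.Perm.mul_apply, h1]; rfl
    · rintro ((v | v) | h)
      · rw [markedExchange_inll]; simp
      · rw [markedExchange_inlr]; simp
      · rw [markedExchange_inr]
        intro h'
        have : h ∈ τ.support := h2 ▸ Finset.mem_univ h
        exact Equiv.Perm.mem_support.1 this (Sum.inr_injective h')
    · rintro ((v | v) | h)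
      · rw [markedExchange_inll, markedRot_inv_inlr]; rfl
      · rw [markedExchange_inlr, markedRot_inv_inll]
        change some (i (π (π⁻¹ v))) = some (i v)
        rw [perm_apply_inv]
      · rw [markedExchange_inr, markedColor_pred, ← h3]; rfl
    · rintro ((v | v) | h) hx
      · rw [markedExchange_inll]; exact Option.some_ne_none _
      · exact absurd hx (Option.some_ne_none _)
      · exact absurd hx (Option.some_ne_none _)

/-- Invariance of the colors under `σ₂` sends distinguished half-edges to distinguished ones, so `t`
takes that of `v` to the successor of another one; this defines `π`. The exchange `t` therefore
preserves the set of free half-edges and restricts to `τ`. -/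
theorem exists_of_isStr_marked [Finite R] {t : Equiv.Perm (Marked R U)} {c : Marked R U → Option X}
    (hs : IsStr (markedRot R U) t c)
    (hc : ∀ x, c x = none ↔ ∃ v, x = Sum.inl (Sum.inl v)) :
    ∃ (i : R → X) (γ : U × ZMod 3 → X) (π : Equiv.Perm R) (τ : Equiv.Perm (R ⊕ U × ZMod 3)),
      t = markedExchange π τ ∧ c = markedColor i γ π := by
  have hi : ∀ v, ∃ i, c (Sum.inl (Sum.inr v)) = some i := fun v =>
    Option.ne_none_iff_exists'.1 fun h => by simpa using (hc _).1 h
  have hγ : ∀ x, ∃ i, c (Sum.inr (Sum.inr x)) = some i := fun v =>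
    Option.ne_none_iff_exists'.1 fun h => by simpa using (hc _).1 h
  choose i hi using hi
  choose γ hγ using hγ
  have hp : ∀ v, ∃ w, t (Sum.inl (Sum.inl v)) = Sum.inl (Sum.inr w) := by
    intro v
    have h1 := hs.2.2.1 (Sum.inl (Sum.inl v))
    rw [(hc _).2 ⟨v, rfl⟩, hc] at h1
    obtain ⟨w, hw⟩ := h1
    exact ⟨w, by rw [Equiv.Perm.inv_eq_iff_eq] at hw; exact hw⟩
  choose p hp using hp
  have hpi : Function.Injective p := fun v w h => by
    have : t (Sum.inl (Sum.inl v)) = t (Sum.inl (Sum.inl w)) := by rw [hp, hp, h]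
    simpa using t.injective this
  let π : Equiv.Perm R := Equiv.ofBijective p (Finite.injective_iff_bijective.1 hpi)
  have hπ : ∀ v, t (Sum.inl (Sum.inl v)) = Sum.inl (Sum.inr (π v)) := hp
  have hπ' : ∀ v, t (Sum.inl (Sum.inr v)) = Sum.inl (Sum.inl (π⁻¹ v)) := fun v => by
    have := hs.1 (Sum.inl (Sum.inl (π⁻¹ v)))
    rwa [hπ, perm_apply_inv] at this
  have hq : ∀ h, ∃ k, t (Sum.inr h) = Sum.inr k := by
    intro h
    rcases ht : t (Sum.inr h) with (v | v) | k
    · have := hs.1 (Sum.inr h)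
      rw [ht, hπ] at this
      simp at this
    · have := hs.1 (Sum.inr h)
      rw [ht, hπ'] at this
      simp at this
    · exact ⟨k, rfl⟩
  choose q hq using hq
  have hqi : Function.Involutive q := fun h => by
    have := hs.1 (Sum.inr h)
    rw [hq, hq] at this
    exact Sum.inr_injective this
  refine ⟨i, γ, π, hqi.toPerm, ?_, ?_⟩
  · ext1 x
    rcases x with (v | v) | h
    · rw [hπ, markedExchange_inll]
    · rw [hπ', markedExchange_inlr]
    · rw [hq, markedExchange_inr]; rfl
  · funext x
    rcases x with (v | v) | (v | x)
    · exact (hc _).2 ⟨v, rfl⟩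
    · exact hi v
    -- `σ₂` takes the successor half-edge at `π v` to the third half-edge at `v`, so the color of
    -- the latter is forced to be `i (π v)`.
    · have h1 := hs.2.2.1 (Sum.inl (Sum.inr (π v)))
      rw [hπ', Equiv.Perm.inv_eq_iff_eq.2 rfl, markedRot_inv_inll] at h1
      rw [h1, hi]; rfl
    · exact hγ x

theorem markedColor_eq_none_iff (i : R → X) (γ : U × ZMod 3 → X) (π : Equiv.Perm R)
    (x : Marked R U) : markedColor i γ π x = none ↔ ∃ v, x = Sum.inl (Sum.inl v) := by
  rcases x with (v | v) | h <;> simp [markedColor]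

/-- On distinguished half-edges `σ₂` is `π`: the exchange leads to the successor half-edge at `π v`,
and the inverse rotation back to the distinguished one. -/
theorem numBdry_marked (i : R → X) (γ : U × ZMod 3 → X) (π : Equiv.Perm R)
    (τ : Equiv.Perm (R ⊕ U × ZMod 3)) :
    numBdry (markedRot R U) (markedExchange π τ) (markedColor i γ π) =
      Nat.card (PermCycle π) := by
  rw [card_permCycle_eq_cyclesIn]
  refine (card_cyclesIn_congr (fun v : R => (Sum.inl (Sum.inl v) : Marked R U)) (fun v _ => rfl)
    (fun v w _ _ => sameCycle_map_iff (f := fun v : R => (Sum.inl (Sum.inl v) : Marked R U))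
      (fun v w h => by simpa using h) fun v => ?_) ?_).symm
  · rw [Equiv.Perm.mul_apply, markedExchange_inll, markedRot_inv_inlr]
  · intro y hy
    obtain ⟨v, rfl⟩ := (markedColor_eq_none_iff i γ π y).1 hy
    exact ⟨v, trivial, Equiv.Perm.SameCycle.refl _ _⟩

theorem prod_edgeFactor_marked [Fintype R] [Fintype U] {lam : X → ℝ} (hlam : ∀ i, 0 < lam i)
    (i : R → X) (γ : U × ZMod 3 → X) (π : Equiv.Perm R) (τ : Equiv.Perm (R ⊕ U × ZMod 3)) :
    ∏ x, edgeFactor lam (markedColor i γ π x) (markedColor i γ π (markedExchange π τ x)) =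
      (∏ v, 2 / lam (i v)) *
        ∏ h, edgeFactor lam (some (freeColor i γ π h)) (some (freeColor i γ π (τ h))) := by
  rw [Fintype.prod_sum_type]
  congr 1
  rw [Fintype.prod_sum_type]
  simp only [markedExchange_inll, markedExchange_inlr]
  change (∏ v, edgeFactor lam none (some (i (π v)))) * (∏ v, edgeFactor lam (some (i v)) none) = _
  rw [Equiv.prod_comp π fun v => edgeFactor lam none (some (i v)), ← Finset.prod_mul_distrib]
  refine Finset.prod_congr rfl fun v _ => ?_
  rw [edgeFactor_comm, edgeFactor_mul_self hlam]
  simp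

/-! ### Summation over pairings and colors with fixed boundary corners -/

theorem sum_prod_curry {ι κ S : Type} [Fintype ι] [Fintype κ] [DecidableEq ι] [DecidableEq κ]
    [CommSemiring S] {n : Type} [Fintype n] (f : (κ → n) → S) :
    ∑ γ : ι × κ → n, ∏ u, f (fun j => γ (u, j)) = (∑ δ : κ → n, f δ) ^ Fintype.card ι := by
  rw [← Finset.card_univ, ← Finset.prod_const, Finset.prod_univ_sum, Fintype.piFinset_univ]
  exact Fintype.sum_equiv (Equiv.curry ι κ n) _ _ fun γ => rfl

theorem trace_pow_three {S : Type} [CommRing S] {n : Type} [Fintype n] [DecidableEq n]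
    (M : Matrix n n S) :
    ∑ δ : ZMod 3 → n, ∏ j, M (δ j) (δ (j - 1)) = (M ^ 3).trace := by
  let e : (ZMod 3 → n) ≃ n × n × n :=
    { toFun := fun δ => (δ 0, δ 1, δ 2)
      invFun := fun p => (![p.1, p.2.1, p.2.2] : Fin 3 → n)
      left_inv := fun δ => by
        funext j
        change Fin 3 at j
        fin_cases j <;> rfl
      right_inv := fun p => rfl }
  have h1 : ∀ δ : ZMod 3 → n, ∏ j, M (δ j) (δ (j - 1)) =
      M (δ 0) (δ 2) * M (δ 1) (δ 0) * M (δ 2) (δ 1) := fun δ =>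
    Fin.prod_univ_three (fun j : Fin 3 => M (δ j) (δ ((j : Fin 3) - 1 : Fin 3)))
  simp only [h1]
  refine (Fintype.sum_equiv e _ (fun p => M p.1 p.2.2 * M p.2.1 p.1 * M p.2.2 p.2.1)
    fun δ => rfl).trans ?_
  rw [Fintype.sum_prod_type]
  simp only [Matrix.trace, Matrix.diag_apply, pow_succ, pow_zero, one_mul, Matrix.mul_apply,
    Finset.sum_mul, Fintype.sum_prod_type]
  exact Finset.sum_congr rfl fun a _ => Finset.sum_congr rfl fun b _ =>
    Finset.sum_congr rfl fun c _ => by ring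

variable {N : ℕ} {lam : Fin N → ℝ}

/-- Wick's theorem, with the covariance split into square roots `edgeFactor` together with
indicators of matching colors. The indicators for `(h, k)` and `(k, h)` are the two index equations
of the covariance. -/
theorem sum_involution_marked (hlam : ∀ i, 0 < lam i) [Fintype R] [Fintype U]
    [DecidableEq R] [DecidableEq U] (i : R → Fin N) (γ : U × ZMod 3 → Fin N) (π : Equiv.Perm R) :
    ∑ τ : Equiv.Perm (R ⊕ U × ZMod 3) with (τ * τ = 1 ∧ τ.support = Finset.univ) ∧
        ∀ h, freeColor i γ π h = freePredColor i γ (τ h),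
      ((∏ h, edgeFactor lam (some (freeColor i γ π h)) (some (freeColor i γ π (τ h))) : ℝ) : ℂ) =
    gaussianExp (hermVar lam) (∏ h, hermPoly N (freeColor i γ π h) (freePredColor i γ h)) := by
  classical
  let g : R ⊕ U × ZMod 3 → R ⊕ U × ZMod 3 → ℂ := fun h k =>
    if freeColor i γ π h = freePredColor i γ k then
      (edgeFactor lam (some (freeColor i γ π h)) (some (freeColor i γ π k)) : ℂ) else 0
  have hg : ∀ h k, h ≠ k → g h k * g k h =
      if freeColor i γ π h = freePredColor i γ k ∧ freePredColor i γ h = freeColor i γ π k then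
        (2 / (lam (freeColor i γ π h) + lam (freePredColor i γ h)) : ℂ) else 0 := by
    intro h k _
    simp only [g]
    by_cases h1 : freeColor i γ π h = freePredColor i γ k
    · by_cases h2 : freePredColor i γ h = freeColor i γ π k
      · rw [if_pos h1, if_pos h2.symm, if_pos ⟨h1, h2⟩, edgeFactor_comm lam _ (some (freeColor i γ π h)),
          ← Complex.ofReal_mul, edgeFactor_mul_self hlam, h2]
        simp
      · rw [if_neg (Ne.symm h2), if_neg (not_and_of_not_right _ h2), mul_zero]
    · rw [if_neg h1, if_neg (not_and_of_not_left _ h1), zero_mul]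
  rw [gaussianExp_prod_hermPoly hlam _ _ g hg, ← Finset.filter_filter, Finset.sum_filter]
  refine Finset.sum_congr rfl fun τ _ => ?_
  simp only [g]
  rw [Finset.prod_ite_zero]
  simp

/-- The colors at each vertex of `U` sum to one factor `Tr X³`. A vertex `v` of `R` contributes the
entry of `X` at its free half-edge; with a factor `2/λ`, reindexed by `π`, this is the entry `(i (π
v), i v)` of `2 Λ⁻¹ X`. -/
theorem sum_freeColor_marked [Fintype R] [Fintype U] [DecidableEq R] [DecidableEq U] (Q : ℂ)
    (lam : Fin N → ℝ) :
    ∑ i : R → Fin N, ∑ γ : U × ZMod 3 → Fin N, ∑ π : Equiv.Perm R,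
      MvPolynomial.C (Q ^ Nat.card (PermCycle π) * ∏ v, (2 / (lam (i v) : ℂ))) *
        ∏ h, hermPoly N (freeColor i γ π h) (freePredColor i γ h) =
    (hermPoly N ^ 3).trace ^ Fintype.card U *
      permSum R (MvPolynomial.C Q) fun _ => weightedHermPoly lam := by
  have h1 : ∀ (i : R → Fin N) (γ : U × ZMod 3 → Fin N) (π : Equiv.Perm R),
      MvPolynomial.C (Q ^ Nat.card (PermCycle π) * ∏ v, (2 / (lam (i v) : ℂ))) *
        ∏ h, hermPoly N (freeColor i γ π h) (freePredColor i γ h) =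
      (∏ u, ∏ j, hermPoly N (γ (u, j)) (γ (u, j - 1))) * (MvPolynomial.C Q ^ Nat.card (PermCycle π) *
        ∏ v, weightedHermPoly lam (i (π v)) (i v)) := by
    intro i γ π
    rw [Fintype.prod_sum_type, ← Equiv.prod_comp π fun v => (2 / (lam (i v) : ℂ)),
      Fintype.prod_prod_type]
    simp only [map_mul, map_pow, map_prod, weightedHermPoly, Matrix.of_apply,
      Finset.prod_mul_distrib, freeColor, freePredColor, Sum.elim_inl, Sum.elim_inr, rot_inv_apply]
    ring
  simp only [h1]
  rw [permSum, ← trace_pow_three, ← sum_prod_curry]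
  rw [Finset.sum_comm]
  simp only [← Finset.mul_sum, ← Finset.sum_mul]
  congr 1
  rw [Finset.sum_comm]
  simp only [Finset.mul_sum]

theorem sum_strWeight_marked (hlam : ∀ i, 0 < lam i) (Q : ℂ) [Fintype R] [Fintype U]
    [DecidableEq R] [DecidableEq U] :
    ∑ p : Str (markedRot R U) (Fin N) with ∀ x, p.1.2 x = none ↔ ∃ v, x = Sum.inl (Sum.inl v),
      strWeight lam Q (markedRot R U) p.1.1 p.1.2 =
    gaussianExp (hermVar lam) ((hermPoly N ^ 3).trace ^ Fintype.card U *
      permSum R (MvPolynomial.C Q) fun _ => weightedHermPoly lam) := by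
  rw [← sum_freeColor_marked, gaussianExp_sum (hermVar_pos hlam)]
  simp only [gaussianExp_sum (hermVar_pos hlam), gaussianExp_C_mul]
  simp only [← sum_involution_marked hlam, Finset.mul_sum]
  have hsum : ∀ F : (R → Fin N) → (U × ZMod 3 → Fin N) → Equiv.Perm R →
      Equiv.Perm (R ⊕ U × ZMod 3) → ℂ,
      ∑ i : R → Fin N, ∑ γ : U × ZMod 3 → Fin N, ∑ π : Equiv.Perm R,
        ∑ τ : Equiv.Perm (R ⊕ U × ZMod 3) with (τ * τ = 1 ∧ τ.support = Finset.univ) ∧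
          ∀ h, freeColor i γ π h = freePredColor i γ (τ h), F i γ π τ =
      ∑ d : (R → Fin N) × (U × ZMod 3 → Fin N) × Equiv.Perm R × Equiv.Perm (R ⊕ U × ZMod 3) with
        (d.2.2.2 * d.2.2.2 = 1 ∧ d.2.2.2.support = Finset.univ) ∧
          ∀ h, freeColor d.1 d.2.1 d.2.2.1 h = freePredColor d.1 d.2.1 (d.2.2.2 h),
        F d.1 d.2.1 d.2.2.1 d.2.2.2 := fun F => by
    simp only [Finset.sum_filter, Fintype.sum_prod_type]
  rw [hsum]
  symm
  -- The data `(i, γ, π, τ)` parametrise the structures with these boundary half-edges: well defined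
  -- by `isStr_marked_iff`, onto by `exists_of_isStr_marked`.
  refine Finset.sum_bij (fun d hd => ⟨(markedExchange d.2.2.1 d.2.2.2, markedColor d.1 d.2.1 d.2.2.1),
    (isStr_marked_iff _ _ _ _).2 (Finset.mem_filter.1 hd).2⟩) ?_ ?_ ?_ ?_
  · intro d hd
    simp only [Finset.mem_filter, Finset.mem_univ, true_and]
    exact markedColor_eq_none_iff _ _ _
  · rintro ⟨i, γ, π, τ⟩ hd ⟨i', γ', π', τ'⟩ hd' h
    simp only [Subtype.mk.injEq, Prod.mk.injEq] at h
    obtain ⟨h1, h2⟩ := h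
    have e1 : i = i' := funext fun v => by
      simpa [markedColor] using congrFun h2 (Sum.inl (Sum.inr v))
    have e2 : γ = γ' := funext fun x => by
      simpa [markedColor, freeColor] using congrFun h2 (Sum.inr (Sum.inr x))
    have e3 : π = π' := Equiv.ext fun v => by
      simpa [markedExchange] using Equiv.congr_fun h1 (Sum.inl (Sum.inl v))
    have e4 : τ = τ' := Equiv.ext fun h => by
      simpa [markedExchange] using Equiv.congr_fun h1 (Sum.inr h)
    rw [e1, e2, e3, e4]
  · rintro ⟨⟨t, c⟩, hs⟩ hp
    obtain ⟨i, γ, π, τ, rfl, rfl⟩ := exists_of_isStr_marked hs (Finset.mem_filter.1 hp).2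
    exact ⟨(i, γ, π, τ), Finset.mem_filter.2 ⟨Finset.mem_univ _, (isStr_marked_iff _ _ _ _).1 hs⟩, rfl⟩
  · rintro ⟨i, γ, π, τ⟩ hd
    rw [strWeight, numBdry_marked, prod_edgeFactor_marked hlam]
    push_cast
    ring

end Marked
/-! ## The partition function as a sum over structures -/

section PartitionFunction

variable {V : Type} (β : V → Option (ZMod 3))

/-- The half-edges of `V` triangles, with distinguished corners given by `β`. -/
def markedMap : Marked {v // β v ≠ none} {v // ¬ β v ≠ none} → V × ZMod 3
  | Sum.inl (Sum.inl v) => (v, (β v).getD 0)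
  | Sum.inl (Sum.inr v) => (v, (β v).getD 0 + 1)
  | Sum.inr (Sum.inl v) => (v, (β v).getD 0 + 2)
  | Sum.inr (Sum.inr x) => (x.1, x.2)

theorem markedMap_rot (x : Marked {v // β v ≠ none} {v // ¬ β v ≠ none}) :
    markedMap β (markedRot _ _ x) = rot V (markedMap β x) := by
  rcases x with (v | v) | (v | ⟨u, j⟩)
  · rfl
  · change ((v : V), (β v).getD 0 + 2) = ((v : V), (β v).getD 0 + 1 + 1)
    rw [add_assoc]; rfl
  · change ((v : V), (β v).getD 0) = ((v : V), (β v).getD 0 + 2 + 1)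
    rw [add_assoc]
    exact congrArg _ (add_zero _).symm
  · rfl

theorem markedMap_bijective : Function.Bijective (markedMap β) := by
  constructor
  · have h01 : ∀ k : ZMod 3, k ≠ k + 1 := by decide
    have h02 : ∀ k : ZMod 3, k ≠ k + 2 := by decide
    have h12 : ∀ k : ZMod 3, k + 1 ≠ k + 2 := by decide
    rintro ((v | v) | (v | ⟨u, j⟩)) ((w | w) | (w | ⟨u', j'⟩)) h <;>
      simp only [markedMap, Prod.mk.injEq] at h <;> obtain ⟨h1, h2⟩ := h
    · rw [Subtype.ext h1]
    · rw [h1] at h2; exact absurd h2 (h01 _)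
    · rw [h1] at h2; exact absurd h2 (h02 _)
    · exact absurd (h1 ▸ v.2) u'.2
    · rw [h1] at h2; exact absurd h2.symm (h01 _)
    · rw [Subtype.ext h1]
    · rw [h1] at h2; exact absurd h2 (h12 _)
    · exact absurd (h1 ▸ v.2) u'.2
    · rw [h1] at h2; exact absurd h2.symm (h02 _)
    · rw [h1] at h2; exact absurd h2.symm (h12 _)
    · rw [Subtype.ext h1]
    · exact absurd (h1 ▸ v.2) u'.2
    · exact absurd (h1 ▸ w.2) u.2
    · exact absurd (h1 ▸ w.2) u.2
    · exact absurd (h1 ▸ w.2) u.2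
    · rw [Subtype.ext h1, h2]
  · rintro ⟨v, j⟩
    by_cases hv : β v ≠ none
    · have h : ∀ k : ZMod 3, j = k ∨ j = k + 1 ∨ j = k + 2 := by revert j; decide
      rcases h ((β v).getD 0) with h | h | h
      · exact ⟨Sum.inl (Sum.inl ⟨v, hv⟩), by rw [h]; rfl⟩
      · exact ⟨Sum.inl (Sum.inr ⟨v, hv⟩), by rw [h]; rfl⟩
      · exact ⟨Sum.inr (Sum.inl ⟨v, hv⟩), by rw [h]; rfl⟩
    · exact ⟨Sum.inr (Sum.inr (⟨v, hv⟩, j)), rfl⟩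

/-- `markedMap` as a bijection. -/
noncomputable def markedEquiv : Marked {v // β v ≠ none} {v // ¬ β v ≠ none} ≃ V × ZMod 3 :=
  Equiv.ofBijective _ (markedMap_bijective β)

theorem forall_markedEquiv_iff {X : Type} (c : V × ZMod 3 → Option X) :
    (∀ x, c (markedEquiv β x) = none ↔ ∃ v, x = Sum.inl (Sum.inl v)) ↔
      ∀ v j, c (v, j) = none ↔ β v = some j := by
  constructor
  · intro h v j
    obtain ⟨x, hx⟩ := (markedEquiv β).surjective (v, j)
    rw [← hx, h]
    change markedMap β x = _ at hx
    constructor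
    · rintro ⟨w, rfl⟩
      simp only [markedMap, Prod.mk.injEq] at hx
      obtain ⟨rfl, rfl⟩ := hx
      rcases hw : β w with _ | k
      · exact absurd hw w.2
      · rfl
    · intro hv
      refine ⟨⟨v, by simp [hv]⟩, (markedMap_bijective β).1 (hx.trans ?_)⟩
      simp [markedMap, hv]
  · intro h x
    change c (markedMap β x) = none ↔ _
    constructor
    · intro hx
      rw [h] at hx
      refine ⟨⟨(markedMap β x).1, by simp [hx]⟩, (markedMap_bijective β).1 ?_⟩
      change _ = ((markedMap β x).1, (β (markedMap β x).1).getD 0)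
      rw [hx]
      rfl
    · rintro ⟨v, rfl⟩
      rw [h]
      change β v = some ((β v).getD 0)
      rcases hv : β v with _ | k
      · exact absurd hv v.2
      · rfl

open Classical in
/-- The corners on the boundaries. -/
noncomputable def bdryCorner {X : Type} (c : V × ZMod 3 → Option X) (v : V) : Option (ZMod 3) :=
  if h : ∃ j, c (v, j) = none then some h.choose else none

/-- A vertex has at most one boundary corner: any two half-edges of a triangle are consecutive, and
consecutive ones are not both on boundaries. The choice in `bdryCorner` is thus no choice. -/
theorem bdryCorner_eq_iff {X : Type} {t : Equiv.Perm (V × ZMod 3)} {c : V × ZMod 3 → Option X}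
    (hs : IsStr (rot V) t c) :
    bdryCorner c = β ↔ ∀ v j, c (v, j) = none ↔ β v = some j := by
  have huniq : ∀ v j k, c (v, j) = none → c (v, k) = none → j = k := by
    intro v j k hj hk
    have h : ∀ j k : ZMod 3, j = k ∨ k = j + 1 ∨ j = k + 1 := by decide
    rcases h j k with h | h | h
    · exact h
    · subst h; exact absurd hk (hs.not_consecutive hj)
    · subst h; exact absurd hj (hs.not_consecutive hk)
  have hb : ∀ v j, c (v, j) = none ↔ bdryCorner c v = some j := by
    intro v j
    constructor
    · intro h
      have he : ∃ j, c (v, j) = none := ⟨j, h⟩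
      rw [bdryCorner, dif_pos he, huniq v _ _ he.choose_spec h]
    · intro h
      unfold bdryCorner at h
      split_ifs at h with he
      rw [← Option.some_injective _ h]
      exact he.choose_spec
  constructor
  · rintro rfl; exact hb
  · intro h
    funext v
    ext j
    rw [← hb, h]

variable {N : ℕ} {lam : Fin N → ℝ}

/-- Structures are sorted by their boundary corners `β`; `markedEquiv β` carries each class to the
structures with distinguished half-edges that `sum_strWeight_marked` evaluates. -/
theorem sum_strWeight_rot (hlam : ∀ i, 0 < lam i) (Q : ℂ) (V : Type) [Fintype V] [DecidableEq V] :
    ∑ p : Str (rot V) (Fin N), strWeight lam Q (rot V) p.1.1 p.1.2 =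
      ∑ β : V → Option (ZMod 3), gaussianExp (hermVar lam)
        ((hermPoly N ^ 3).trace ^ Fintype.card {v // ¬ β v ≠ none} *
          permSum {v // β v ≠ none} (MvPolynomial.C Q) fun _ => weightedHermPoly lam) := by
  classical
  rw [← Finset.sum_fiberwise (s := Finset.univ)
    (g := fun p : Str (rot V) (Fin N) => bdryCorner p.1.2)]
  refine Finset.sum_congr rfl fun β _ => ?_
  rw [← sum_strWeight_marked hlam Q, Finset.sum_filter, Finset.sum_filter]
  symm
  refine Fintype.sum_equiv (strEquiv (markedEquiv β) (markedMap_rot β)) _ _ fun p => ?_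
  obtain ⟨h1, h2⟩ := strEquiv_spec (markedEquiv β) (markedMap_rot β) p
  refine if_congr ?_ (strWeight_conj (markedEquiv β) (markedMap_rot β) lam Q h1 h2).symm rfl
  rw [bdryCorner_eq_iff β (strEquiv (markedEquiv β) (markedMap_rot β) p).2,
    ← forall_markedEquiv_iff]
  simp only [h2]

theorem even_card_of_str {X : Type} {H : Type} [Fintype H] {s : Equiv.Perm H}
    (p : Str s X) : Even (Fintype.card H) := by
  classical
  have h := Equiv.Perm.two_dvd_card_support (σ := p.1.1) (by
    ext x; rw [sq, Equiv.Perm.mul_apply, p.2.1]; rfl)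
  have h2 : p.1.1.support = Finset.univ := by
    rw [Finset.eq_univ_iff_forall]
    exact fun x => Equiv.Perm.mem_support.2 (p.2.2.1 x)
  rw [h2, Finset.card_univ] at h
  exact even_iff_two_dvd.2 h

/-- The coefficients of the partition function. -/
theorem coeff_tau_eq_sum (hlam : ∀ i, 0 < lam i) (Q : ℂ) (m : ℕ) :
    PowerSeries.coeff m (tau lam Q) =
      (∑ p : Str (rot (Fin m)) (Fin N), strWeight lam Q (rot (Fin m)) p.1.1 p.1.2) /
        (m.factorial * 6 ^ m) := by
  rw [coeff_tau hlam, ← sum_strWeight_rot hlam]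
  rcases Nat.even_or_odd m with hm | hm
  · rw [hm.neg_one_pow]; ring
  · have : IsEmpty (Str (rot (Fin m)) (Fin N)) := ⟨fun p => by
      have h := even_card_of_str p
      rw [Fintype.card_prod, Fintype.card_fin, ZMod.card] at h
      have h3 : Odd 3 := by decide
      exact (Nat.not_even_iff_odd.2 (hm.mul h3)) h⟩
    simp

end PartitionFunction

/-! ## Connected structures and the logarithm -/

section Connected

section Sum

variable {H₁ H₂ X : Type} {s₁ : Equiv.Perm H₁} {s₂ : Equiv.Perm H₂}

/-- The disjoint union of two structures. -/
def strSum (p : Str s₁ X × Str s₂ X) : Str (Equiv.Perm.sumCongr s₁ s₂) X :=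
  ⟨(Equiv.Perm.sumCongr p.1.1.1 p.2.1.1, Sum.elim p.1.1.2 p.2.1.2), by
    obtain ⟨a1, a2, a3, a4⟩ := p.1.2
    obtain ⟨b1, b2, b3, b4⟩ := p.2.2
    refine ⟨?_, ?_, ?_, ?_⟩
    · rintro (x | x)
      · exact congrArg Sum.inl (a1 x)
      · exact congrArg Sum.inr (b1 x)
    · rintro (x | x) h
      · exact a2 x (Sum.inl_injective h)
      · exact b2 x (Sum.inr_injective h)
    · rintro (x | x)
      · exact a3 x
      · exact b3 x
    · rintro (x | x)
      · exact a4 x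
      · exact b4 x⟩

theorem strSum_injective : Function.Injective (strSum (s₁ := s₁) (s₂ := s₂) (X := X)) := by
  rintro ⟨⟨⟨t₁, c₁⟩, h₁⟩, ⟨⟨t₂, c₂⟩, h₂⟩⟩ ⟨⟨⟨t₁', c₁'⟩, h₁'⟩, ⟨⟨t₂', c₂'⟩, h₂'⟩⟩ h
  simp only [strSum, Subtype.mk.injEq, Prod.mk.injEq] at h
  obtain ⟨ht, hc⟩ := h
  have e1 : t₁ = t₁' := Equiv.ext fun x => Sum.inl_injective (Equiv.congr_fun ht (Sum.inl x))
  have e2 : t₂ = t₂' := Equiv.ext fun x => Sum.inr_injective (Equiv.congr_fun ht (Sum.inr x))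
  have e3 : c₁ = c₁' := funext fun x => congrFun hc (Sum.inl x)
  have e4 : c₂ = c₂' := funext fun x => congrFun hc (Sum.inr x)
  simp only [e1, e2, e3, e4]

theorem exists_strSum (p : Str (Equiv.Perm.sumCongr s₁ s₂) X)
    (h : ∀ x, ∃ y, p.1.1 (Sum.inl x) = Sum.inl y) : ∃ q, strSum q = p := by
  obtain ⟨⟨t, c⟩, a1, a2, a3, a4⟩ := p
  simp only at a1 a2 a3 a4 h
  have h' : ∀ x, ∃ y, t (Sum.inr x) = Sum.inr y := by
    intro x
    rcases hx : t (Sum.inr x) with y | y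
    · obtain ⟨z, hz⟩ := h y
      have := a1 (Sum.inr x)
      rw [hx, hz] at this
      simp at this
    · exact ⟨y, rfl⟩
  choose f hf using h
  choose g hg using h'
  have hfi : Function.Involutive f := fun x => Sum.inl_injective (by
    rw [← hf, ← hf, a1])
  have hgi : Function.Involutive g := fun x => Sum.inr_injective (by
    rw [← hg, ← hg, a1])
  refine ⟨(⟨(hfi.toPerm, fun x => c (Sum.inl x)), hfi, fun x hx => a2 (Sum.inl x) ?_, fun x => ?_,
    fun x hx => ?_⟩, ⟨(hgi.toPerm, fun x => c (Sum.inr x)), hgi, fun x hx => a2 (Sum.inr x) ?_,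
    fun x => ?_, fun x hx => ?_⟩), ?_⟩
  · rw [hf]; exact congrArg Sum.inl hx
  · have := a3 (Sum.inl x); rw [hf] at this; exact this
  · have := a4 (Sum.inl x) hx; rw [hf] at this; exact this
  · rw [hg]; exact congrArg Sum.inr hx
  · have := a3 (Sum.inr x); rw [hg] at this; exact this
  · have := a4 (Sum.inr x) hx; rw [hg] at this; exact this
  · apply Subtype.ext
    refine Prod.ext (Equiv.ext ?_) (funext ?_)
    · rintro (x | x)
      · exact (hf x).symm
      · exact (hg x).symm
    · rintro (x | x) <;> rfl

theorem strWeight_strSum [Fintype H₁] [Fintype H₂] (lam : X → ℝ) (Q : ℂ)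
    (p : Str s₁ X × Str s₂ X) :
    strWeight lam Q (Equiv.Perm.sumCongr s₁ s₂) (strSum p).1.1 (strSum p).1.2 =
      strWeight lam Q s₁ p.1.1.1 p.1.1.2 * strWeight lam Q s₂ p.2.1.1 p.2.1.2 := by
  have h : numBdry (Equiv.Perm.sumCongr s₁ s₂) (strSum p).1.1 (strSum p).1.2 =
      numBdry s₁ p.1.1.1 p.1.1.2 + numBdry s₂ p.2.1.1 p.2.1.2 := by
    have hperm : (Equiv.Perm.sumCongr s₁ s₂)⁻¹ * (strSum p).1.1 =
        Equiv.Perm.sumCongr (s₁⁻¹ * p.1.1.1) (s₂⁻¹ * p.2.1.1) := by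
      ext x
      rcases x with x | x <;> rfl
    rw [numBdry, hperm]
    exact card_cyclesIn_sum _ _ fun x => (strSum p).1.2 x = none
  rw [strWeight, strWeight, strWeight, h, pow_add, Fintype.prod_sum_type]
  simp only [strSum, Equiv.Perm.sumCongr_apply, Sum.map_inl, Sum.map_inr, Sum.elim_inl,
    Sum.elim_inr]
  push_cast
  ring

end Sum

variable {X : Type} [Finite X] (lam : X → ℝ) (Q : ℂ)

/-- The sum of the weights of all structures on `V` triangles. -/
noncomputable def strTotal (V : Type) [Fintype V] : ℂ :=
  ∑ p : Str (rot V) X, strWeight lam Q (rot V) p.1.1 p.1.2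

open Classical in
/-- The sum of the weights of the connected structures on `V` triangles. -/
noncomputable def strConn (V : Type) [Fintype V] : ℂ :=
  ∑ p : Str (rot V) X with IsConn (rot V) p.1.1, strWeight lam Q (rot V) p.1.1 p.1.2

theorem rot_conj {V W : Type} (e : V ≃ W) (x : V × ZMod 3) :
    e.prodCongr (Equiv.refl _) (rot V x) = rot W (e.prodCongr (Equiv.refl _) x) := rfl

theorem strTotal_congr {V W : Type} [Fintype V] [Fintype W] (e : V ≃ W) :
    strTotal lam Q V = strTotal lam Q W := by
  refine Fintype.sum_equiv (strEquiv (e.prodCongr (Equiv.refl _)) (rot_conj e)) _ _ fun p => ?_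
  obtain ⟨h1, h2⟩ := strEquiv_spec _ (rot_conj e) p
  exact (strWeight_conj _ (rot_conj e) lam Q h1 h2).symm

theorem strConn_congr {V W : Type} [Fintype V] [Fintype W] (e : V ≃ W) :
    strConn lam Q V = strConn lam Q W := by
  classical
  rw [strConn, strConn, Finset.sum_filter, Finset.sum_filter]
  refine Fintype.sum_equiv (strEquiv (e.prodCongr (Equiv.refl _)) (rot_conj e)) _ _ fun p => ?_
  obtain ⟨h1, h2⟩ := strEquiv_spec _ (rot_conj e) p
  exact if_congr (isConn_conj _ (rot_conj e) h1).symm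
    (strWeight_conj _ (rot_conj e) lam Q h1 h2).symm rfl

/-! ### The connected component of a vertex -/

variable {V : Type}

/-- The vertices in the connected component of `v₀`. -/
def component (v₀ : V) (t : Equiv.Perm (V × ZMod 3)) : Set V :=
  {v | ∀ U : Set (V × ZMod 3), (∀ x ∈ U, rot V x ∈ U) → (∀ x ∈ U, t x ∈ U) → (v₀, 0) ∈ U →
    (v, 0) ∈ U}

theorem rot_closed {U : Set (V × ZMod 3)} (hU : ∀ x ∈ U, rot V x ∈ U) {v : V} {j : ZMod 3}
    (h : (v, j) ∈ U) (k : ZMod 3) : (v, k) ∈ U := by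
  have h1 := hU _ h
  have h2 := hU _ h1
  have h3 : ∀ j k : ZMod 3, k = j ∨ k = j + 1 ∨ k = j + 1 + 1 := by decide
  rcases h3 j k with rfl | rfl | rfl
  · exact h
  · exact h1
  · exact h2

variable (K : Finset V)

/-- Splitting triangles according to a set of vertices. -/
def splitEquiv [DecidableEq V] :
    ({v // v ∈ K} × ZMod 3) ⊕ ({v // v ∉ K} × ZMod 3) ≃ V × ZMod 3 :=
  (Equiv.sumProdDistrib _ _ _).symm.trans
    ((Equiv.sumCompl fun v => v ∈ K).prodCongr (Equiv.refl _))

theorem splitEquiv_inl [DecidableEq V] (x : {v // v ∈ K} × ZMod 3) :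
    splitEquiv K (Sum.inl x) = (↑x.1, x.2) := rfl

theorem splitEquiv_inr [DecidableEq V] (x : {v // v ∉ K} × ZMod 3) :
    splitEquiv K (Sum.inr x) = (↑x.1, x.2) := rfl

theorem splitEquiv_rot [DecidableEq V] (x : ({v // v ∈ K} × ZMod 3) ⊕ ({v // v ∉ K} × ZMod 3)) :
    splitEquiv K (Equiv.Perm.sumCongr (rot _) (rot _) x) = rot V (splitEquiv K x) := by
  rcases x with x | x <;> rfl

variable {K}

omit [Finite X] in
theorem component_split [DecidableEq V] {v₀ : V} (hv₀ : v₀ ∈ K)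
    (q : Str (rot {v // v ∈ K}) X × Str (rot {v // v ∉ K}) X)
    {t : Equiv.Perm (V × ZMod 3)} (ht : ∀ x, splitEquiv K ((strSum q).1.1 x) = t (splitEquiv K x)) :
    component v₀ t = K ↔ IsConn (rot _) q.1.1.1 := by
  have htl : ∀ x, t (splitEquiv K (Sum.inl x)) = splitEquiv K (Sum.inl (q.1.1.1 x)) :=
    fun x => (ht _).symm
  constructor
  · intro h
    have hmem : ∀ U : Set ({v // v ∈ K} × ZMod 3), (∀ x ∈ U, rot _ x ∈ U) →
        (∀ x ∈ U, q.1.1.1 x ∈ U) → (⟨v₀, hv₀⟩, 0) ∈ U → U = Set.univ := by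
      intro U hr hq h0
      rw [Set.eq_univ_iff_forall]
      rintro ⟨⟨v, hv⟩, j⟩
      have hvc : v ∈ component v₀ t := by rw [h]; exact hv
      have := hvc ((fun x => splitEquiv K (Sum.inl x)) '' U) ?_ ?_ ⟨_, h0, rfl⟩
      · obtain ⟨⟨⟨w, hw⟩, k⟩, hx, hxv⟩ := this
        dsimp only at hxv
        rw [splitEquiv_inl] at hxv
        obtain rfl : w = v := congrArg Prod.fst hxv
        exact rot_closed hr hx j
      · rintro _ ⟨x, hx, rfl⟩
        exact ⟨_, hr x hx, rfl⟩
      · rintro _ ⟨x, hx, rfl⟩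
        exact ⟨_, hq x hx, (htl x).symm⟩
    refine ⟨⟨(⟨v₀, hv₀⟩, 0)⟩, fun U hr hq hU => ?_⟩
    by_cases h0 : ((⟨v₀, hv₀⟩, 0) : {v // v ∈ K} × ZMod 3) ∈ U
    · exact hmem U hr hq h0
    -- Complements of closed sets are closed, since `rot` has order three and the exchange is an
    -- involution. A non-empty closed set that misses `v₀` would then be disjoint from everything.
    · have := hmem Uᶜ ?_ ?_ h0
      · obtain ⟨x, hx⟩ := hU
        exact absurd hx (this ▸ Set.mem_univ x : x ∈ Uᶜ)
      · rintro ⟨v, j⟩ hx hx'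
        exact hx (rot_closed hr hx' j)
      · intro x hx hx'
        have := hq _ hx'
        rw [q.1.2.1] at this
        exact hx this
  · rintro ⟨-, h⟩
    ext v
    constructor
    · intro hv
      refine hv {x | x.1 ∈ K} (fun x hx => hx) ?_ hv₀
      rintro ⟨w, j⟩ hw
      have := htl (⟨w, hw⟩, j)
      rw [splitEquiv_inl] at this
      rw [this, splitEquiv_inl]
      exact (q.1.1.1 (⟨w, hw⟩, j)).1.2
    · intro hv U hr hU h0
      have := h ((fun x => splitEquiv K (Sum.inl x)) ⁻¹' U) (fun x hx => hr _ hx)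
        (fun x hx => by rw [Set.mem_preimage, ← htl]; exact hU _ hx) ⟨(⟨v₀, hv₀⟩, 0), h0⟩
      have h2 := Set.eq_univ_iff_forall.1 this (⟨v, hv⟩, 0)
      exact h2

theorem component_closed {v₀ : V} {t : Equiv.Perm (V × ZMod 3)} {v : V} (hv : v ∈ component v₀ t)
    (j : ZMod 3) : (t (v, j)).1 ∈ component v₀ t := fun U hr hU h0 =>
  rot_closed hr (hU _ (rot_closed hr (hv U hr hU h0) j) : ((t (v, j)).1, (t (v, j)).2) ∈ U) 0

open Classical in
theorem sum_component_eq [Fintype V] [DecidableEq V] {v₀ : V} (hv₀ : v₀ ∈ K) :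
    ∑ p : Str (rot V) X with component v₀ p.1.1 = K, strWeight lam Q (rot V) p.1.1 p.1.2 =
      strConn lam Q {v // v ∈ K} * strTotal lam Q {v // v ∉ K} := by
  rw [strConn, strTotal, Finset.sum_mul_sum, ← Finset.sum_product']
  symm
  refine Finset.sum_bij (fun q _ => strEquiv (splitEquiv K) (splitEquiv_rot K) (strSum q)) ?_ ?_ ?_ ?_
  · intro q hq
    obtain ⟨h1, h2⟩ := strEquiv_spec _ (splitEquiv_rot K) (strSum q)
    simp only [Finset.mem_product, Finset.mem_filter, Finset.mem_univ, true_and, and_true] at hq ⊢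
    exact (component_split hv₀ q h1).2 hq
  · intro q _ q' _ h
    exact strSum_injective ((strEquiv _ _).injective h)
  · intro p hp
    have hp' := (Finset.mem_filter.1 hp).2
    obtain ⟨p', rfl⟩ := (strEquiv (splitEquiv K) (splitEquiv_rot K)).surjective p
    obtain ⟨h1, h2⟩ := strEquiv_spec _ (splitEquiv_rot K) p'
    obtain ⟨q, rfl⟩ := exists_strSum p' (by
      rintro ⟨⟨v, hv⟩, j⟩
      rcases hx : p'.1.1 (Sum.inl (⟨v, hv⟩, j)) with y | y
      · exact ⟨y, rfl⟩
      · exfalso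
        have h3 := h1 (Sum.inl (⟨v, hv⟩, j))
        rw [hx, splitEquiv_inl, splitEquiv_inr] at h3
        have h4 := component_closed (hp' ▸ Finset.mem_coe.2 hv : v ∈ component v₀ _) j
        rw [← h3, hp'] at h4
        exact y.1.2 h4)
    refine ⟨q, ?_, rfl⟩
    simp only [Finset.mem_product, Finset.mem_filter, Finset.mem_univ, true_and, and_true]
    exact (component_split hv₀ q h1).1 hp'
  · intro q _
    obtain ⟨h1, h2⟩ := strEquiv_spec _ (splitEquiv_rot K) (strSum q)
    rw [← strWeight_strSum, strWeight_conj _ (splitEquiv_rot K) lam Q h1 h2]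

/-- Structures are sorted by the vertex set of the component of `0`, which consists of `0` and of
`k` among the other `m` vertices; the weight is multiplicative over the component and its
complement. -/
theorem strTotal_fin_succ (m : ℕ) :
    strTotal lam Q (Fin (m + 1)) = ∑ k ∈ Finset.range (m + 1),
      (m.choose k : ℂ) * (strConn lam Q (Fin (k + 1)) * strTotal lam Q (Fin (m - k))) := by
  classical
  have h1 : strTotal lam Q (Fin (m + 1)) = ∑ K : Finset (Fin (m + 1)),
      ∑ p : Str (rot (Fin (m + 1))) X with component 0 p.1.1 = (K : Set _),
        strWeight lam Q (rot (Fin (m + 1))) p.1.1 p.1.2 := by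
    rw [strTotal, ← Finset.sum_fiberwise (s := Finset.univ)
      (g := fun p : Str (rot (Fin (m + 1))) X => (component 0 p.1.1).toFinset)]
    refine Finset.sum_congr rfl fun K _ => Finset.sum_congr ?_ fun _ _ => rfl
    ext p
    simp only [Finset.mem_filter, Finset.mem_univ, true_and, ← Finset.coe_inj, Set.coe_toFinset]
  have h2 : ∀ K : Finset (Fin (m + 1)), 0 ∈ K →
      ∑ p : Str (rot (Fin (m + 1))) X with component 0 p.1.1 = (K : Set _),
        strWeight lam Q (rot (Fin (m + 1))) p.1.1 p.1.2 =
      strConn lam Q (Fin K.card) * strTotal lam Q (Fin (m + 1 - K.card)) := by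
    intro K hK
    rw [sum_component_eq lam Q hK]
    congr 1
    · exact strConn_congr lam Q (K.equivFin)
    · refine strTotal_congr lam Q (Fintype.equivFinOfCardEq ?_)
      rw [Fintype.card_subtype_compl, Fintype.card_fin, Fintype.card_coe]
  have h3 : ∀ K : Finset (Fin (m + 1)), 0 ∉ K →
      ∑ p : Str (rot (Fin (m + 1))) X with component 0 p.1.1 = (K : Set _),
        strWeight lam Q (rot (Fin (m + 1))) p.1.1 p.1.2 = 0 := by
    intro K hK
    rw [Finset.filter_false_of_mem, Finset.sum_empty]
    intro p _ hp
    have : (0 : Fin (m + 1)) ∈ component 0 p.1.1 := fun U _ _ h => h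
    rw [hp] at this
    exact hK this
  rw [h1, ← Finset.powerset_univ, ← Finset.insert_erase (Finset.mem_univ (0 : Fin (m + 1))),
    Finset.sum_powerset_insert (Finset.notMem_erase _ _), Finset.sum_eq_zero, zero_add]
  · have h4 : ∀ L ∈ (Finset.univ.erase (0 : Fin (m + 1))).powerset,
        ∑ p : Str (rot (Fin (m + 1))) X with component 0 p.1.1 = ((insert 0 L : Finset _) : Set _),
          strWeight lam Q (rot (Fin (m + 1))) p.1.1 p.1.2 =
        strConn lam Q (Fin (L.card + 1)) * strTotal lam Q (Fin (m - L.card)) := by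
      intro L hL
      have h0 : 0 ∉ L := fun h => by simpa using Finset.mem_powerset.1 hL h
      rw [h2 _ (Finset.mem_insert_self _ _), Finset.card_insert_of_notMem h0, Nat.add_sub_add_right]
    rw [Finset.sum_congr rfl h4, Finset.sum_powerset_apply_card
      (fun k => strConn lam Q (Fin (k + 1)) * strTotal lam Q (Fin (m - k)))]
    simp
  · intro L hL
    exact h3 L fun h => by simpa using Finset.mem_powerset.1 hL h

theorem strConn_zero : strConn lam Q (Fin 0) = 0 := by
  classical
  rw [strConn, Finset.filter_false_of_mem, Finset.sum_empty]
  rintro p _ ⟨⟨x⟩, -⟩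
  exact x.1.elim0

theorem strTotal_zero : strTotal lam Q (Fin 0) = 1 := by
  have hu : ∀ p q : Str (rot (Fin 0)) X, p = q := fun p q =>
    Subtype.ext (Prod.ext (Equiv.ext fun x => x.1.elim0) (funext fun x => x.1.elim0))
  let p0 : Str (rot (Fin 0)) X := ⟨(1, fun x => x.1.elim0), fun x => x.1.elim0,
    fun x => x.1.elim0, fun x => x.1.elim0, fun x => x.1.elim0⟩
  rw [strTotal, Fintype.sum_eq_single p0 fun q hq => absurd (hu q p0) hq, strWeight, numBdry]
  have : IsEmpty (CyclesIn ((rot (Fin 0))⁻¹ * p0.1.1) fun x => p0.1.2 x = none) :=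
    ⟨fun q => by obtain ⟨q, x, -⟩ := q; exact x.1.elim0⟩
  simp

end Connected

section FreeEnergy

variable {N : ℕ} {lam : Fin N → ℝ}

theorem constantCoeff_tau (hlam : ∀ i, 0 < lam i) (Q : ℂ) :
    PowerSeries.constantCoeff (tau lam Q) = 1 := by
  rw [← PowerSeries.coeff_zero_eq_constantCoeff_apply, coeff_tau_eq_sum hlam]
  have := strTotal_zero lam Q
  rw [strTotal] at this
  rw [this]
  simp

/-- The free energy is the generating function of the connected structures. -/
theorem coeff_freeEnergy (hlam : ∀ i, 0 < lam i) (Q : ℂ) (m : ℕ) :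
    PowerSeries.coeff m (freeEnergy lam Q) =
      strConn lam Q (Fin m) / (m.factorial * 6 ^ m) := by
  have h : freeEnergy lam Q =
      PowerSeries.mk fun m => strConn lam Q (Fin m) / (m.factorial * 6 ^ m) := by
    -- The equation `τ' = τ F'` in degree `m` is `strTotal_fin_succ` divided by `m! 6^(m+1)`.
    refine logOf_eq_of_derivative (constantCoeff_tau hlam Q) ?_ ?_
    · simp [strConn_zero]
    · ext m
      rw [PowerSeries.coeff_derivative, coeff_tau_eq_sum hlam, PowerSeries.coeff_mul]
      have h1 := strTotal_fin_succ lam Q m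
      rw [strTotal] at h1
      rw [h1]
      simp only [PowerSeries.coeff_derivative, PowerSeries.coeff_mk, coeff_tau_eq_sum hlam]
      rw [← Finset.Nat.sum_antidiagonal_swap]
      have h2 := Finset.Nat.sum_antidiagonal_eq_sum_range_succ (fun k j =>
        (∑ p : Str (rot (Fin j)) (Fin N), strWeight lam Q (rot (Fin j)) p.1.1 p.1.2) /
          (j.factorial * 6 ^ j : ℂ) * (strConn lam Q (Fin (k + 1)) /
            ((k + 1).factorial * 6 ^ (k + 1)) * (k + 1))) m
      refine Eq.trans ?_ h2.symm
      rw [Finset.sum_div, Finset.sum_mul]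
      refine Finset.sum_congr rfl fun k hk => ?_
      have hk' : k ≤ m := Nat.lt_succ_iff.1 (Finset.mem_range.1 hk)
      obtain ⟨j, rfl⟩ := Nat.exists_eq_add_of_le hk'
      rw [Nat.add_sub_cancel_left, strTotal]
      generalize (∑ p : Str (rot (Fin j)) (Fin N), strWeight lam Q (rot (Fin j)) p.1.1 p.1.2) = A
      generalize strConn lam Q (Fin (k + 1)) = B
      have h5 : ((k + j).choose k : ℂ) * k.factorial * j.factorial = (k + j).factorial := by
        rw [Nat.choose_symm_add]
        exact_mod_cast Nat.add_choose_mul_factorial_mul_factorial k j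
      have h6 : (k.factorial : ℂ) ≠ 0 := by exact_mod_cast k.factorial_ne_zero
      have h7 : (j.factorial : ℂ) ≠ 0 := by exact_mod_cast j.factorial_ne_zero
      have h8 : (k : ℂ) + 1 ≠ 0 := by exact_mod_cast k.succ_ne_zero
      have h9 : (k : ℂ) + j + 1 ≠ 0 := by exact_mod_cast (k + j).succ_ne_zero
      have h10 : ((k + j).choose k : ℂ) ≠ 0 := by
        exact_mod_cast (Nat.choose_pos (Nat.le_add_right k j)).ne'
      rw [Nat.factorial_succ, Nat.factorial_succ]
      push_cast
      rw [← h5]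
      field_simp
      try ring
  rw [h, PowerSeries.coeff_mk]

end FreeEnergy

/-! ## Permutations all of whose cycles have length three -/

section Triangles

theorem cycleType_of_triangles {α : Type} [Fintype α] [DecidableEq α] {σ : Equiv.Perm α}
    (h3 : ∀ x, σ (σ (σ x)) = x) (h1 : ∀ x, σ x ≠ x) :
    ∃ k, Fintype.card α = 3 * k ∧ σ.cycleType = Multiset.replicate k 3 := by
  have hσ : σ ^ 3 = 1 := by
    ext x
    simpa [pow_succ] using h3 x
  have hall : ∀ n ∈ σ.cycleType, n = 3 := by
    intro n hn
    have h2 := Equiv.Perm.two_le_of_mem_cycleType hn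
    have hd := (Equiv.Perm.dvd_of_mem_cycleType hn).trans (orderOf_dvd_of_pow_eq_one hσ)
    rcases (Nat.dvd_prime Nat.prime_three).1 hd with h | h <;> omega
  have hrep := Multiset.eq_replicate_of_mem hall
  refine ⟨Multiset.card σ.cycleType, ?_, hrep⟩
  have hs := σ.sum_cycleType
  have hsupp : σ.support = Finset.univ := Finset.eq_univ_iff_forall.2 fun x =>
    Equiv.Perm.mem_support.2 (h1 x)
  rw [hsupp, Finset.card_univ, hrep, Multiset.sum_replicate, smul_eq_mul] at hs
  omega

theorem rot_rot_rot {V : Type} (x : V × ZMod 3) : rot V (rot V (rot V x)) = x := by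
  obtain ⟨v, j⟩ := x
  have h : ∀ j : ZMod 3, j + 1 + 1 + 1 = j := by decide
  simp [h]

theorem rot_ne {V : Type} (x : V × ZMod 3) : rot V x ≠ x := by
  obtain ⟨v, j⟩ := x
  simp

theorem rot_rot_ne {V : Type} (x : V × ZMod 3) : rot V (rot V x) ≠ x := by
  obtain ⟨v, j⟩ := x
  have h : ∀ j : ZMod 3, j + 1 + 1 ≠ j := by decide
  simp [h]

theorem cycleType_rot (m : ℕ) : (rot (Fin m)).cycleType = Multiset.replicate m 3 := by
  obtain ⟨k, hk, h⟩ := cycleType_of_triangles (rot_rot_rot (V := Fin m)) rot_ne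
  rw [Fintype.card_prod, Fintype.card_fin, ZMod.card] at hk
  rw [h]
  congr 1
  omega

theorem card_permCycle_rot (V : Type) [Finite V] : Nat.card (PermCycle (rot V)) = Nat.card V := by
  refine Nat.card_eq_of_bijective (Quotient.lift Prod.fst fun x y h => ?_) ⟨?_, fun v =>
    ⟨Quotient.mk _ (v, 0), rfl⟩⟩
  · have := sameCycle_map (σ := rot V) (σ' := (1 : Equiv.Perm V)) Prod.fst
      (fun x => Equiv.Perm.SameCycle.refl _ _) h
    simpa using this
  · intro a b h
    induction a using Quotient.inductionOn with | h x => ?_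
    induction b using Quotient.inductionOn with | h y => ?_
    obtain ⟨v, j⟩ := x
    obtain ⟨w, k⟩ := y
    obtain rfl : v = w := h
    refine Quotient.sound ?_
    have h3 : ∀ j k : ZMod 3, k = j ∨ k = j + 1 ∨ k = j + 1 + 1 := by decide
    rcases h3 j k with rfl | rfl | rfl
    · exact Equiv.Perm.SameCycle.refl _ _
    · exact ⟨1, by simp⟩
    · exact ⟨2, by rw [zpow_two, Equiv.Perm.mul_apply, rot_apply, rot_apply]⟩

/-- A permutation all of whose cycles have length three is a rotation of triangles. -/
theorem exists_conj_rot {α : Type} [Fintype α] [DecidableEq α] {σ : Equiv.Perm α}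
    (h3 : ∀ x, σ (σ (σ x)) = x) (h1 : ∀ x, σ x ≠ x) :
    ∃ e : α ≃ Fin (Nat.card (PermCycle σ)) × ZMod 3, ∀ x, e (σ x) = rot _ (e x) := by
  obtain ⟨k, hk, hσ⟩ := cycleType_of_triangles h3 h1
  have e0 : α ≃ Fin k × ZMod 3 := Fintype.equivOfCardEq (by
    rw [Fintype.card_prod, Fintype.card_fin, ZMod.card, hk, mul_comm])
  obtain ⟨k', hk', h⟩ := cycleType_of_triangles (σ := e0.permCongr σ)
    (fun x => by simp [h3]) (fun x hx => h1 (e0.symm x) (by simpa [Equiv.eq_symm_apply] using hx))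
  have hkk : k' = k := by
    rw [Fintype.card_prod, Fintype.card_fin, ZMod.card] at hk'
    omega
  rw [hkk, ← cycleType_rot, ← Equiv.Perm.isConj_iff_cycleType_eq, isConj_iff] at h
  obtain ⟨c, hc⟩ := h
  have he : ∀ x, (e0.trans c) (σ x) = rot _ ((e0.trans c) x) := fun x => by
    rw [← hc]
    simp
  have hcard : Nat.card (PermCycle σ) = k := by
    rw [card_permCycle_conj _ he, card_permCycle_rot, Nat.card_fin]
  rw [hcard]
  exact ⟨_, he⟩

theorem card_centralizer_rot (m : ℕ) :
    Nat.card {a : Equiv.Perm (Fin m × ZMod 3) // ∀ x, a (rot _ x) = rot _ (a x)} =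
      m.factorial * 3 ^ m := by
  have h := Equiv.Perm.nat_card_centralizer (rot (Fin m))
  have h2 : Nat.card {a : Equiv.Perm (Fin m × ZMod 3) // ∀ x, a (rot _ x) = rot _ (a x)} =
      Nat.card (Subgroup.centralizer {rot (Fin m)}) := by
    refine Nat.card_congr (Equiv.subtypeEquivRight fun a => ?_)
    rw [Subgroup.mem_centralizer_singleton_iff]
    constructor
    · intro h; ext1 x; exact h x
    · intro h x; exact Equiv.congr_fun h x
  rw [h2, h, cycleType_rot]
  rcases m.eq_zero_or_pos with rfl | hm
  · simp
  · simp [Multiset.toFinset_replicate, hm.ne', mul_comm]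

end Triangles

/-! ## Isomorphism classes of graphs and structures on triangles -/

namespace ColoredRibbonGraph

variable {H X : Type}

open Classical in
/-- The coloring as a map defined on all half-edges, with value `none` on the boundaries. -/
noncomputable def colorOpt (Γ : ColoredRibbonGraph X) (x : Fin Γ.size) : Option X :=
  if h : x ∈ Γ.graph.B then none else some (Γ.color ⟨x, h⟩)

theorem colorOpt_eq_none_iff {Γ : ColoredRibbonGraph X} {x : Fin Γ.size} :
    Γ.colorOpt x = none ↔ x ∈ Γ.graph.B := by
  rw [colorOpt]
  split_ifs with h <;> simp [h]

theorem colorOpt_of_notMem {Γ : ColoredRibbonGraph X} {x : Fin Γ.size} (h : x ∉ Γ.graph.B) :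
    Γ.colorOpt x = some (Γ.color ⟨x, h⟩) := dif_neg h

/-- Only `σ₂ B ⊆ B` is an axiom; an injective self-map of a finite set that preserves a subset also
preserves its complement. -/
theorem σ₂_mem_iff (Γ : ColoredRibbonGraph X) (x : Fin Γ.size) :
    Γ.graph.σ₂ x ∈ Γ.graph.B ↔ x ∈ Γ.graph.B := by
  have h : Set.MapsTo Γ.graph.σ₂ Γ.graph.B Γ.graph.B := fun x hx => Γ.graph.B_cycle x hx
  refine ⟨fun hx => ?_, fun hx => h hx⟩
  have := Equiv.Perm.perm_symm_mapsTo_of_mapsTo _ h hx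
  rwa [Equiv.symm_apply_apply] at this

theorem colorOpt_σ₂ (Γ : ColoredRibbonGraph X) (x : Fin Γ.size) :
    Γ.colorOpt (Γ.graph.σ₂ x) = Γ.colorOpt x := by
  by_cases hx : x ∈ Γ.graph.B
  · rw [colorOpt_eq_none_iff.2 hx, colorOpt_eq_none_iff.2 ((σ₂_mem_iff Γ x).2 hx)]
  · have hx' := fun h => hx ((σ₂_mem_iff Γ x).1 h)
    rw [colorOpt_of_notMem hx, colorOpt_of_notMem hx',
      Γ.color_cycle ⟨x, hx⟩ ⟨_, hx'⟩ rfl]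

theorem isStr (Γ : ColoredRibbonGraph X) : IsStr Γ.graph.σ₀ Γ.graph.σ₁ Γ.colorOpt :=
  ⟨Γ.graph.σ₁_invol, Γ.graph.σ₁_ne, Γ.colorOpt_σ₂, fun x hx h =>
    Γ.graph.B_edge x (colorOpt_eq_none_iff.1 hx) (colorOpt_eq_none_iff.1 h)⟩

theorem isIso_iff {Γ Γ' : ColoredRibbonGraph X} {a : Fin Γ.size ≃ Fin Γ'.size} :
    IsIso Γ Γ' a ↔ (∀ x, a (Γ.graph.σ₀ x) = Γ'.graph.σ₀ (a x)) ∧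
      (∀ x, a (Γ.graph.σ₁ x) = Γ'.graph.σ₁ (a x)) ∧ ∀ x, Γ'.colorOpt (a x) = Γ.colorOpt x := by
  refine and_congr_right fun _ => and_congr_right fun _ => ⟨fun ⟨hB, hc⟩ x => ?_, fun h =>
    ⟨fun x => ?_, fun x hx hx' => ?_⟩⟩
  · by_cases hx : x ∈ Γ.graph.B
    · rw [colorOpt_eq_none_iff.2 hx, colorOpt_eq_none_iff.2 ((hB x).2 hx)]
    · rw [colorOpt_of_notMem hx, colorOpt_of_notMem (fun h => hx ((hB x).1 h)), hc x hx]
  · rw [← colorOpt_eq_none_iff, h, colorOpt_eq_none_iff]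
  · have := h x
    rwa [colorOpt_of_notMem hx, colorOpt_of_notMem hx', Option.some_inj] at this

/-- `e` is an isomorphism from the structure `(s, t, c)` to the graph `Γ`. -/
def IsoFrom (s t : Equiv.Perm H) (c : H → Option X) (Γ : ColoredRibbonGraph X)
    (e : H ≃ Fin Γ.size) : Prop :=
  (∀ x, e (s x) = Γ.graph.σ₀ (e x)) ∧ (∀ x, e (t x) = Γ.graph.σ₁ (e x)) ∧
    ∀ x, Γ.colorOpt (e x) = c x

theorem IsoFrom.trans_iff {s t : Equiv.Perm H} {c : H → Option X} {Γ Γ' : ColoredRibbonGraph X}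
    {e : H ≃ Fin Γ.size} (h : IsoFrom s t c Γ e) {a : Fin Γ.size ≃ Fin Γ'.size} :
    IsoFrom s t c Γ' (e.trans a) ↔ IsIso Γ Γ' a := by
  rw [isIso_iff, IsoFrom]
  refine and_congr ?_ (and_congr ?_ ?_) <;> rw [← e.forall_congr_right (q := fun y => _)] <;>
    refine forall_congr' fun x => ?_
  · simp [h.1]
  · simp [h.2.1]
  · simp [h.2.2]

/-- The colored ribbon graph given by a structure on a set of half-edges. -/
noncomputable def ofStr [Finite H] (s : Equiv.Perm H) (hs : ∀ x, s x ≠ x ∧ s (s x) ≠ x)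
    (p : Str s X) : ColoredRibbonGraph X :=
  let e := Finite.equivFin H
  have h' : ∀ y, (e.permCongr s)⁻¹ y = e (s⁻¹ (e.symm y)) := fun y => by
    rw [Equiv.Perm.inv_eq_iff_eq]; simp
  { size := Nat.card H
    graph :=
      { σ₀ := e.permCongr s
        σ₁ := e.permCongr p.1.1
        B := {x | p.1.2 (e.symm x) = none}
        σ₁_invol := fun x => by simp [p.2.1]
        σ₁_ne := fun x hx => p.2.2.1 (e.symm x) (by simpa [Equiv.eq_symm_apply] using hx)
        B_cycle := fun x hx => by
          have := p.2.2.2.1 (e.symm x)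
          rw [Set.mem_ofPred_eq] at hx ⊢
          rw [h', Equiv.symm_apply_apply, Equiv.permCongr_apply, Equiv.symm_apply_apply, this, hx]
        B_edge := fun x hx => by
          have := p.2.2.2.2 (e.symm x) hx
          simpa using this
        degree := fun x => ⟨fun hx => (hs (e.symm x)).1 (by
            simpa [Equiv.eq_symm_apply] using hx), fun hx => (hs (e.symm x)).2 (by
            simpa [Equiv.eq_symm_apply] using hx)⟩ }
    color := fun x => (p.1.2 (e.symm x)).get (Option.ne_none_iff_isSome.1 x.2)
    color_cycle := fun x y hxy => by
      have h1 : p.1.2 (e.symm y) = p.1.2 (e.symm x) := by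
        rw [← hxy, RibbonGraph.σ₂, Equiv.Perm.mul_apply, h', Equiv.symm_apply_apply,
          Equiv.permCongr_apply, Equiv.symm_apply_apply, p.2.2.2.1]
      simp only [h1] }

/-- The numbering of the half-edges of `ofStr`. -/
noncomputable def ofStrEquiv [Finite H] (s : Equiv.Perm H) (hs : ∀ x, s x ≠ x ∧ s (s x) ≠ x)
    (p : Str s X) : H ≃ Fin (ofStr s hs p).size :=
  Finite.equivFin H

theorem isoFrom_ofStr [Finite H] (s : Equiv.Perm H) (hs : ∀ x, s x ≠ x ∧ s (s x) ≠ x)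
    (p : Str s X) : IsoFrom s p.1.1 p.1.2 (ofStr s hs p) (ofStrEquiv s hs p) := by
  have hes := fun x => (Finite.equivFin H).symm_apply_apply x
  refine ⟨fun x => congrArg (fun y => Finite.equivFin H (s y)) (hes x).symm,
    fun x => congrArg (fun y => Finite.equivFin H (p.1.1 y)) (hes x).symm, fun x => ?_⟩
  have hB : (Finite.equivFin H x ∈ (ofStr s hs p).graph.B) = (p.1.2 x = none) :=
    congrArg (fun y => p.1.2 y = none) (hes x)
  by_cases h : p.1.2 x = none
  · rw [h]
    exact colorOpt_eq_none_iff.2 (hB.mpr h)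
  · rw [← hB] at h
    refine (colorOpt_of_notMem h).trans ?_
    exact (Option.some_get _).trans (congrArg p.1.2 (hes x))

theorem mk_ofStr_eq_iff [Finite H] {s : Equiv.Perm H} {hs : ∀ x, s x ≠ x ∧ s (s x) ≠ x}
    {p : Str s X} {q : IsoClass X} :
    (Quotient.mk _ (ofStr s hs p) : IsoClass X) = q ↔ ∃ e, IsoFrom s p.1.1 p.1.2 q.out e := by
  rw [Quotient.mk_eq_iff_out]
  constructor
  · rintro ⟨a, ha⟩
    exact ⟨_, (isoFrom_ofStr s hs p).trans_iff.2 ha⟩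
  · rintro ⟨e, he⟩
    refine ⟨(ofStrEquiv s hs p).symm.trans e, (isoFrom_ofStr s hs p).trans_iff.1 ?_⟩
    rwa [← Equiv.trans_assoc, Equiv.self_trans_symm, Equiv.refl_trans]

theorem autCard_ne_zero (Γ : ColoredRibbonGraph X) : Γ.autCard ≠ 0 := by
  have : Nonempty {a // IsIso Γ Γ a} := ⟨⟨Equiv.refl _, isIso_iff.2 (by simp)⟩⟩
  exact Nat.card_ne_zero.2 ⟨this, inferInstance⟩

/-- The isomorphisms from a fixed structure to `Γ` form a torsor under `Aut Γ`. -/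
theorem IsoFrom.card {s t : Equiv.Perm H} {c : H → Option X} {Γ : ColoredRibbonGraph X}
    {e : H ≃ Fin Γ.size} (h : IsoFrom s t c Γ e) :
    Nat.card {e // IsoFrom s t c Γ e} = Γ.autCard := by
  refine (Nat.card_congr (Equiv.subtypeEquiv (Equiv.equivCongr (Equiv.refl _) (Equiv.refl _)
    |>.trans ⟨fun a => e.trans a, fun f => e.symm.trans f, fun a => ?_, fun f => ?_⟩)
    fun a => ?_)).symm
  · ext x; simp
  · ext x; simp
  · exact h.trans_iff.symm

theorem exists_equiv_rot {Γ : ColoredRibbonGraph X} (h : Γ.graph.Trivalent) :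
    ∃ e : Fin Γ.graph.numVertices × ZMod 3 ≃ Fin Γ.size,
      ∀ x, e (rot _ x) = Γ.graph.σ₀ (e x) := by
  obtain ⟨e, he⟩ := exists_conj_rot h fun x => (Γ.graph.degree x).1
  exact ⟨e.symm, fun x => (Equiv.symm_apply_eq _).2
    ((he (e.symm x)).trans (congrArg _ (e.apply_symm_apply x))).symm⟩

theorem rot_degree {V : Type} (x : V × ZMod 3) : rot V x ≠ x ∧ rot V (rot V x) ≠ x :=
  ⟨rot_ne x, rot_rot_ne x⟩

/-- The number of structures on `m` triangles that are isomorphic to a given graph. -/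
theorem card_str_mul_autCard [Finite X] {m : ℕ} {q : IsoClass X} (h : q.out.graph.Trivalent)
    (hm : q.out.graph.numVertices = m) :
    Nat.card {p : Str (rot (Fin m)) X // Quotient.mk _ (ofStr _ rot_degree p) = q} *
      q.out.autCard = m.factorial * 3 ^ m := by
  obtain ⟨e, he⟩ : ∃ e : Fin m × ZMod 3 ≃ Fin q.out.size,
      ∀ x, e (rot _ x) = q.out.graph.σ₀ (e x) := hm ▸ exists_equiv_rot h
  -- Double counting of `A`: as a torsor under the centralizer of `rot` it has `m! 3^m` elements.
  -- Each of them pulls the graph back to a structure on triangles, and a given isomorphic structure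
  -- arises from as many of them as there are automorphisms.
  let A := {f : Fin m × ZMod 3 ≃ Fin q.out.size // ∀ x, f (rot _ x) = q.out.graph.σ₀ (f x)}
  have h1 : Nat.card A = m.factorial * 3 ^ m := by
    rw [← card_centralizer_rot]
    refine Nat.card_congr (Equiv.subtypeEquiv ⟨fun f => f.trans e.symm, fun a => a.trans e,
      fun a => ?_, fun f => ?_⟩ fun f => ?_)
    · ext x; simp
    · exact Equiv.ext fun x => e.symm_apply_apply (f x)
    · refine forall_congr' fun x => ?_
      simp [Equiv.symm_apply_eq, he]
  have h2 : A ≃ Σ p : {p : Str (rot (Fin m)) X // Quotient.mk _ (ofStr _ rot_degree p) = q},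
      {f // IsoFrom (rot (Fin m)) p.1.1.1 p.1.1.2 q.out f} :=
    { toFun := fun f =>
        have hf : ∀ x, f.1.symm (q.out.graph.σ₀ x) = rot _ (f.1.symm x) := fun x => by
          rw [Equiv.symm_apply_eq, f.2, Equiv.apply_symm_apply]
        let p := strEquiv f.1.symm hf ⟨(q.out.graph.σ₁, q.out.colorOpt), q.out.isStr⟩
        have hp : IsoFrom (rot (Fin m)) p.1.1 p.1.2 q.out f.1 :=
          ⟨f.2, fun x => by simp [p, strEquiv], fun x => by simp [p, strEquiv]⟩
        ⟨⟨p, mk_ofStr_eq_iff.2 ⟨f.1, hp⟩⟩, ⟨f.1, hp⟩⟩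
      invFun := fun z => ⟨z.2.1, z.2.2.1⟩
      left_inv := fun f => rfl
      right_inv := fun z => by
        obtain ⟨⟨⟨⟨t, c⟩, hp⟩, hq⟩, f, hf⟩ := z
        have h1 : ∀ x, f.symm (q.out.graph.σ₁ (f x)) = t x := fun x => by
          rw [Equiv.symm_apply_eq, hf.2.1]
        have h2 : ∀ x, q.out.colorOpt (f x) = c x := hf.2.2
        have h3 : f.symm.permCongr q.out.graph.σ₁ = t := Equiv.ext fun x => by simp [h1]
        have h4 : (fun x => q.out.colorOpt (f x)) = c := funext h2
        subst h3 h4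
        rfl }
  rw [← h1, Nat.card_congr h2]
  cases nonempty_fintype {p : Str (rot (Fin m)) X // Quotient.mk _ (ofStr _ rot_degree p) = q}
  rw [Nat.card_sigma, Finset.sum_congr rfl fun p _ => (mk_ofStr_eq_iff.1 p.2).choose_spec.card,
    Finset.sum_const, Finset.card_univ, Nat.card_eq_fintype_card, smul_eq_mul]

theorem exists_mk_ofStr [Finite X] {m : ℕ} {q : IsoClass X} (h : q.out.graph.Trivalent)
    (hm : q.out.graph.numVertices = m) :
    ∃ p : Str (rot (Fin m)) X, Quotient.mk _ (ofStr _ rot_degree p) = q := by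
  have h3 := card_str_mul_autCard h hm
  have h4 : Nat.card {p : Str (rot (Fin m)) X // Quotient.mk _ (ofStr _ rot_degree p) = q} ≠ 0 := by
    intro h
    rw [h, zero_mul] at h3
    exact absurd h3 (by positivity)
  obtain ⟨⟨p, hp⟩⟩ := (Nat.card_ne_zero.1 h4).1
  exact ⟨p, hp⟩

theorem finite_trivalent [Finite X] (m : ℕ) :
    {q : IsoClass X | q.out.graph.Trivalent ∧ q.out.graph.numVertices = m}.Finite :=
  (Set.finite_range fun p : Str (rot (Fin m)) X =>
    (Quotient.mk _ (ofStr _ rot_degree p) : IsoClass X)).subset fun _ hq =>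
      exists_mk_ofStr hq.1 hq.2

open Classical in
/-- Sums over isomorphism classes of trivalent graphs, weighted by automorphisms, are averages
over structures on triangles. -/
theorem finsum_isoClass [Finite X] (m : ℕ) (F : ColoredRibbonGraph X → ℂ)
    (hF : ∀ Γ Γ' : ColoredRibbonGraph X, Γ ≈ Γ' → F Γ = F Γ')
    (h0 : ∀ Γ, F Γ ≠ 0 → Γ.graph.Trivalent ∧ Γ.graph.numVertices = m) :
    ∑ᶠ q : IsoClass X, F q.out / q.out.autCard =
      (∑ p : Str (rot (Fin m)) X, F (ofStr _ rot_degree p)) / (m.factorial * 3 ^ m) := by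
  let cls : Str (rot (Fin m)) X → IsoClass X := fun p => Quotient.mk _ (ofStr _ rot_degree p)
  have hcls : ∀ p, F (ofStr _ rot_degree p) = F (cls p).out := fun p =>
    hF _ _ (Quotient.mk_eq_iff_out.1 rfl)
  rw [eq_div_iff (by exact_mod_cast (by positivity : m.factorial * 3 ^ m ≠ 0)),
    finsum_eq_sum_of_support_subset (s := Finset.univ.image cls),
    Finset.sum_mul, Finset.sum_congr rfl fun p _ => hcls p,
    ← Finset.sum_fiberwise_of_maps_to (s := Finset.univ) (t := Finset.univ.image cls) (g := cls)
      fun p _ => Finset.mem_image_of_mem _ (Finset.mem_univ _)]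
  · refine Finset.sum_congr rfl fun q _ => ?_
    rw [Finset.sum_congr rfl fun p hp => by rw [(Finset.mem_filter.1 hp).2], Finset.sum_const]
    by_cases hq : F q.out = 0
    · simp [hq]
    · obtain ⟨h1, h2⟩ := h0 _ hq
      have h3 := card_str_mul_autCard h1 h2
      rw [Nat.card_eq_fintype_card, Fintype.card_subtype] at h3
      have h4 := congrArg (Nat.cast (R := ℂ)) h3.symm
      have h5 : (q.out.autCard : ℂ) ≠ 0 := Nat.cast_ne_zero.2 (autCard_ne_zero _)
      push_cast at h4
      rw [h4, nsmul_eq_mul]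
      field_simp
      rfl
  · intro q hq
    obtain ⟨h1, h2⟩ := h0 q.out fun h => hq (by simp [h])
    obtain ⟨p, hp⟩ := exists_mk_ofStr h1 h2
    exact Finset.mem_coe.2 (Finset.mem_image.2 ⟨p, Finset.mem_univ _, hp⟩)

end ColoredRibbonGraph

/-! ## Weights of graphs in terms of structures -/

namespace RibbonGraph

variable {H : Type} (G : RibbonGraph H)

theorem edge_eq_iff {x y : H} : G.edge y = G.edge x ↔ y = x ∨ y = G.σ₁ x := by
  constructor
  · intro h
    obtain ⟨i, hi⟩ := (Quotient.exact h : Equiv.Perm.SameCycle _ _ _).symm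
    have h2 : G.σ₁ ^ (2 : ℤ) = 1 := by
      ext x
      rw [zpow_two, Equiv.Perm.mul_apply, G.σ₁_invol, Equiv.Perm.one_apply]
    rcases Int.even_or_odd' i with ⟨k, rfl | rfl⟩
    · rw [zpow_mul, h2, one_zpow] at hi
      exact Or.inl hi.symm
    · rw [zpow_add, zpow_mul, h2, one_zpow, zpow_one, one_mul] at hi
      exact Or.inr hi.symm
  · rintro (rfl | rfl)
    · rfl
    · exact Quotient.sound ⟨1, by rw [zpow_one, G.σ₁_invol]⟩

theorem filter_edge [Fintype H] [DecidableEq H] [DecidableEq G.Edge] (x : H) :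
    (Finset.univ.filter fun y => G.edge y = G.edge x) = {x, G.σ₁ x} := by
  ext y
  simp [G.edge_eq_iff]

theorem card_eq_two_mul_numEdges [Fintype H] : Fintype.card H = 2 * G.numEdges := by
  classical
  rw [← Finset.card_univ, Finset.card_eq_sum_card_fiberwise (f := G.edge) (t := Finset.univ)
    fun _ _ => Finset.mem_coe.2 (Finset.mem_univ _), numEdges, Nat.card_eq_fintype_card, mul_comm,
    ← Finset.card_univ, ← smul_eq_mul]
  refine Finset.sum_const_nat ?_ |>.trans (smul_eq_mul _ _).symm
  intro e _
  induction e using Quotient.inductionOn with | h x => ?_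
  exact (congrArg Finset.card (G.filter_edge x)).trans
    (Finset.card_pair (G.σ₁_ne x).symm)

theorem card_eq_three_mul_numVertices [Fintype H] (h : G.Trivalent) :
    Fintype.card H = 3 * G.numVertices := by
  classical
  obtain ⟨e, -⟩ := exists_conj_rot h fun x => (G.degree x).1
  rw [Fintype.card_congr e, Fintype.card_prod, Fintype.card_fin, ZMod.card, mul_comm]
  rfl

theorem connected_iff [Finite H] : G.Connected ↔ IsConn G.σ₀ G.σ₁ := by
  refine and_congr_right fun _ => ⟨fun h U h0 h1 hU => ?_, fun h x y => ?_⟩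
  · obtain ⟨x, hx⟩ := hU
    have hinv : ∀ τ ∈ Subgroup.closure {G.σ₀, G.σ₁}, ∀ y ∈ U, τ y ∈ U := by
      intro τ hτ
      induction hτ using Subgroup.closure_induction with
      | mem τ hτ =>
        rcases hτ with rfl | rfl
        · exact h0
        · exact h1
      | one => exact fun y hy => hy
      | mul τ τ' _ _ h h' => exact fun y hy => h _ (h' y hy)
      | inv τ _ h => exact fun y hy => Equiv.Perm.perm_symm_mapsTo_of_mapsTo τ h hy
    rw [Set.eq_univ_iff_forall]
    intro y
    obtain ⟨τ, hτ, rfl⟩ := h x y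
    exact hinv τ hτ x hx
  · have := h {y | ∃ τ ∈ Subgroup.closure {G.σ₀, G.σ₁}, τ x = y}
      (by
        rintro _ ⟨τ, hτ, rfl⟩
        exact ⟨G.σ₀ * τ, mul_mem (Subgroup.subset_closure (by simp)) hτ, rfl⟩)
      (by
        rintro _ ⟨τ, hτ, rfl⟩
        exact ⟨G.σ₁ * τ, mul_mem (Subgroup.subset_closure (by simp)) hτ, rfl⟩)
      ⟨x, 1, one_mem _, rfl⟩
    exact Set.eq_univ_iff_forall.1 this y

end RibbonGraph

namespace ColoredRibbonGraph

variable {X : Type}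

theorem numBoundaries_eq (Γ : ColoredRibbonGraph X) :
    Γ.graph.numBoundaries = numBdry Γ.graph.σ₀ Γ.graph.σ₁ Γ.colorOpt := by
  rw [numBdry]
  simp only [colorOpt_eq_none_iff]
  rfl

open Classical in
theorem edgeWeight_eq (Γ : ColoredRibbonGraph X) (lam : X → ℝ) (e : Γ.graph.Edge) :
    Γ.edgeWeight lam e = ∑ y, if Γ.graph.edge y = e then (Γ.colorOpt y).elim 0 lam else 0 := by
  rw [edgeWeight, ← Finset.sum_filter_add_sum_filter_not Finset.univ (· ∉ Γ.graph.B),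
    Finset.sum_eq_zero (s := Finset.univ.filter fun y => ¬ y ∉ Γ.graph.B), add_zero,
    Finset.sum_subtype (p := (· ∉ Γ.graph.B)) _ (by simp)]
  · refine Finset.sum_congr rfl fun y _ => ?_
    rw [colorOpt_of_notMem y.2]
    rfl
  · intro y hy
    rw [colorOpt_eq_none_iff.2 (not_not.1 (Finset.mem_filter.1 hy).2)]
    simp

theorem edgeWeight_edge (Γ : ColoredRibbonGraph X) (lam : X → ℝ) (x : Fin Γ.size) :
    Γ.edgeWeight lam (Γ.graph.edge x) =
      (Γ.colorOpt x).elim 0 lam + (Γ.colorOpt (Γ.graph.σ₁ x)).elim 0 lam := by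
  classical
  rw [edgeWeight_eq, ← Finset.sum_filter, RibbonGraph.filter_edge,
    Finset.sum_pair (Γ.graph.σ₁_ne x).symm]

theorem edgeWeight_pos (Γ : ColoredRibbonGraph X) {lam : X → ℝ} (hlam : ∀ i, 0 < lam i)
    (e : Γ.graph.Edge) : 0 < Γ.edgeWeight lam e := by
  induction e using Quotient.inductionOn with | h x => ?_
  refine lt_of_lt_of_eq ?_ (edgeWeight_edge Γ lam x).symm
  have h : ∀ p : Option X, 0 ≤ p.elim 0 lam := by
    rintro (_ | i)
    · exact le_rfl
    · exact (hlam i).le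
  have h' : ∀ p : Option X, p ≠ none → 0 < p.elim 0 lam := by
    rintro (_ | i) hp
    · exact absurd rfl hp
    · exact hlam i
  by_cases hx : Γ.colorOpt x = none
  · exact add_pos_of_nonneg_of_pos (h _) (h' _ (Γ.isStr.2.2.2 x hx))
  · exact add_pos_of_pos_of_nonneg (h' _ hx) (h _)

theorem strWeight_eq (Γ : ColoredRibbonGraph X) {lam : X → ℝ} (hlam : ∀ i, 0 < lam i) (Q : ℂ) :
    strWeight lam Q Γ.graph.σ₀ Γ.graph.σ₁ Γ.colorOpt = Q ^ Γ.graph.numBoundaries *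
      (2 ^ Γ.graph.numEdges * ∏ e, (Γ.edgeWeight lam e)⁻¹ : ℝ) := by
  classical
  rw [strWeight, numBoundaries_eq]
  congr 2
  rw [← Finset.prod_fiberwise_of_maps_to (s := Finset.univ) (t := Finset.univ) (g := Γ.graph.edge)
      fun _ _ => Finset.mem_univ _,
    RibbonGraph.numEdges, Nat.card_eq_fintype_card, ← Finset.card_univ, ← Finset.prod_const,
    ← Finset.prod_mul_distrib]
  refine Finset.prod_congr rfl fun e _ => ?_
  induction e using Quotient.inductionOn with | h x => ?_
  change ∏ y with Γ.graph.edge y = Γ.graph.edge x, _ = 2 * (Γ.edgeWeight lam (Γ.graph.edge x))⁻¹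
  rw [RibbonGraph.filter_edge, Finset.prod_pair (Γ.graph.σ₁_ne x).symm, Γ.graph.σ₁_invol,
    edgeFactor_comm lam (Γ.colorOpt (Γ.graph.σ₁ x)), edgeFactor_mul_self hlam, edgeWeight_edge,
    div_eq_mul_inv]

theorem weight_eq (Γ : ColoredRibbonGraph X) {lam : X → ℝ} (hlam : ∀ i, 0 < lam i) (Q : ℂ) :
    Q ^ Γ.graph.numBoundaries * (Γ.weight lam : ℂ) =
      strWeight lam Q Γ.graph.σ₀ Γ.graph.σ₁ Γ.colorOpt / 2 ^ Γ.graph.numVertices / Γ.autCard := by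
  rw [strWeight_eq Γ hlam, weight, zpow_sub₀ two_ne_zero, zpow_natCast, zpow_natCast]
  push_cast
  ring

section Transfer

variable {Γ Γ' : ColoredRibbonGraph X} {a : Fin Γ.size ≃ Fin Γ'.size}

theorem IsIso.strWeight_eq (h : IsIso Γ Γ' a) (lam : X → ℝ) (Q : ℂ) :
    strWeight lam Q Γ'.graph.σ₀ Γ'.graph.σ₁ Γ'.colorOpt =
      strWeight lam Q Γ.graph.σ₀ Γ.graph.σ₁ Γ.colorOpt :=
  strWeight_conj a h.1 lam Q h.2.1 (isIso_iff.1 h).2.2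

theorem IsIso.connected_iff (h : IsIso Γ Γ' a) : Γ'.graph.Connected ↔ Γ.graph.Connected := by
  rw [RibbonGraph.connected_iff, RibbonGraph.connected_iff]
  exact isConn_conj a h.1 h.2.1

theorem IsIso.trivalent_iff (h : IsIso Γ Γ' a) : Γ'.graph.Trivalent ↔ Γ.graph.Trivalent := by
  rw [RibbonGraph.Trivalent, ← a.forall_congr_right]
  simp only [← h.1, a.injective.eq_iff]
  rfl

theorem IsIso.numVertices_eq (h : IsIso Γ Γ' a) : Γ'.graph.numVertices = Γ.graph.numVertices :=
  (card_permCycle_conj a h.1).symm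

end Transfer

open Classical in
/-- Sums of contributions of trivalent graphs as sums over structures on triangles. -/
theorem finsum_weight [Finite X] (m : ℕ) {lam : X → ℝ} (hlam : ∀ i, 0 < lam i) (Q : ℂ)
    (P : ColoredRibbonGraph X → Prop) (hP : ∀ Γ Γ' a, IsIso Γ Γ' a → P Γ → P Γ')
    (h0 : ∀ Γ, P Γ → Γ.graph.Trivalent ∧ Γ.graph.numVertices = m) :
    ∑ᶠ (q : IsoClass X) (_ : P q.out), Q ^ q.out.graph.numBoundaries * (q.out.weight lam : ℂ) =
      (∑ p : Str (rot (Fin m)) X with P (ofStr _ rot_degree p),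
        strWeight lam Q (rot (Fin m)) p.1.1 p.1.2) / (m.factorial * 6 ^ m) := by
  have h := finsum_isoClass m (fun Γ : ColoredRibbonGraph X => if P Γ then
    strWeight lam Q Γ.graph.σ₀ Γ.graph.σ₁ Γ.colorOpt / 2 ^ Γ.graph.numVertices else 0) ?_ ?_
  · refine Eq.trans (finsum_congr fun q => ?_) (h.trans ?_)
    · rw [finsum_eq_if, weight_eq _ hlam]
      split_ifs <;> simp
    -- There are `m` vertices, so the factor `2^(-V)` of the weight turns `m! 3^m` into `m! 6^m`.
    · rw [← Finset.sum_filter, Finset.sum_congr rfl (g := fun p =>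
        strWeight lam Q (rot (Fin m)) p.1.1 p.1.2 / 2 ^ m), ← Finset.sum_div, div_div,
        mul_left_comm, ← mul_pow]
      · norm_num
      · intro p hp
        obtain ⟨hs, ht, hc⟩ := isoFrom_ofStr _ rot_degree p
        rw [← strWeight_conj _ hs lam Q ht hc, (h0 _ (Finset.mem_filter.1 hp).2).2]
  · rintro Γ Γ' ⟨a, ha⟩
    obtain ⟨b, hb⟩ := (isoSetoid X).symm ⟨a, ha⟩
    have hi : P Γ ↔ P Γ' := ⟨hP _ _ _ ha, hP _ _ _ hb⟩
    simp only [hi, ha.strWeight_eq, ha.numVertices_eq]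
  · intro Γ h
    exact h0 Γ (by by_contra h'; exact h (if_neg h'))

section OfStr

variable {m : ℕ} (p : Str (rot (Fin m)) X)

theorem trivalent_ofStr : (ofStr _ rot_degree p).graph.Trivalent := by
  have h := (isoFrom_ofStr _ rot_degree p).1
  rw [RibbonGraph.Trivalent, ← (ofStrEquiv _ rot_degree p).forall_congr_right]
  intro x
  rw [← h, ← h, ← h, rot_rot_rot]

theorem numVertices_ofStr : (ofStr _ rot_degree p).graph.numVertices = m := by
  rw [RibbonGraph.numVertices, ← card_permCycle_conj _ (isoFrom_ofStr _ rot_degree p).1,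
    card_permCycle_rot, Nat.card_fin]

theorem connected_ofStr_iff :
    (ofStr _ rot_degree p).graph.Connected ↔ IsConn (rot (Fin m)) p.1.1 := by
  have h := isoFrom_ofStr _ rot_degree p
  rw [RibbonGraph.connected_iff]
  exact isConn_conj _ h.1 h.2.1

end OfStr

end ColoredRibbonGraph

theorem coeff_freeEnergy_eq_finsum {N : ℕ} {lam : Fin N → ℝ} (hlam : ∀ i, 0 < lam i) (Q : ℂ)
    (m : ℕ) : PowerSeries.coeff m (freeEnergy lam Q) =
      ∑ᶠ (q : ColoredRibbonGraph.IsoClass (Fin N))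
        (_ : q.out.graph.Connected ∧ q.out.graph.Trivalent ∧ q.out.graph.numVertices = m),
        Q ^ q.out.graph.numBoundaries * (q.out.weight lam : ℂ) := by
  classical
  rw [coeff_freeEnergy hlam, ColoredRibbonGraph.finsum_weight m hlam Q fun Γ =>
    Γ.graph.Connected ∧ Γ.graph.Trivalent ∧ Γ.graph.numVertices = m]
  · simp only [ColoredRibbonGraph.connected_ofStr_iff, ColoredRibbonGraph.trivalent_ofStr,
      ColoredRibbonGraph.numVertices_ofStr, and_true]
    rfl
  · intro Γ Γ' a ha
    rw [ha.connected_iff, ha.trivalent_iff, ha.numVertices_eq]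
    exact id
  · exact fun _ h => h.2

/-! ## Positions along the cycles -/

namespace RibbonGraph

open Classical Matrix

variable {H : Type} [Fintype H] (G : RibbonGraph H)

omit [Fintype H] in
theorem cycle_σ₂ (x : H) : G.cycle (G.σ₂ x) = G.cycle x :=
  Quotient.sound ⟨-1, by rw [_root_.zpow_neg_one, Equiv.Perm.inv_eq_iff_eq]⟩

omit [Fintype H] in
theorem cycle_out (q : G.Cycle) : G.cycle q.out = q := Quotient.out_eq q

omit [Fintype H] in
theorem cycle_pow (q : G.Cycle) (i : ℕ) : G.cycle ((G.σ₂ ^ i) q.out) = q := by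
  induction i with
  | zero => exact G.cycle_out q
  | succ i ih => rw [pow_succ', Equiv.Perm.mul_apply, cycle_σ₂, ih]

theorem exists_pow_lt (x : H) :
    ∃ i < Function.minimalPeriod G.σ₂ (G.cycle x).out, (G.σ₂ ^ i) (G.cycle x).out = x := by
  have h : Equiv.Perm.SameCycle G.σ₂ (G.cycle x).out x := Quotient.exact (G.cycle_out (G.cycle x))
  obtain ⟨i, hi⟩ := h.exists_nat_pow_eq
  refine ⟨i % Function.minimalPeriod G.σ₂ (G.cycle x).out, Nat.mod_lt _ ?_, ?_⟩
  · exact Function.minimalPeriod_pos_of_mem_periodicPts (G.σ₂.injective.mem_periodicPts _)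
  · rw [← Equiv.Perm.iterate_eq_pow, Function.iterate_mod_minimalPeriod_eq,
      Equiv.Perm.iterate_eq_pow, hi]

/-- The position of a half-edge in its cycle. -/
noncomputable def pos (x : H) : ℕ := (G.exists_pow_lt x).choose

theorem pos_lt_minimalPeriod (x : H) :
    G.pos x < Function.minimalPeriod G.σ₂ (G.cycle x).out :=
  (G.exists_pow_lt x).choose_spec.1

theorem pow_pos (x : H) : (G.σ₂ ^ G.pos x) (G.cycle x).out = x :=
  (G.exists_pow_lt x).choose_spec.2

omit [Fintype H] in
theorem pow_injOn {q : G.Cycle} {i j : ℕ} (hi : i < Function.minimalPeriod G.σ₂ q.out)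
    (hj : j < Function.minimalPeriod G.σ₂ q.out)
    (h : (G.σ₂ ^ i) q.out = (G.σ₂ ^ j) q.out) : i = j := by
  rw [← Equiv.Perm.iterate_eq_pow, ← Equiv.Perm.iterate_eq_pow] at h
  exact Function.iterate_injOn_Iio_minimalPeriod hi hj h

theorem pos_pow {q : G.Cycle} {i : ℕ} (hi : i < Function.minimalPeriod G.σ₂ q.out) :
    G.pos ((G.σ₂ ^ i) q.out) = i := by
  have h1 := G.pos_lt_minimalPeriod ((G.σ₂ ^ i) q.out)
  have h2 := G.pow_pos ((G.σ₂ ^ i) q.out)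
  rw [G.cycle_pow] at h1 h2
  exact G.pow_injOn h1 hi h2

theorem eq_of_pos_eq {x y : H} (h : G.cycle x = G.cycle y) (hp : G.pos x = G.pos y) : x = y := by
  rw [← G.pow_pos x, ← G.pow_pos y, h, hp]

theorem cycleLength_eq (q : G.Cycle) :
    G.cycleLength q = Function.minimalPeriod G.σ₂ q.out := by
  rw [cycleLength, ← Nat.card_fin (Function.minimalPeriod G.σ₂ q.out)]
  symm
  refine Nat.card_eq_of_bijective (fun i => ⟨(G.σ₂ ^ (i : ℕ)) q.out, G.cycle_pow q i⟩)
    ⟨fun i j h => Fin.ext (G.pow_injOn i.2 j.2 (congrArg Subtype.val h)), ?_⟩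
  rintro ⟨x, rfl⟩
  obtain ⟨i, hi, h⟩ := G.exists_pow_lt x
  exact ⟨⟨i, hi⟩, Subtype.ext h⟩

theorem pos_lt (x : H) : G.pos x < G.cycleLength (G.cycle x) := by
  rw [cycleLength_eq]
  exact G.pos_lt_minimalPeriod x

theorem pos_σ₂ (x : H) : G.pos (G.σ₂ x) = G.pos x + 1 ∨
    G.pos (G.σ₂ x) = 0 ∧ G.pos x + 1 = G.cycleLength (G.cycle x) := by
  have hx : G.σ₂ x = (G.σ₂ ^ (G.pos x + 1)) (G.cycle x).out := by
    rw [pow_succ', Equiv.Perm.mul_apply, G.pow_pos]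
  rcases (Nat.succ_le_of_lt (G.pos_lt x)).lt_or_eq with h | h
  · left
    rw [hx, G.pos_pow (by rwa [← G.cycleLength_eq])]
  · right
    refine ⟨?_, h⟩
    rw [hx, ← Nat.succ_eq_add_one, h, cycleLength_eq, ← Equiv.Perm.iterate_eq_pow,
      Function.iterate_minimalPeriod]
    exact G.pos_pow (i := 0) (Function.minimalPeriod_pos_of_mem_periodicPts
      (G.σ₂.injective.mem_periodicPts _))

theorem pos_out (q : G.Cycle) : G.pos q.out = 0 :=
  G.pos_pow (i := 0) (Function.minimalPeriod_pos_of_mem_periodicPts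
    (G.σ₂.injective.mem_periodicPts _))

theorem sum_cycle (q : G.Cycle) (f : H → ℝ) :
    ∑ x with G.cycle x = q, f x = ∑ i ∈ Finset.range (G.cycleLength q), f ((G.σ₂ ^ i) q.out) := by
  symm
  refine Finset.sum_nbij' (fun i => (G.σ₂ ^ i) q.out) G.pos ?_ ?_ ?_ ?_ ?_
  · intro i _
    simp [G.cycle_pow]
  · intro x hx
    obtain rfl := (Finset.mem_filter.1 hx).2
    exact Finset.mem_range.2 (G.pos_lt x)
  · intro i hi
    exact G.pos_pow (by rw [← G.cycleLength_eq]; exact Finset.mem_range.1 hi)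
  · intro x hx
    obtain rfl := (Finset.mem_filter.1 hx).2
    exact G.pow_pos x
  · intro i _
    rfl

/-! ## The matrices of the Kontsevich form and of the perimeter map -/

/-- Incidence of half-edges and edges. -/
noncomputable def edgeMat : Matrix H G.Edge ℝ := of fun x e => if G.edge x = e then 1 else 0

/-- Incidence of cycles and half-edges. -/
noncomputable def cycleMat : Matrix G.Cycle H ℝ := of fun q x => if G.cycle x = q then 1 else 0

/-- The order of half-edges along the cycles. -/
noncomputable def orderMat : Matrix H H ℝ :=
  of fun x y => if G.cycle x = G.cycle y ∧ G.pos x ≤ G.pos y then 1 else 0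

/-- The inverse of `orderMat`. -/
noncomputable def cutMat : Matrix H H ℝ :=
  of fun x y => (if x = y then 1 else 0) - if y = G.σ₂ x ∧ G.pos y ≠ 0 then 1 else 0

/-- The matrix of the Kontsevich form. -/
noncomputable def kontsevichMat : Matrix G.Edge G.Edge ℝ :=
  (1 / 2 : ℝ) • (G.edgeMatᵀ * (G.orderMat - G.orderMatᵀ) * G.edgeMat)

/-- The matrix of the perimeter map. -/
noncomputable def perimeterMat : Matrix G.Cycle G.Edge ℝ := G.cycleMat * G.edgeMat

theorem perimeter_apply (ℓ : G.Edge → ℝ) : G.perimeter ℓ = G.perimeterMat *ᵥ ℓ := by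
  rw [perimeterMat, ← mulVec_mulVec]
  have h : G.edgeMat *ᵥ ℓ = fun x => ℓ (G.edge x) := by
    funext x
    simp [edgeMat, mulVec, dotProduct]
  funext q
  rw [h]
  simp [perimeter, cycleMat, mulVec, dotProduct]

/-- Positions `i < j` along a cycle are replaced by pairs of half-edges. `orderMat` also contains
the diagonal, which cancels in the antisymmetrization. -/
theorem kontsevichForm_apply (u v : G.Edge → ℝ) :
    G.kontsevichForm u v = u ⬝ᵥ (G.kontsevichMat *ᵥ v) := by
  have hv : ∀ v, G.edgeMat *ᵥ v = fun x => v (G.edge x) := by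
    intro v
    funext x
    simp [edgeMat, mulVec, dotProduct]
  have key : ∀ f : H → H → ℝ,
      ∑ q : G.Cycle, ∑ j ∈ Finset.range (G.cycleLength q), ∑ i ∈ Finset.range j,
        f ((G.σ₂ ^ i) q.out) ((G.σ₂ ^ j) q.out) =
      ∑ x, ∑ y, (if G.cycle x = G.cycle y ∧ G.pos x < G.pos y then f x y else 0) := by
    intro f
    rw [Finset.sum_comm, ← Finset.sum_fiberwise_of_maps_to (s := Finset.univ)
      (t := Finset.univ) (g := G.cycle) fun _ _ => Finset.mem_univ _]
    refine Finset.sum_congr rfl fun q _ => ?_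
    rw [G.sum_cycle]
    refine Finset.sum_congr rfl fun j hj => ?_
    have hj' := Finset.mem_range.1 hj
    rw [G.cycle_pow, G.pos_pow (by rwa [← G.cycleLength_eq])]
    simp only [ite_and]
    rw [← Finset.sum_filter, G.sum_cycle, ← Finset.sum_subset
      (Finset.range_mono hj'.le)]
    · refine Finset.sum_congr rfl fun i hi => ?_
      have hi' := Finset.mem_range.1 hi
      rw [G.pos_pow (by rw [← G.cycleLength_eq]; omega), if_pos hi']
    · intro i hi hi'
      rw [G.pos_pow (by rw [← G.cycleLength_eq]; exact Finset.mem_range.1 hi),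
        if_neg (by simpa using hi')]
  have h1 : u ⬝ᵥ (G.kontsevichMat *ᵥ v) = (1 / 2) * ((fun x => u (G.edge x)) ⬝ᵥ
      ((G.orderMat - G.orderMatᵀ) *ᵥ fun x => v (G.edge x))) := by
    rw [kontsevichMat, smul_mulVec, dotProduct_smul, ← mulVec_mulVec, ← mulVec_mulVec, hv,
      dotProduct_mulVec, vecMul_transpose, hv, smul_eq_mul]
  rw [h1, kontsevichForm]
  congr 1
  simp only [cycleEdge]
  rw [key fun x y => u (G.edge x) * v (G.edge y) - u (G.edge y) * v (G.edge x)]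
  have h2 : ∀ x y, (if G.cycle x = G.cycle y ∧ G.pos x < G.pos y then
      u (G.edge x) * v (G.edge y) - u (G.edge y) * v (G.edge x) else 0) =
      u (G.edge x) * (G.orderMat x y * v (G.edge y)) -
        u (G.edge y) * (G.orderMat x y * v (G.edge x)) := by
    intro x y
    rw [orderMat, of_apply]
    by_cases hc : G.cycle x = G.cycle y
    · rcases lt_trichotomy (G.pos x) (G.pos y) with h | h | h
      · simp [hc, h, h.le]
      · obtain rfl := G.eq_of_pos_eq hc h
        simp
      · simp [hc, h.not_gt, h.not_ge]
    · simp [hc]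
  simp only [h2, Finset.sum_sub_distrib]
  rw [Finset.sum_comm (f := fun x y => u (G.edge y) * _), sub_mulVec, dotProduct_sub]
  simp only [dotProduct, mulVec, Finset.mul_sum, transpose_apply]

/-- Cut at its base point, each cycle is a chain; the matrix of partial sums along a chain is
inverted by the identity minus the shift. -/
theorem cutMat_mul_orderMat : G.cutMat * G.orderMat = 1 := by
  ext x y
  have h : (G.cutMat * G.orderMat) x y = G.orderMat x y -
      if G.pos (G.σ₂ x) ≠ 0 then G.orderMat (G.σ₂ x) y else 0 := by
    rw [mul_apply]
    simp only [cutMat, of_apply, sub_mul, Finset.sum_sub_distrib, ite_mul, one_mul, zero_mul,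
      ite_and]
    simp
  rw [h, orderMat, of_apply, of_apply, G.cycle_σ₂, one_apply]
  by_cases hc : G.cycle x = G.cycle y
  · have hxy : x = y ↔ G.pos x = G.pos y := ⟨fun h => h ▸ rfl, G.eq_of_pos_eq hc⟩
    have hlt := G.pos_lt y
    rw [← hc] at hlt
    simp only [hc, true_and, hxy]
    rcases G.pos_σ₂ x with h | ⟨h, h'⟩
    · rw [h]
      split_ifs <;> first | omega | simp
    · rw [h]
      split_ifs <;> first | omega | simp
  · have hxy : x ≠ y := fun h => hc (h ▸ rfl)
    simp [hc, hxy]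

end RibbonGraph

/-! ## The determinant of the Kontsevich form -/

namespace RibbonGraph

open Classical Matrix

section PermMatrices

variable {H : Type} [Fintype H]

/-- The matrix of a permutation. -/
noncomputable def permMat (σ : Equiv.Perm H) : Matrix H H ℝ := of fun x y => if y = σ x then 1 else 0

theorem permMat_mul (σ τ : Equiv.Perm H) : permMat σ * permMat τ = permMat (τ * σ) := by
  ext x y
  simp only [permMat, mul_apply, of_apply, ite_mul, one_mul, zero_mul, Finset.sum_ite_eq',
    Finset.mem_univ, if_true, Equiv.Perm.mul_apply]
  congr

theorem abs_det_permMat (σ : Equiv.Perm H) : |(permMat σ).det| = 1 := by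
  have h : permMat σ = (1 : Matrix H H ℝ).submatrix σ (Equiv.refl H) := by
    ext x y
    simp [permMat, one_apply, eq_comm]
  rw [h, abs_det_submatrix_equiv_equiv, det_one, abs_one]

/-- The matrix is block diagonal with one block per triangle, and `1` plus a cyclic shift of three
points has determinant 2. -/
theorem det_one_add_permMat_rot (V : Type) [Fintype V] [DecidableEq V] :
    (1 + permMat (rot V)).det = 2 ^ Fintype.card V := by
  let A : Matrix (ZMod 3) (ZMod 3) ℤ := of fun i j => (if i = j then 1 else 0) +
    if j = i + 1 then 1 else 0
  have hA : A.det = 2 := by decide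
  have h : 1 + permMat (rot V) =
      (blockDiagonal fun _ : V => A.map (Int.castRingHom ℝ)).submatrix (Equiv.prodComm _ _)
        (Equiv.prodComm _ _) := by
    ext ⟨v, i⟩ ⟨w, j⟩
    by_cases hvw : v = w
    · subst hvw
      simp [permMat, one_apply, blockDiagonal_apply, A]
    · simp [permMat, one_apply, blockDiagonal_apply, A, hvw, Ne.symm hvw]
  rw [h, det_submatrix_equiv_self, det_blockDiagonal, Finset.prod_const, Finset.card_univ]
  congr 1
  have h2 := RingHom.map_det (Int.castRingHom ℝ) A
  rw [RingHom.mapMatrix_apply] at h2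
  rw [← h2, hA]
  simp

end PermMatrices

variable {H : Type} [Fintype H] (G : RibbonGraph H)

theorem det_one_add_permMat_σ₀ (h : G.Trivalent) :
    (1 + permMat G.σ₀).det = 2 ^ G.numVertices := by
  obtain ⟨e, he⟩ := exists_conj_rot h fun x => (G.degree x).1
  have h2 : 1 + permMat G.σ₀ = (1 + permMat (rot _)).submatrix e e := by
    ext x y
    simp [permMat, one_apply, ← he]
  rw [h2, det_submatrix_equiv_self, det_one_add_permMat_rot, Fintype.card_fin]
  rfl

/-- As `permMat` reverses products and `σ₂ = σ₀⁻¹ σ₁`, the sum factors as `P_σ₁ (1 + P_σ₀ᵀ)`; the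
first factor has determinant `±1`. -/
theorem abs_det_permMat_add (h : G.Trivalent) :
    |(permMat G.σ₁ + permMat G.σ₂).det| = 2 ^ G.numVertices := by
  have h1 : permMat G.σ₁ + permMat G.σ₂ = permMat G.σ₁ * (1 + permMat G.σ₀)ᵀ := by
    rw [transpose_add, transpose_one, Matrix.mul_add, Matrix.mul_one]
    congr 1
    have : (permMat G.σ₀)ᵀ = permMat G.σ₀⁻¹ := by
      ext x y
      simp only [permMat, transpose_apply, of_apply, Equiv.Perm.eq_inv_iff_eq]
      simp only [eq_comm]
    rw [this, permMat_mul, σ₂]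
  rw [h1, det_mul, abs_mul, abs_det_permMat, one_mul, det_transpose, G.det_one_add_permMat_σ₀ h,
    abs_of_nonneg (by positivity)]

theorem orderMat_add_transpose :
    G.orderMat + G.orderMatᵀ = G.cycleMatᵀ * G.cycleMat + 1 := by
  ext x y
  have h : (G.cycleMatᵀ * G.cycleMat) x y = if G.cycle x = G.cycle y then 1 else 0 := by
    simp [cycleMat, mul_apply]
  rw [Matrix.add_apply, Matrix.add_apply, h, transpose_apply, orderMat, of_apply, of_apply, one_apply]
  by_cases hc : G.cycle x = G.cycle y
  · have hxy : x = y ↔ G.pos x = G.pos y := ⟨fun h => h ▸ rfl, G.eq_of_pos_eq hc⟩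
    simp only [hc, true_and, hxy, if_true]
    split_ifs <;> first | omega | norm_num
  · have hxy : x ≠ y := fun h => hc (h ▸ rfl)
    simp [hc, hxy, Ne.symm hc]

theorem transpose_edgeMat_mul : G.edgeMatᵀ * G.edgeMat = (2 : ℝ) • 1 := by
  ext e e'
  rw [mul_apply, Matrix.smul_apply, one_apply]
  simp only [edgeMat, transpose_apply, of_apply, mul_ite, mul_one, mul_zero]
  rw [← Finset.sum_filter]
  by_cases h : e = e'
  · subst h
    rw [Finset.sum_congr rfl fun y hy => if_pos (Finset.mem_filter.1 hy).2, Finset.sum_const]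
    induction e using Quotient.inductionOn with | h x => ?_
    rw [show (Finset.univ.filter fun y => G.edge y = ⟦x⟧) = {x, G.σ₁ x} from
      G.filter_edge x, Finset.card_pair (G.σ₁_ne x).symm]
    simp
  · rw [if_neg h, smul_zero]
    exact Finset.sum_eq_zero fun x hx =>
      if_neg fun h' => h (h'.symm.trans (Finset.mem_filter.1 hx).2)

theorem edgeMat_mul_transpose : G.edgeMat * G.edgeMatᵀ = 1 + permMat G.σ₁ := by
  ext x y
  have h : (G.edgeMat * G.edgeMatᵀ) x y = if G.edge y = G.edge x then 1 else 0 := by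
    simp [edgeMat, mul_apply, eq_comm]
  rw [h, Matrix.add_apply, one_apply, permMat, of_apply]
  have := (G.σ₁_ne x)
  by_cases h1 : x = y
  · subst h1
    simp [this.symm]
  · have h1' : ¬ y = x := fun h => h1 h.symm
    simp [h1, h1', G.edge_eq_iff]

theorem cutMat_mul_transpose_apply (x : H) (q : G.Cycle) :
    (G.cutMat * G.cycleMatᵀ) x q = if G.cycle x = q ∧ G.pos (G.σ₂ x) = 0 then 1 else 0 := by
  rw [mul_apply]
  simp only [cutMat, cycleMat, of_apply, transpose_apply, sub_mul, Finset.sum_sub_distrib, ite_mul,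
    one_mul, zero_mul, ite_and]
  simp only [Finset.sum_ite_eq, Finset.sum_ite_eq', Finset.mem_univ, if_true, G.cycle_σ₂]
  split_ifs <;> simp_all

theorem cycleMat_mul_cutMat_apply (q : G.Cycle) (y : H) :
    (G.cycleMat * G.cutMat) q y = if G.cycle y = q ∧ G.pos y = 0 then 1 else 0 := by
  rw [mul_apply]
  simp only [cutMat, cycleMat, of_apply, mul_sub, Finset.sum_sub_distrib, mul_ite,
    mul_one, mul_zero, ite_and]
  have h : ∀ x, y = G.σ₂ x ↔ G.σ₂.symm y = x := fun x => (Equiv.symm_apply_eq _).symm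
  have h2 : G.cycle (G.σ₂.symm y) = G.cycle y := by
    rw [← G.cycle_σ₂, Equiv.apply_symm_apply]
  simp only [h, Finset.sum_ite_eq, Finset.sum_ite_eq', Finset.mem_univ, if_true, h2]
  split_ifs <;> simp_all

theorem cycleMat_mul_cutMat_mul : G.cycleMat * (G.cutMat * G.cycleMatᵀ) = 1 := by
  ext q q'
  rw [mul_apply]
  simp only [cutMat_mul_transpose_apply]
  have h : ∀ x, (G.cycle x = q' ∧ G.pos (G.σ₂ x) = 0) ↔ G.σ₂.symm q'.out = x := by
    intro x
    rw [Equiv.symm_apply_eq]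
    constructor
    · rintro ⟨rfl, h⟩
      exact G.eq_of_pos_eq (by rw [G.cycle_out, G.cycle_σ₂]) (by rw [h, G.pos_out])
    · intro h
      rw [← h, G.pos_out, ← G.cycle_σ₂, ← h, G.cycle_out]
      exact ⟨rfl, rfl⟩
  have h2 : G.cycle (G.σ₂.symm q'.out) = q' := by
    rw [← G.cycle_σ₂, Equiv.apply_symm_apply, G.cycle_out]
  simp only [h, mul_ite, mul_one, mul_zero, Finset.sum_ite_eq, Finset.mem_univ, if_true]
  simp only [cycleMat, of_apply, h2, one_apply, eq_comm]

/-- The identity inside `edgeMat * edgeMatᵀ = 1 + P_σ₁` cancels that of `cutMat`. The remaining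
shift misses the step across the cut of each cycle, and the product through the cycles restores
exactly these entries, completing `P_σ₂`. -/
theorem cutMat_sub :
    G.cutMat - G.edgeMat * G.edgeMatᵀ - G.cutMat * G.cycleMatᵀ * (G.cycleMat * G.cutMat) =
      -(permMat G.σ₁ + permMat G.σ₂) := by
  ext x y
  have h : (G.cutMat * G.cycleMatᵀ * (G.cycleMat * G.cutMat)) x y =
      if y = G.σ₂ x ∧ G.pos y = 0 then 1 else 0 := by
    rw [mul_apply]
    simp only [cutMat_mul_transpose_apply, cycleMat_mul_cutMat_apply]
    have h1 : (y = G.σ₂ x ∧ G.pos y = 0) ↔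
        (G.cycle x = G.cycle y ∧ G.pos (G.σ₂ x) = 0) ∧ G.pos y = 0 := by
      constructor
      · rintro ⟨rfl, h⟩
        exact ⟨⟨(G.cycle_σ₂ x).symm, h⟩, h⟩
      · rintro ⟨⟨h1, h2⟩, h3⟩
        exact ⟨G.eq_of_pos_eq (by rw [G.cycle_σ₂, h1]) (by rw [h2, h3]), h3⟩
    simp only [h1, ite_and, mul_ite, mul_one, mul_zero]
    simp only [Finset.sum_ite_eq, Finset.mem_univ, if_true]
    split_ifs <;> simp
  rw [Matrix.sub_apply, Matrix.sub_apply, h, G.edgeMat_mul_transpose, Matrix.neg_apply,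
    Matrix.add_apply, Matrix.add_apply, one_apply,
    permMat, of_apply, permMat, of_apply, cutMat, of_apply]
  by_cases h1 : y = G.σ₂ x
  · simp only [h1, true_and]
    split_ifs <;> first | tauto | ring
  · simp [h1]

/-- Both `cutMat` and its inverse `orderMat` have integer entries, so the determinant is a unit of
`ℤ`. -/
theorem abs_det_cutMat : |G.cutMat.det| = 1 := by
  let L : Matrix H H ℤ :=
    of fun x y => (if x = y then 1 else 0) - if y = G.σ₂ x ∧ G.pos y ≠ 0 then 1 else 0
  let U : Matrix H H ℤ := of fun x y => if G.cycle x = G.cycle y ∧ G.pos x ≤ G.pos y then 1 else 0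
  have hL : L.map (Int.castRingHom ℝ) = G.cutMat := by
    ext x y
    simp only [L, cutMat, of_apply, map_apply]
    split_ifs <;> simp
  have hU : U.map (Int.castRingHom ℝ) = G.orderMat := by
    ext x y
    simp [U, orderMat]
  have h1 : L.det * U.det = 1 := by
    have h := congrArg det G.cutMat_mul_orderMat
    rw [det_mul, det_one, ← hL, ← hU] at h
    have h2 : ∀ A : Matrix H H ℤ, (A.map (Int.castRingHom ℝ)).det = (A.det : ℝ) := fun A =>
      (RingHom.map_det (Int.castRingHom ℝ) A).symm
    rw [h2, h2] at h
    exact_mod_cast h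
  have h2 := Int.isUnit_iff_abs_eq.1 (IsUnit.of_mul_eq_one _ h1)
  have h3 : (L.map (Int.castRingHom ℝ)).det = (L.det : ℝ) :=
    (RingHom.map_det (Int.castRingHom ℝ) L).symm
  rw [← hL, h3]
  exact_mod_cast h2

/-- The bordered Kontsevich matrix. -/
theorem abs_det_bordered (h : G.Trivalent) :
    |(fromBlocks (-(G.kontsevichMat + (1 / 2 : ℝ) • (G.perimeterMatᵀ * G.perimeterMat)))
      (-G.perimeterMatᵀ) (-G.perimeterMat) 0).det| = 2 ^ G.numVertices := by
  have hLU := G.cutMat_mul_orderMat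
  have hUL : G.orderMat * G.cutMat = 1 := mul_eq_one_comm.1 hLU
  -- By `cutMat_sub`, `-(P_σ₁ + P_σ₂) = L (1 - U Y Z)` with `L = cutMat` of determinant `±1` and `U
  -- = L⁻¹ = orderMat`. The bordered matrix is `1 - Z (U Y)`, which has the same determinant as `1 -
  -- (U Y) Z`.
  let Y : Matrix H (G.Edge ⊕ G.Cycle) ℝ := fromCols G.edgeMat (G.cutMat * G.cycleMatᵀ)
  let Z : Matrix (G.Edge ⊕ G.Cycle) H ℝ := fromRows G.edgeMatᵀ (G.cycleMat * G.cutMat)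
  have h1 : -(permMat G.σ₁ + permMat G.σ₂) = G.cutMat * (1 - G.orderMat * Y * Z) := by
    rw [mul_sub, mul_one, ← Matrix.mul_assoc, ← Matrix.mul_assoc, hLU, Matrix.one_mul,
      fromCols_mul_fromRows, ← G.cutMat_sub, sub_sub]
  have h2 : 1 - Z * (G.orderMat * Y) = fromBlocks (-(G.kontsevichMat + (1 / 2 : ℝ) •
      (G.perimeterMatᵀ * G.perimeterMat))) (-G.perimeterMatᵀ) (-G.perimeterMat) 0 := by
    have e1 : G.orderMat * Y = fromCols (G.orderMat * G.edgeMat) G.cycleMatᵀ := by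
      rw [mul_fromCols, ← Matrix.mul_assoc, hUL, Matrix.one_mul]
    rw [e1, fromRows_mul_fromCols, ← fromBlocks_one, sub_eq_add_neg, fromBlocks_neg,
      fromBlocks_add]
    simp only [← sub_eq_add_neg]
    congr 1
    -- The antisymmetric part of `orderMat` yields the Kontsevich matrix; the symmetric part yields
    -- the perimeter term and, because every edge has two half-edges, an identity that cancels the
    -- one in `1 - Z (U Y)`.
    · have h3 : G.orderMat = (1 / 2 : ℝ) • (G.orderMat - G.orderMatᵀ) +
          (1 / 2 : ℝ) • (G.cycleMatᵀ * G.cycleMat + 1) := by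
        rw [← G.orderMat_add_transpose, ← smul_add]
        ext x y
        simp
        ring
      have h4 : G.edgeMatᵀ * (G.orderMat * G.edgeMat) = G.kontsevichMat +
          (1 / 2 : ℝ) • (G.perimeterMatᵀ * G.perimeterMat) + 1 := by
        conv_lhs => rw [h3]
        rw [kontsevichMat, perimeterMat, transpose_mul, Matrix.add_mul, Matrix.mul_add, Matrix.smul_mul,
          Matrix.smul_mul, Matrix.mul_smul, Matrix.mul_smul, Matrix.add_mul, Matrix.mul_add, Matrix.one_mul,
          G.transpose_edgeMat_mul, smul_add, smul_smul]
        simp only [Matrix.mul_assoc]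
        norm_num [add_assoc]
      rw [h4]
      abel
    · rw [zero_sub, perimeterMat, transpose_mul]
    · rw [zero_sub, Matrix.mul_assoc, ← Matrix.mul_assoc G.cutMat, hLU, Matrix.one_mul,
        perimeterMat]
    · rw [Matrix.mul_assoc, G.cycleMat_mul_cutMat_mul, sub_self]
  have h3 := G.abs_det_permMat_add h
  rw [← h2, ← h3, ← det_one_sub_mul_comm, ← one_mul |_|, ← G.abs_det_cutMat, ← abs_mul, ← det_mul,
    ← h1, det_neg, abs_mul, abs_pow, abs_neg, abs_one, one_pow, one_mul]

end RibbonGraph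

/-! ## The volume of the level sets of the perimeter map -/

namespace RibbonGraph

open Classical Matrix

variable {H : Type} [Fintype H] (G : RibbonGraph H)

/-- A basis of the kernel of the perimeter map, as columns of a matrix. -/
noncomputable def kerMat : Matrix G.Edge (Fin (Module.finrank ℝ (LinearMap.ker G.perimeter))) ℝ :=
  of fun e i => (Module.finBasis ℝ (LinearMap.ker G.perimeter) i : G.Edge → ℝ) e

theorem kerMat_mulVec (a : Fin (Module.finrank ℝ (LinearMap.ker G.perimeter)) → ℝ) :
    G.kerMat *ᵥ a =
      ∑ i, a i • (Module.finBasis ℝ (LinearMap.ker G.perimeter) i : G.Edge → ℝ) := by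
  funext e
  simp [kerMat, mulVec, dotProduct, mul_comm]

theorem perimeterMat_mul_kerMat : G.perimeterMat * G.kerMat = 0 := by
  ext q i
  have h := (Module.finBasis ℝ (LinearMap.ker G.perimeter) i).2
  rw [LinearMap.mem_ker, perimeter_apply] at h
  exact congrFun h q

/-- The bordered matrix is invertible, and its last block row is `(-perimeterMat, 0)`; a block of
the inverse is therefore, up to sign, a right inverse of `perimeterMat`. In particular the perimeter
map is onto. -/
theorem exists_section (h : G.Trivalent) :
    ∃ S : Matrix G.Edge G.Cycle ℝ, G.perimeterMat * S = 1 := by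
  have hd := G.abs_det_bordered h
  set B := fromBlocks (-(G.kontsevichMat + (1 / 2 : ℝ) • (G.perimeterMatᵀ * G.perimeterMat)))
      (-G.perimeterMatᵀ) (-G.perimeterMat) 0
  have hB : IsUnit B.det := isUnit_iff_ne_zero.2 fun h0 => by
    rw [h0, abs_zero] at hd
    exact absurd hd (by positivity)
  have h1 := mul_nonsing_inv B hB
  rw [← fromBlocks_toBlocks B⁻¹, fromBlocks_multiply, ← fromBlocks_one, fromBlocks_inj] at h1
  refine ⟨-(B⁻¹).toBlocks₁₂, ?_⟩
  have := h1.2.2.2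
  rwa [Matrix.zero_mul, add_zero, Matrix.neg_mul, ← Matrix.mul_neg] at this

variable {G} {S : Matrix G.Edge G.Cycle ℝ} (hS : G.perimeterMat * S = 1)

include hS in
-- Rank and nullity of the surjective perimeter map. The bijection only serves to read the frame
-- (kernel basis, section) as a square matrix.
theorem nonempty_edge_equiv :
    Nonempty (Fin (Module.finrank ℝ (LinearMap.ker G.perimeter)) ⊕ G.Cycle ≃ G.Edge) := by
  have hsurj : LinearMap.range G.perimeter = ⊤ := by
    rw [LinearMap.range_eq_top]
    intro w
    refine ⟨S *ᵥ w, ?_⟩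
    rw [perimeter_apply, mulVec_mulVec, hS, one_mulVec]
  have h := LinearMap.finrank_range_add_finrank_ker G.perimeter
  rw [hsurj, finrank_top, Module.finrank_fintype_fun_eq_card,
    Module.finrank_fintype_fun_eq_card] at h
  refine ⟨Fintype.equivOfCardEq ?_⟩
  rw [Fintype.card_sum, Fintype.card_fin, ← h, add_comm]

theorem perimeterMat_mul_fromCols_eq (hS : G.perimeterMat * S = 1) :
    G.perimeterMat * fromCols G.kerMat S = fromCols 0 1 := by
  rw [mul_fromCols, hS, perimeterMat_mul_kerMat]

include hS in
theorem det_frame_ne_zero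
    (e : Fin (Module.finrank ℝ (LinearMap.ker G.perimeter)) ⊕ G.Cycle ≃ G.Edge) :
    ((fromCols G.kerMat S).submatrix id e.symm).det ≠ 0 := by
  intro h0
  obtain ⟨x, hx, h⟩ := exists_mulVec_eq_zero_iff.2 h0
  rw [submatrix_mulVec_equiv, Function.comp_id, Equiv.symm_symm] at h
  have h1 := congrArg (G.perimeterMat *ᵥ ·) h
  rw [mulVec_mulVec, perimeterMat_mul_fromCols_eq hS, mulVec_zero, fromCols_mulVec, zero_mulVec,
    zero_add, one_mulVec] at h1
  rw [fromCols_mulVec, h1, mulVec_zero, add_zero, kerMat_mulVec] at h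
  have h2 := Fintype.linearIndependent_iff.1 ((Module.finBasis ℝ (LinearMap.ker G.perimeter)
    ).linearIndependent.map' (LinearMap.ker G.perimeter).subtype (Submodule.ker_subtype _)) _ h
  apply hx
  funext y
  obtain ⟨i | q, rfl⟩ := e.surjective y
  · exact h2 i
  · exact congrFun h1 q

/-- The Pfaffian of the Kontsevich form on the kernel of the perimeter map. -/
theorem abs_det_kontsevichForm (h : G.Trivalent) (hS : G.perimeterMat * S = 1)
    (e : Fin (Module.finrank ℝ (LinearMap.ker G.perimeter)) ⊕ G.Cycle ≃ G.Edge) :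
    |(G.kerMatᵀ * G.kontsevichMat * G.kerMat).det| =
      2 ^ G.numVertices * ((fromCols G.kerMat S).submatrix id e.symm).det ^ 2 := by
  set R := (fromCols G.kerMat S).submatrix id e.symm with hR
  have hB := G.abs_det_bordered h
  set X := -(G.kontsevichMat + (1 / 2 : ℝ) • (G.perimeterMatᵀ * G.perimeterMat)) with hX
  -- Passage to the frame `R` multiplies the bordered determinant by `det R ^ 2` and brings the
  -- perimeter map into the form `(0, 1)`.
  have h1 : (fromBlocks R 0 0 (1 : Matrix G.Cycle G.Cycle ℝ))ᵀ *
      fromBlocks X (-G.perimeterMatᵀ) (-G.perimeterMat) 0 * fromBlocks R 0 0 1 =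
      fromBlocks (Rᵀ * X * R) (-(G.perimeterMat * R)ᵀ) (-(G.perimeterMat * R)) 0 := by
    simp [fromBlocks_transpose, fromBlocks_multiply, transpose_mul]
  have h2 := congrArg (fun A => |A.det|) h1
  simp only [det_mul, det_transpose, abs_mul, det_fromBlocks_zero₁₂, det_one, mul_one] at h2
  rw [hB] at h2
  have hPR : G.perimeterMat * R = (fromCols 0 1 : Matrix G.Cycle _ ℝ).submatrix id e.symm := by
    rw [← perimeterMat_mul_fromCols_eq hS]
    rfl
  have hRX : Rᵀ * X * R = (fromBlocks (G.kerMatᵀ * X * G.kerMat) (G.kerMatᵀ * X * S)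
      (Sᵀ * X * G.kerMat) (Sᵀ * X * S)).submatrix e.symm e.symm := by
    have : (fromCols G.kerMat S)ᵀ * X * fromCols G.kerMat S = fromBlocks (G.kerMatᵀ * X * G.kerMat)
        (G.kerMatᵀ * X * S) (Sᵀ * X * G.kerMat) (Sᵀ * X * S) := by
      rw [transpose_fromCols, fromRows_mul, fromRows_mul_fromCols]
    rw [← this]
    rfl
  have hVX : G.kerMatᵀ * X * G.kerMat = -(G.kerMatᵀ * G.kontsevichMat * G.kerMat) := by
    rw [hX, Matrix.mul_neg, Matrix.neg_mul, Matrix.mul_add, Matrix.add_mul, Matrix.mul_smul,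
      Matrix.smul_mul, ← Matrix.mul_assoc G.kerMatᵀ, Matrix.mul_assoc _ G.perimeterMat,
      perimeterMat_mul_kerMat, Matrix.mul_zero, smul_zero, add_zero]
  -- Exchanging the section columns with the border columns makes the matrix block triangular, with
  -- the form on the kernel and two blocks `-1` on the diagonal. The added perimeter term vanishes
  -- on the kernel.
  let τ : (Fin (Module.finrank ℝ (LinearMap.ker G.perimeter)) ⊕ G.Cycle) ⊕ G.Cycle ≃
      (Fin (Module.finrank ℝ (LinearMap.ker G.perimeter)) ⊕ G.Cycle) ⊕ G.Cycle :=
    (Equiv.sumAssoc _ _ _).trans ((Equiv.sumCongr (Equiv.refl _) (Equiv.sumComm _ _)).trans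
      (Equiv.sumAssoc _ _ _).symm)
  have h3 : (fromBlocks (Rᵀ * X * R) (-(G.perimeterMat * R)ᵀ) (-(G.perimeterMat * R)) 0).submatrix
      (e.sumCongr (Equiv.refl G.Cycle)) (τ.trans (e.sumCongr (Equiv.refl G.Cycle))) =
      fromBlocks (fromBlocks (-(G.kerMatᵀ * G.kontsevichMat * G.kerMat)) 0 (Sᵀ * X * G.kerMat) (-1))
        (fromRows (G.kerMatᵀ * X * S) (Sᵀ * X * S)) 0 (-1) := by
    rw [hPR, hRX, hVX]
    ext ((i | i) | i) ((j | j) | j) <;> simp [τ, one_apply, eq_comm]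
  have h4 := congrArg (fun A => |A.det|) h3
  simp only [abs_det_submatrix_equiv_equiv, det_fromBlocks_zero₂₁, det_fromBlocks_zero₁₂, det_neg,
    det_one, abs_mul, abs_pow, abs_neg, abs_one, one_pow, mul_one, one_mul] at h4
  rw [← h4, ← h2, ← sq_abs]
  ring

end RibbonGraph

namespace RibbonGraph

open Classical Matrix MeasureTheory

variable {H : Type} [Fintype H] (G : RibbonGraph H)

/-- The metrics with given perimeters. -/
def levelSet (w : G.Cycle → ℝ) : Set (G.Edge → ℝ) := {ℓ | (∀ e, 0 < ℓ e) ∧ G.perimeter ℓ = w}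

/-- From `2E = 3V` follows `V = 2 (E - V)`, so `2^V` is the square of `2^(E-V)`; the truncated
subtraction is harmless because `V ≤ E`. -/
theorem sqrt_abs_det_kontsevichForm (h : G.Trivalent) {S : Matrix G.Edge G.Cycle ℝ}
    (hS : G.perimeterMat * S = 1)
    (e : Fin (Module.finrank ℝ (LinearMap.ker G.perimeter)) ⊕ G.Cycle ≃ G.Edge) :
    Real.sqrt |(Matrix.of fun i j => G.kontsevichForm
        (Module.finBasis ℝ (LinearMap.ker G.perimeter) i : G.Edge → ℝ)
        (Module.finBasis ℝ (LinearMap.ker G.perimeter) j : G.Edge → ℝ)).det| =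
      2 ^ (G.numEdges - G.numVertices) * |((fromCols G.kerMat S).submatrix id e.symm).det| := by
  have h1 : (Matrix.of fun i j => G.kontsevichForm
        (Module.finBasis ℝ (LinearMap.ker G.perimeter) i : G.Edge → ℝ)
        (Module.finBasis ℝ (LinearMap.ker G.perimeter) j : G.Edge → ℝ)) =
      G.kerMatᵀ * G.kontsevichMat * G.kerMat := by
    ext i j
    rw [of_apply, kontsevichForm_apply, dotProduct_mulVec, Matrix.mul_apply', dotProduct_comm]
    rw [dotProduct_comm]
    rfl
  have h2 : G.numVertices = 2 * (G.numEdges - G.numVertices) := by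
    have h3 := G.card_eq_two_mul_numEdges
    have h4 := G.card_eq_three_mul_numVertices h
    omega
  rw [h1, abs_det_kontsevichForm h hS e]
  conv_lhs => rw [h2]
  rw [mul_comm 2, pow_mul, ← mul_pow, Real.sqrt_sq_eq_abs, abs_mul, abs_pow, abs_two]

variable {G}

theorem levelSet_frame {S : Matrix G.Edge G.Cycle ℝ} (hS : G.perimeterMat * S = 1)
    (w : G.Cycle → ℝ) (a : Fin (Module.finrank ℝ (LinearMap.ker G.perimeter)) → ℝ) :
    G.kerMat *ᵥ a + S *ᵥ w ∈ G.levelSet w ↔ ∀ e, 0 < (G.kerMat *ᵥ a + S *ᵥ w) e := by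
  refine ⟨fun h => h.1, fun h => ⟨h, ?_⟩⟩
  rw [perimeter_apply, mulVec_add, mulVec_mulVec, mulVec_mulVec, hS, perimeterMat_mul_kerMat,
    zero_mulVec, zero_add, one_mulVec]

theorem exists_frame {S : Matrix G.Edge G.Cycle ℝ} (hS : G.perimeterMat * S = 1)
    (ℓ : G.Edge → ℝ) : ∃ a, ℓ = G.kerMat *ᵥ a + S *ᵥ G.perimeter ℓ := by
  have hk : ℓ - S *ᵥ G.perimeter ℓ ∈ LinearMap.ker G.perimeter := by
    rw [LinearMap.mem_ker, perimeter_apply, mulVec_sub, mulVec_mulVec, hS, one_mulVec,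
      ← perimeter_apply, sub_self]
  refine ⟨(Module.finBasis ℝ (LinearMap.ker G.perimeter)).repr ⟨_, hk⟩, ?_⟩
  have h := congrArg Subtype.val
    ((Module.finBasis ℝ (LinearMap.ker G.perimeter)).sum_repr ⟨_, hk⟩)
  rw [kerMat_mulVec]
  simp only [AddSubmonoidClass.coe_finsetSum, SetLike.val_smul] at h
  rw [h, sub_add_cancel]

/-- By translation invariance all base points in the level set give the same volume, also when `S *ᵥ
w` lies outside it. For an empty level set both sides are zero. -/
theorem iSup_volume_levelSet {S : Matrix G.Edge G.Cycle ℝ} (hS : G.perimeterMat * S = 1)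
    (w : G.Cycle → ℝ) :
    ⨆ ℓ₀ ∈ G.levelSet w, volume {a | ℓ₀ + G.kerMat *ᵥ a ∈ G.levelSet w} =
      volume {a | ∀ e, 0 < (G.kerMat *ᵥ a + S *ᵥ w) e} := by
  have h : ∀ ℓ₀ ∈ G.levelSet w, volume {a | ℓ₀ + G.kerMat *ᵥ a ∈ G.levelSet w} =
      volume {a | ∀ e, 0 < (G.kerMat *ᵥ a + S *ᵥ w) e} := by
    intro ℓ₀ h₀
    obtain ⟨a₀, ha₀⟩ := exists_frame hS ℓ₀
    rw [h₀.2] at ha₀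
    rw [← measure_preimage_add volume a₀ {a | ∀ e, 0 < (G.kerMat *ᵥ a + S *ᵥ w) e}]
    congr 1
    ext a
    rw [Set.mem_preimage, Set.mem_ofPred_eq, Set.mem_ofPred_eq, ← levelSet_frame hS, mulVec_add,
      ha₀, add_right_comm]
  rcases (G.levelSet w).eq_empty_or_nonempty with h0 | ⟨ℓ₀, h₀⟩
  · have h1 : {a | ∀ e, 0 < (G.kerMat *ᵥ a + S *ᵥ w) e} = ∅ := by
      rw [Set.eq_empty_iff_forall_notMem]
      intro a ha
      have := (levelSet_frame hS w a).2 ha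
      rw [h0] at this
      exact this
    rw [h1, h0]
    simp
  · exact le_antisymm (iSup₂_le fun ℓ hℓ => (h ℓ hℓ).le) (h ℓ₀ h₀ ▸ le_iSup₂ (f := fun ℓ₀ _ =>
      volume {a | ℓ₀ + G.kerMat *ᵥ a ∈ G.levelSet w}) ℓ₀ h₀)

theorem symplecticVolume_levelSet (h : G.Trivalent) {S : Matrix G.Edge G.Cycle ℝ}
    (hS : G.perimeterMat * S = 1)
    (e : Fin (Module.finrank ℝ (LinearMap.ker G.perimeter)) ⊕ G.Cycle ≃ G.Edge)
    (w : G.Cycle → ℝ) : G.symplecticVolume (G.levelSet w) =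
      ENNReal.ofReal (2 ^ (G.numEdges - G.numVertices) *
        |((fromCols G.kerMat S).submatrix id e.symm).det|) *
        volume {a | ∀ e, 0 < (G.kerMat *ᵥ a + S *ᵥ w) e} := by
  rw [← iSup_volume_levelSet hS, ← G.sqrt_abs_det_kontsevichForm h hS e, symplecticVolume]
  simp only [kerMat_mulVec]

theorem continuous_frame (S : Matrix G.Edge G.Cycle ℝ) :
    Continuous fun z : (Fin (Module.finrank ℝ (LinearMap.ker G.perimeter)) → ℝ) ×
      (G.Cycle → ℝ) => G.kerMat *ᵥ z.1 + S *ᵥ z.2 :=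
  (continuous_const.matrix_mulVec continuous_fst).add
    (continuous_const.matrix_mulVec continuous_snd)

theorem measurableSet_positive {ι : Type} [Finite ι] :
    MeasurableSet {ℓ : ι → ℝ | ∀ e, 0 < ℓ e} := by
  have h : {ℓ : ι → ℝ | ∀ e, 0 < ℓ e} = ⋂ e, {ℓ | 0 < ℓ e} := by
    ext
    simp
  rw [h]
  exact MeasurableSet.iInter fun e => measurableSet_lt measurable_const (measurable_pi_apply e)

theorem measurable_symplecticVolume (h : G.Trivalent) :
    Measurable fun w => G.symplecticVolume (G.levelSet w) := by
  obtain ⟨S, hS⟩ := G.exists_section h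
  obtain ⟨e⟩ := nonempty_edge_equiv hS
  simp only [symplecticVolume_levelSet h hS e]
  exact Measurable.const_mul (measurable_measure_prodMk_right
    ((continuous_frame S).measurable measurableSet_positive)) _

/-- Linear change of variables from kernel coordinates and perimeters to edge lengths, with matrix
the frame. -/
theorem lintegral_frame {S : Matrix G.Edge G.Cycle ℝ} (hS : G.perimeterMat * S = 1)
    (e : Fin (Module.finrank ℝ (LinearMap.ker G.perimeter)) ⊕ G.Cycle ≃ G.Edge)
    {g : (G.Edge → ℝ) → ENNReal} (hg : Measurable g) :
    ∫⁻ z : (Fin (Module.finrank ℝ (LinearMap.ker G.perimeter)) → ℝ) × (G.Cycle → ℝ),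
      g (G.kerMat *ᵥ z.1 + S *ᵥ z.2) =
    ENNReal.ofReal |((fromCols G.kerMat S).submatrix id e.symm).det|⁻¹ * ∫⁻ ℓ, g ℓ := by
  set R := (fromCols G.kerMat S).submatrix id e.symm with hR
  have hdet : R.det ≠ 0 := det_frame_ne_zero hS e
  let κ := (MeasurableEquiv.sumPiEquivProdPi
    (fun _ : Fin (Module.finrank ℝ (LinearMap.ker G.perimeter)) ⊕ G.Cycle => ℝ)).symm.trans
    (MeasurableEquiv.piCongrLeft (fun _ => ℝ) e)
  have hκ : MeasurePreserving κ volume volume :=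
    (volume_measurePreserving_sumPiEquivProdPi_symm _).trans
      (volume_measurePreserving_piCongrLeft _ e)
  have hψ : ∀ z : (Fin (Module.finrank ℝ (LinearMap.ker G.perimeter)) → ℝ) × (G.Cycle → ℝ),
      G.kerMat *ᵥ z.1 + S *ᵥ z.2 = toLin' R (κ z) := by
    intro z
    have h1 : κ z ∘ e = Sum.elim z.1 z.2 := by
      funext i
      refine (MeasurableEquiv.piCongrLeft_apply_apply (β := fun _ => ℝ) e _ i).trans ?_
      rcases i with i | i <;> rfl
    rw [toLin'_apply, hR, submatrix_mulVec_equiv, Function.comp_id, Equiv.symm_symm, h1,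
      fromCols_mulVec_sumElim]
  simp only [hψ]
  have hm : Measurable (toLin' R) := (toLin' R).continuous_of_finiteDimensional.measurable
  rw [hκ.lintegral_comp (f := fun u => g (toLin' R u)) (hg.comp hm), ← lintegral_map hg hm,
    Real.map_matrix_volume_pi_eq_smul_volume_pi hdet, lintegral_smul_measure, abs_inv, smul_eq_mul]

/-- Integration over the level sets of the perimeter map. -/
theorem lintegral_symplecticVolume (h : G.Trivalent) {f : (G.Cycle → ℝ) → ENNReal}
    (hf : Measurable f) :
    ∫⁻ w, f w * G.symplecticVolume (G.levelSet w) =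
      2 ^ (G.numEdges - G.numVertices) *
        ∫⁻ ℓ in {ℓ : G.Edge → ℝ | ∀ e, 0 < ℓ e}, f (G.perimeter ℓ) := by
  obtain ⟨S, hS⟩ := G.exists_section h
  obtain ⟨e⟩ := nonempty_edge_equiv hS
  simp only [symplecticVolume_levelSet h hS e]
  set r := |((fromCols G.kerMat S).submatrix id e.symm).det| with hr
  have hr0 : 0 < r := abs_pos.2 (det_frame_ne_zero hS e)
  let g : (G.Edge → ℝ) → ENNReal :=
    {ℓ : G.Edge → ℝ | ∀ e, 0 < ℓ e}.indicator fun ℓ => f (G.perimeter ℓ)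
  have hg : Measurable g := (hf.comp
    G.perimeter.continuous_of_finiteDimensional.measurable).indicator measurableSet_positive
  have h1 : ∀ w, f w * volume {a | ∀ e, 0 < (G.kerMat *ᵥ a + S *ᵥ w) e} =
      ∫⁻ a, g (G.kerMat *ᵥ a + S *ᵥ w) := by
    intro w
    have hm : MeasurableSet {a | ∀ e, 0 < (G.kerMat *ᵥ a + S *ᵥ w) e} :=
      ((continuous_frame S).comp (Continuous.prodMk_left w)).measurable measurableSet_positive
    rw [← lintegral_indicator_const hm]
    refine lintegral_congr fun a => ?_
    dsimp only [g]
    by_cases ha : ∀ e, 0 < (G.kerMat *ᵥ a + S *ᵥ w) e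
    · rw [Set.indicator_of_mem (by exact ha), Set.indicator_of_mem (by exact ha),
        ((levelSet_frame hS w a).2 ha).2]
    · rw [Set.indicator_of_notMem (by exact ha), Set.indicator_of_notMem (by exact ha)]
  have h2 : ∀ w, f w * (ENNReal.ofReal (2 ^ (G.numEdges - G.numVertices) * r) *
      volume {a | ∀ e, 0 < (G.kerMat *ᵥ a + S *ᵥ w) e}) =
      ENNReal.ofReal (2 ^ (G.numEdges - G.numVertices) * r) *
        ∫⁻ a, g (G.kerMat *ᵥ a + S *ᵥ w) := fun w => by
    rw [← h1, mul_left_comm]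
  have hgm := hg.comp (continuous_frame S).measurable
  simp only [h2]
  -- After Tonelli, the Jacobian of the change of variables cancels the factor `r` of the density;
  -- the choices of kernel basis and section drop out and only `2^(E-V)` survives.
  rw [lintegral_const_mul' _ _ ENNReal.ofReal_ne_top,
    ← lintegral_prod_symm' (fun z : (Fin (Module.finrank ℝ (LinearMap.ker G.perimeter)) → ℝ) ×
      (G.Cycle → ℝ) => g (G.kerMat *ᵥ z.1 + S *ᵥ z.2)) hgm, ← Measure.volume_eq_prod,
    lintegral_frame hS e hg, ← mul_assoc, ← hr, ← ENNReal.ofReal_mul (by positivity), mul_assoc,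
    mul_inv_cancel₀ hr0.ne', mul_one, lintegral_indicator measurableSet_positive]
  congr 1
  rw [ENNReal.ofReal_pow zero_le_two, ENNReal.ofReal_ofNat]

end RibbonGraph

/-! ## Laplace transforms of the volumes -/

open MeasureTheory

theorem lintegral_exp_positive {ι : Type} [Fintype ι] {a : ι → ℝ} (ha : ∀ i, 0 < a i) :
    ∫⁻ ℓ in {ℓ : ι → ℝ | ∀ e, 0 < ℓ e}, ENNReal.ofReal (Real.exp (-∑ e, a e * ℓ e)) =
      ENNReal.ofReal (∏ e, (a e)⁻¹) := by
  have hset : {ℓ : ι → ℝ | ∀ e, 0 < ℓ e} = Set.univ.pi fun _ => Set.Ioi 0 := by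
    ext ℓ
    simp
  have hint : ∀ e, Integrable (fun x => Real.exp (-a e * x)) (volume.restrict (Set.Ioi 0)) :=
    fun e => exp_neg_integrableOn_Ioi 0 (ha e)
  have hprod : ∀ ℓ : ι → ℝ, Real.exp (-∑ e, a e * ℓ e) = ∏ e, Real.exp (-a e * ℓ e) := by
    intro ℓ
    rw [← Real.exp_sum, ← Finset.sum_neg_distrib]
    simp only [neg_mul]
  rw [hset, volume_pi, Measure.restrict_pi_pi]
  simp only [hprod]
  rw [← ofReal_integral_eq_lintegral_ofReal (Integrable.fintype_prod hint)
    (Filter.Eventually.of_forall fun ℓ => Finset.prod_nonneg fun e _ => (Real.exp_pos _).le),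
    integral_fintype_prod_eq_prod fun e x => Real.exp (-a e * x)]
  congr 1
  refine Finset.prod_congr rfl fun e _ => ?_
  rw [integral_exp_mul_Ioi (neg_lt_zero.2 (ha e))]
  simp

namespace RibbonGraph

variable {H : Type} [Fintype H] (G : RibbonGraph H)

theorem perimeter_pos {ℓ : G.Edge → ℝ} (h : ∀ e, 0 < ℓ e) (q : G.Cycle) : 0 < G.perimeter ℓ q := by
  classical
  have hq : G.cycle q.out = q := G.cycle_out q
  refine Finset.sum_pos' (fun x _ => ?_) ⟨q.out, Finset.mem_univ _, ?_⟩
  · split_ifs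
    · exact (h _).le
    · exact le_rfl
  · rw [if_pos hq]
    exact h _

theorem symplecticVolume_empty : G.symplecticVolume ∅ = 0 := by
  simp [symplecticVolume]

end RibbonGraph

namespace ColoredRibbonGraph

variable {n b : ℕ} {Γ : ColoredRibbonGraph (Fin n)}

theorem colorOpt_eq_of_cycle_eq {X : Type} {Γ : ColoredRibbonGraph X} {x y : Fin Γ.size}
    (h : Γ.graph.cycle x = Γ.graph.cycle y) : Γ.colorOpt x = Γ.colorOpt y := by
  obtain ⟨i, rfl⟩ := Equiv.Perm.SameCycle.exists_nat_pow_eq (Quotient.exact h)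
  clear h
  induction i with
  | zero => rfl
  | succ i ih =>
    rw [ih, pow_succ', Equiv.Perm.mul_apply]
    exact (colorOpt_σ₂ Γ _).symm

/-- In a face-marked graph with labelled boundaries, the cycles are labelled. -/
theorem exists_cycle_equiv (h : Γ.FaceMarked) (β : Γ.graph.Boundary ≃ Fin b) :
    ∃ δ : Fin n ⊕ Fin b ≃ Γ.graph.Cycle,
      (∀ x : {x : Fin Γ.size // x ∉ Γ.graph.B}, δ (Sum.inl (Γ.color x)) = Γ.graph.cycle x) ∧
      ∀ j, δ (Sum.inr j) = β.symm j := by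
  obtain ⟨r, hr⟩ := h.1.hasRightInverse
  have hB : ∀ x y, Γ.graph.cycle x = Γ.graph.cycle y → x ∈ Γ.graph.B → y ∈ Γ.graph.B := by
    intro x y hxy hx
    rwa [← colorOpt_eq_none_iff, ← colorOpt_eq_of_cycle_eq hxy, colorOpt_eq_none_iff]
  refine ⟨Equiv.ofBijective (Sum.elim (fun i => Γ.graph.cycle (r i)) fun j => β.symm j)
    ⟨?_, ?_⟩, fun x => h.2 _ _ (hr _), fun j => rfl⟩
  · rintro (i | j) (i' | j') hij
    · have := colorOpt_eq_of_cycle_eq (Γ := Γ) hij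
      rw [colorOpt_of_notMem (r i).2, colorOpt_of_notMem (r i').2, Option.some_inj] at this
      rw [← hr i, ← hr i', this]
    · obtain ⟨x, hx, hx'⟩ := (β.symm j').2
      exact absurd (hB _ _ (hx'.trans hij.symm) hx) (r i).2
    · obtain ⟨x, hx, hx'⟩ := (β.symm j).2
      exact absurd (hB _ _ (hx'.trans hij) hx) (r i').2
    · rw [β.symm.injective (Subtype.ext hij)]
  · intro q
    induction q using Quotient.inductionOn with | h x => ?_
    by_cases hx : x ∈ Γ.graph.B
    · exact ⟨Sum.inr (β ⟨_, x, hx, rfl⟩), by simp; rfl⟩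
    · exact ⟨Sum.inl (Γ.color ⟨x, hx⟩), h.2 _ _ (hr _)⟩

theorem metricFiber_eq {β : Γ.graph.Boundary ≃ Fin b} {δ : Fin n ⊕ Fin b ≃ Γ.graph.Cycle}
    (h1 : ∀ x : {x : Fin Γ.size // x ∉ Γ.graph.B}, δ (Sum.inl (Γ.color x)) = Γ.graph.cycle x)
    (h2 : ∀ j, δ (Sum.inr j) = β.symm j) (hs : Function.Surjective Γ.color)
    (x : Fin n → ℝ) (y : Fin b → ℝ) :
    Γ.metricFiber β x y = Γ.graph.levelSet (Sum.elim x y ∘ δ.symm) := by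
  ext ℓ
  refine and_congr_right fun _ => ?_
  rw [funext_iff, ← δ.forall_congr_right, Sum.forall]
  simp only [Function.comp, δ.symm_apply_apply, Sum.elim_inl, Sum.elim_inr]
  refine and_congr ?_ ?_
  · rw [hs.forall]
    simp only [h1]
  · rw [← β.symm.forall_congr_right]
    simp [h2]

/-- Both sides count every half-edge on a face with the weight of its color times the length of its
edge, grouped once by faces and once by edges. -/
theorem sum_perimeter (μ : Fin n → ℝ) {β : Γ.graph.Boundary ≃ Fin b}
    {δ : Fin n ⊕ Fin b ≃ Γ.graph.Cycle}
    (h1 : ∀ x : {x : Fin Γ.size // x ∉ Γ.graph.B}, δ (Sum.inl (Γ.color x)) = Γ.graph.cycle x)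
    (h2 : ∀ j, δ (Sum.inr j) = β.symm j) (ℓ : Γ.graph.Edge → ℝ) :
    ∑ i, μ i * Γ.graph.perimeter ℓ (δ (Sum.inl i)) = ∑ e, Γ.edgeWeight μ e * ℓ e := by
  classical
  have hx : ∀ x, ∑ i, (if Γ.graph.cycle x = δ (Sum.inl i) then μ i else 0) =
      (Γ.colorOpt x).elim 0 μ := by
    intro x
    by_cases hB : x ∈ Γ.graph.B
    · rw [colorOpt_eq_none_iff.2 hB]
      refine Finset.sum_eq_zero fun i _ => if_neg fun h => ?_
      have h3 := h2 (β ⟨_, x, hB, rfl⟩)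
      rw [β.symm_apply_apply] at h3
      exact Sum.inr_ne_inl (δ.injective (h3.trans h))
    · rw [colorOpt_of_notMem hB]
      have h3 : ∀ i, Γ.graph.cycle x = δ (Sum.inl i) ↔ Γ.color ⟨x, hB⟩ = i := fun i => by
        rw [← h1 ⟨x, hB⟩, δ.injective.eq_iff, Sum.inl_injective.eq_iff]
      simp [h3]
  have hr : ∑ e, Γ.edgeWeight μ e * ℓ e = ∑ x, (Γ.colorOpt x).elim 0 μ * ℓ (Γ.graph.edge x) := by
    simp only [edgeWeight_eq, Finset.sum_mul, ite_mul, zero_mul]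
    rw [Finset.sum_comm]
    simp
  rw [hr]
  simp only [RibbonGraph.perimeter, LinearMap.coe_mk, AddHom.coe_mk, Finset.mul_sum, ← hx,
    Finset.sum_mul]
  rw [Finset.sum_comm]
  refine Finset.sum_congr rfl fun x _ => Finset.sum_congr rfl fun i _ => ?_
  simp

/-- The Laplace transform of the volume of a cell. -/
theorem lintegral_cell {μ : Fin n → ℝ} (hμ : ∀ i, 0 < μ i) (hm : Γ.FaceMarked)
    (ht : Γ.graph.Trivalent) (β : Γ.graph.Boundary ≃ Fin b) :
    (Measurable fun z : (Fin n → ℝ) × (Fin b → ℝ) =>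
      Γ.graph.symplecticVolume (Γ.metricFiber β z.1 z.2)) ∧
    ∫⁻ z in orthant n b, ENNReal.ofReal (Real.exp (-∑ i, μ i * z.1 i)) *
        Γ.graph.symplecticVolume (Γ.metricFiber β z.1 z.2) =
      ENNReal.ofReal (2 ^ (Γ.graph.numEdges - Γ.graph.numVertices) *
        ∏ e, (Γ.edgeWeight μ e)⁻¹) := by
  obtain ⟨δ, h1, h2⟩ := exists_cycle_equiv hm β
  simp only [metricFiber_eq h1 h2 hm.1]
  let κ := (MeasurableEquiv.sumPiEquivProdPi (fun _ : Fin n ⊕ Fin b => ℝ)).symm.trans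
    (MeasurableEquiv.piCongrLeft (fun _ => ℝ) δ)
  have hκ : MeasurePreserving κ volume volume :=
    (volume_measurePreserving_sumPiEquivProdPi_symm _).trans
      (volume_measurePreserving_piCongrLeft _ δ)
  have hκ' : ∀ z, Sum.elim z.1 z.2 ∘ δ.symm = κ z := by
    intro z
    rw [Equiv.comp_symm_eq]
    funext i
    refine Eq.trans ?_ (MeasurableEquiv.piCongrLeft_apply_apply (β := fun _ => ℝ) δ _ i).symm
    rcases i with i | i <;> rfl
  have hz : ∀ z i, z.1 i = κ z (δ (Sum.inl i)) := fun z i => by simp [← hκ']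
  simp only [hκ']
  have hA := RibbonGraph.measurable_symplecticVolume ht
  refine ⟨hA.comp κ.measurable, ?_⟩
  let F : (Γ.graph.Cycle → ℝ) → ENNReal :=
    fun w => ENNReal.ofReal (Real.exp (-∑ i, μ i * w (δ (Sum.inl i))))
  have hF : Measurable F := by
    refine ENNReal.measurable_ofReal.comp (Real.measurable_exp.comp (Measurable.neg ?_))
    exact Finset.measurable_sum _ fun i _ => (measurable_pi_apply _).const_mul _
  have horth : MeasurableSet (orthant n b) :=
    (RibbonGraph.measurableSet_positive (ι := Fin n)).prod
      (RibbonGraph.measurableSet_positive (ι := Fin b))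
  -- A positive metric has positive perimeters, so the level sets outside the orthant are empty and
  -- the restriction can be dropped.
  have hstep : ∫⁻ z in orthant n b, ENNReal.ofReal (Real.exp (-∑ i, μ i * z.1 i)) *
      Γ.graph.symplecticVolume (Γ.graph.levelSet (κ z)) =
      ∫⁻ z, F (κ z) * Γ.graph.symplecticVolume (Γ.graph.levelSet (κ z)) := by
    rw [← lintegral_indicator horth]
    refine lintegral_congr fun z => ?_
    by_cases hzo : z ∈ orthant n b
    · rw [Set.indicator_of_mem hzo]
      simp only [hz, F]
    · rw [Set.indicator_of_notMem hzo]
      have : Γ.graph.levelSet (κ z) = ∅ := by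
        rw [Set.eq_empty_iff_forall_notMem]
        rintro ℓ ⟨hℓ, hw⟩
        have hp := Γ.graph.perimeter_pos hℓ
        rw [hw] at hp
        refine hzo ⟨fun i => ?_, fun j => ?_⟩
        · rw [hz]
          exact hp _
        · have := hp (δ (Sum.inr j))
          simpa [← hκ'] using this
      rw [this, RibbonGraph.symplecticVolume_empty, mul_zero]
  rw [hstep, hκ.lintegral_comp (f := fun w => F w * Γ.graph.symplecticVolume (Γ.graph.levelSet w))
    (hF.mul hA), RibbonGraph.lintegral_symplecticVolume ht hF]
  simp only [F, sum_perimeter μ h1 h2]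
  rw [lintegral_exp_positive (edgeWeight_pos Γ hμ), ENNReal.ofReal_mul (by positivity),
    ENNReal.ofReal_pow zero_le_two, ENNReal.ofReal_ofNat]

/-- The Laplace transform of the volume of a cell, as a Bochner integral. -/
theorem integral_cell {μ : Fin n → ℝ} (hμ : ∀ i, 0 < μ i) (hm : Γ.FaceMarked)
    (ht : Γ.graph.Trivalent) (β : Γ.graph.Boundary ≃ Fin b) :
    IntegrableOn (fun z : (Fin n → ℝ) × (Fin b → ℝ) => Real.exp (-∑ i, μ i * z.1 i) *
        (Γ.graph.symplecticVolume (Γ.metricFiber β z.1 z.2)).toReal) (orthant n b) ∧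
    ∫ z in orthant n b, Real.exp (-∑ i, μ i * z.1 i) *
        (Γ.graph.symplecticVolume (Γ.metricFiber β z.1 z.2)).toReal =
      2 ^ (Γ.graph.numEdges - Γ.graph.numVertices) * ∏ e, (Γ.edgeWeight μ e)⁻¹ := by
  obtain ⟨hA, hint⟩ := lintegral_cell hμ hm ht β
  have hm' : Measurable fun z : (Fin n → ℝ) × (Fin b → ℝ) =>
      ENNReal.ofReal (Real.exp (-∑ i, μ i * z.1 i)) *
        Γ.graph.symplecticVolume (Γ.metricFiber β z.1 z.2) := by
    refine (ENNReal.measurable_ofReal.comp (Real.measurable_exp.comp (Measurable.neg ?_))).mul hA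
    exact Finset.measurable_sum _ fun i _ =>
      ((measurable_pi_apply _).comp measurable_fst).const_mul _
  have htop : ∫⁻ z in orthant n b, ENNReal.ofReal (Real.exp (-∑ i, μ i * z.1 i)) *
        Γ.graph.symplecticVolume (Γ.metricFiber β z.1 z.2) ≠ ⊤ := by
    rw [hint]
    exact ENNReal.ofReal_ne_top
  have hr : ∀ z : (Fin n → ℝ) × (Fin b → ℝ), Real.exp (-∑ i, μ i * z.1 i) *
        (Γ.graph.symplecticVolume (Γ.metricFiber β z.1 z.2)).toReal =
      (ENNReal.ofReal (Real.exp (-∑ i, μ i * z.1 i)) *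
        Γ.graph.symplecticVolume (Γ.metricFiber β z.1 z.2)).toReal := fun z => by
    rw [ENNReal.toReal_mul, ENNReal.toReal_ofReal (Real.exp_pos _).le]
  simp only [hr]
  refine ⟨integrable_toReal_of_lintegral_ne_top hm'.aemeasurable htop, ?_⟩
  rw [integral_toReal hm'.aemeasurable (ae_lt_top hm' htop), hint, ENNReal.toReal_ofReal]
  exact mul_nonneg (by positivity) (Finset.prod_nonneg fun e _ =>
    (inv_pos.2 (edgeWeight_pos Γ hμ e)).le)

end ColoredRibbonGraph

/-! ## The Laplace transform as a sum over graphs -/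

open MeasureTheory ColoredRibbonGraph

section TopCells

variable {g b n : ℕ} {Γ : ColoredRibbonGraph (Fin n)}

/-- Euler's relation combined with `2E = 3V`. -/
theorem RibbonGraph.HasType.numVertices_eq {H : Type} [Fintype H] {G : RibbonGraph H}
    (h : G.HasType g b n) (ht : G.Trivalent) : G.numVertices + 4 = 4 * g + 2 * b + 2 * n := by
  have h1 := G.card_eq_two_mul_numEdges
  have h2 := G.card_eq_three_mul_numVertices ht
  have h3 := h.2.2.2
  omega

theorem RibbonGraph.HasType.numEdges_eq {H : Type} [Fintype H] {G : RibbonGraph H}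
    (h : G.HasType g b n) (ht : G.Trivalent) : G.numEdges + 6 = 6 * g + 3 * b + 3 * n := by
  have h1 := G.card_eq_two_mul_numEdges
  have h2 := G.card_eq_three_mul_numVertices ht
  have h3 := h.2.2.2
  omega

theorem finite_topCells (g b n : ℕ) :
    {q : IsoClass (Fin n) | IsTopCell g b n q.out}.Finite := by
  refine (finite_trivalent (4 * g + 2 * b + 2 * n - 4)).subset fun q hq => ⟨hq.2.2, ?_⟩
  have := hq.1.numVertices_eq hq.2.2
  omega

theorem ColoredRibbonGraph.weight_eq_of_trivalent (ht : Γ.graph.Trivalent) (μ : Fin n → ℝ) :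
    Γ.weight μ = 1 / (Γ.autCard : ℝ) * (2 ^ (Γ.graph.numEdges - Γ.graph.numVertices) *
      ∏ e, (Γ.edgeWeight μ e)⁻¹) := by
  have h1 := Γ.graph.card_eq_two_mul_numEdges
  have h2 := Γ.graph.card_eq_three_mul_numVertices ht
  rw [weight, ← Nat.cast_sub (by omega), zpow_natCast]
  ring

theorem ColoredRibbonGraph.weight_smul (μ : Fin n → ℝ) (s : ℝ) :
    Γ.weight (fun i => s * μ i) = s ^ (-(Γ.graph.numEdges : ℤ)) * Γ.weight μ := by
  have h : ∀ e, Γ.edgeWeight (fun i => s * μ i) e = s * Γ.edgeWeight μ e := fun e => by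
    simp only [edgeWeight, Finset.mul_sum, mul_ite, mul_zero]
  simp only [weight, h, mul_inv, Finset.prod_mul_distrib, Finset.prod_const, Finset.card_univ]
  rw [zpow_neg, zpow_natCast, RibbonGraph.numEdges, Nat.card_eq_fintype_card, inv_pow]
  ring

open Classical in
theorem laplaceIntegrand_eq (g b n : ℕ) (μ : Fin n → ℝ) (z : (Fin n → ℝ) × (Fin b → ℝ)) :
    laplaceIntegrand g b n μ z = ∑ q ∈ (finite_topCells g b n).toFinset,
      (1 / (b.factorial : ℝ)) * ((1 / (q.out.autCard : ℝ)) *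
        ∑ β : q.out.graph.Boundary ≃ Fin b, Real.exp (-∑ i, μ i * z.1 i) *
          (q.out.graph.symplecticVolume (q.out.metricFiber β z.1 z.2)).toReal) := by
  rw [laplaceIntegrand, openVol]
  rw [show (∑ᶠ (q : IsoClass (Fin n)) (_ : IsTopCell g b n q.out),
      (1 / (q.out.autCard : ℝ)) * ∑ᶠ β : q.out.graph.Boundary ≃ Fin b,
        (q.out.graph.symplecticVolume (q.out.metricFiber β z.1 z.2)).toReal) = _ from
    finsum_mem_eq_finite_toFinset_sum _ (finite_topCells g b n)]
  simp only [finsum_eq_sum_of_fintype, Finset.mul_sum]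
  refine Finset.sum_congr rfl fun q _ => Finset.sum_congr rfl fun β _ => ?_
  ring

theorem integrableOn_laplaceIntegrand (g b n : ℕ) {μ : Fin n → ℝ} (hμ : ∀ i, 0 < μ i) :
    IntegrableOn (laplaceIntegrand g b n μ) (orthant n b) := by
  classical
  simp only [funext (laplaceIntegrand_eq g b n μ)]
  refine integrable_finsetSum _ fun q hq => ?_
  have hq' : IsTopCell g b n q.out := (finite_topCells g b n).mem_toFinset.1 hq
  exact ((integrable_finsetSum _ fun β _ =>
    (integral_cell hμ hq'.2.1 hq'.2.2 β).1).const_mul _).const_mul _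

theorem openW_eq (g b n : ℕ) {μ : Fin n → ℝ} (hμ : ∀ i, 0 < μ i) :
    openW g b n μ = ∑ᶠ (q : IsoClass (Fin n)) (_ : IsTopCell g b n q.out), q.out.weight μ := by
  classical
  rw [show (∑ᶠ (q : IsoClass (Fin n)) (_ : IsTopCell g b n q.out), q.out.weight μ) = _ from
    finsum_mem_eq_finite_toFinset_sum _ (finite_topCells g b n), openW]
  simp only [laplaceIntegrand_eq]
  have hcell : ∀ q ∈ (finite_topCells g b n).toFinset, IsTopCell g b n q.out :=
    fun q hq => (finite_topCells g b n).mem_toFinset.1 hq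
  rw [integral_finsetSum]
  · refine Finset.sum_congr rfl fun q hq => ?_
    obtain ⟨h1, h2, h3⟩ := hcell q hq
    rw [integral_const_mul, integral_const_mul, integral_finsetSum _ fun β _ =>
      (integral_cell hμ h2 h3 β).1, Finset.sum_congr rfl fun β _ => (integral_cell hμ h2 h3 β).2,
      Finset.sum_const, Finset.card_univ, nsmul_eq_mul, weight_eq_of_trivalent h3]
    -- The Laplace transform of a cell does not depend on the labelling `β`, so the `b!` labellings
    -- cancel the prefactor `1/b!`.
    have hb : Fintype.card (q.out.graph.Boundary ≃ Fin b) = b.factorial := by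
      have e : q.out.graph.Boundary ≃ Fin b := Finite.equivFinOfCardEq h1.2.2.1
      rw [Fintype.card_equiv e, ← Nat.card_eq_fintype_card, h1.2.2.1.symm]
      rfl
    rw [hb]
    have : (b.factorial : ℝ) ≠ 0 := Nat.cast_ne_zero.2 b.factorial_ne_zero
    field_simp
  · intro q hq
    obtain ⟨h1, h2, h3⟩ := hcell q hq
    exact ((integrable_finsetSum _ fun β _ => (integral_cell hμ h2 h3 β).1).const_mul _).const_mul _

theorem openW_smul (g b n : ℕ) {μ : Fin n → ℝ} (hμ : ∀ i, 0 < μ i) {s : ℝ} (hs : 0 < s) :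
    openW g b n (fun i => s * μ i) =
      s ^ (6 - (6 * g + 3 * b + 3 * n) : ℤ) * openW g b n μ := by
  rw [openW_eq g b n hμ, openW_eq g b n fun i => mul_pos hs (hμ i),
    show (∑ᶠ (q : IsoClass (Fin n)) (_ : IsTopCell g b n q.out), q.out.weight μ) = _ from
      finsum_mem_eq_finite_toFinset_sum _ (finite_topCells g b n),
    show (∑ᶠ (q : IsoClass (Fin n)) (_ : IsTopCell g b n q.out),
      q.out.weight fun i => s * μ i) = _ from
      finsum_mem_eq_finite_toFinset_sum _ (finite_topCells g b n), Finset.mul_sum]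
  refine Finset.sum_congr rfl fun q hq => ?_
  obtain ⟨h1, -, h3⟩ := (finite_topCells g b n).mem_toFinset.1 hq
  rw [weight_smul]
  congr 2
  have := h1.numEdges_eq h3
  omega

end TopCells

/-! ## The Euler characteristic of a connected graph -/

namespace RibbonGraph

variable {H : Type} [Fintype H] (G : RibbonGraph H)

/-- Coboundaries of vertex functions and of cycle functions are orthogonal. Reindexing by `σ₁` and
`σ₂` makes all four terms equal up to sign, because `σ₁ x` and `σ₂ x` lie at the same vertex. -/
theorem sum_coboundary_mul {u y : H → ℝ} (hu : ∀ x, u (G.σ₀ x) = u x)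
    (hy : ∀ x, y (G.σ₂ x) = y x) :
    ∑ x, (u x - u (G.σ₁ x)) * (y x - y (G.σ₁ x)) = 0 := by
  have h1 : ∑ x, u (G.σ₁ x) * y (G.σ₁ x) = ∑ x, u x * y x :=
    Equiv.sum_comp G.σ₁ fun x => u x * y x
  have h2 : ∑ x, u (G.σ₁ x) * y x = ∑ x, u x * y x := by
    have : ∀ x, u (G.σ₁ x) * y x = u (G.σ₂ x) * y (G.σ₂ x) := fun x => by
      have h := hu (G.σ₂ x)
      rw [σ₂, Equiv.Perm.mul_apply, perm_apply_inv] at h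
      rw [hy, h, σ₂, Equiv.Perm.mul_apply]
    rw [Finset.sum_congr rfl fun x _ => this x]
    exact Equiv.sum_comp G.σ₂ fun x => u x * y x
  have h3 : ∑ x, u x * y (G.σ₁ x) = ∑ x, u x * y x := by
    rw [← h2, ← Equiv.sum_comp G.σ₁]
    simp only [G.σ₁_invol]
  have h4 : ∀ x, (u x - u (G.σ₁ x)) * (y x - y (G.σ₁ x)) =
      u x * y x - u x * y (G.σ₁ x) - u (G.σ₁ x) * y x + u (G.σ₁ x) * y (G.σ₁ x) := fun x => by ring
  simp only [h4, Finset.sum_add_distrib, Finset.sum_sub_distrib, h1, h2, h3]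
  ring

theorem eq_of_invariant (h : G.Connected) {u : H → ℝ} (h0 : ∀ x, u (G.σ₀ x) = u x)
    (h1 : ∀ x, u (G.σ₁ x) = u x) (x y : H) : u x = u y := by
  have h' := (G.connected_iff.1 h).2 {z | u z = u y} (fun z hz => (h0 z).trans hz)
    (fun z hz => (h1 z).trans hz) ⟨y, rfl⟩
  exact Set.eq_univ_iff_forall.1 h' x

/-- This is nonnegativity of the genus. A vertex function and a cycle function are sent to the sum
of their coboundaries and to their values at `x₀`. If the image is zero, orthogonality makes both
coboundaries vanish, and connectedness makes both functions constant, hence zero. -/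
theorem card_vertex_add_card_cycle_le (h : G.Connected) :
    G.numVertices + Nat.card G.Cycle ≤ G.numEdges + 2 := by
  obtain ⟨x₀⟩ := h.1
  let V : H → G.Vertex := fun x => Quotient.mk _ x
  let δ : (G.Vertex → ℝ) × (G.Cycle → ℝ) → H → ℝ := fun z x =>
    (z.1 (V x) - z.1 (V (G.σ₁ x))) + (z.2 (G.cycle x) - z.2 (G.cycle (G.σ₁ x)))
  let Φ : (G.Vertex → ℝ) × (G.Cycle → ℝ) →ₗ[ℝ] (G.Edge → ℝ) × ℝ × ℝ :=
    { toFun := fun z => (fun e => δ z e.out, z.1 (V x₀), z.2 (G.cycle x₀))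
      map_add' := fun z w => by
        refine Prod.ext (funext fun e => ?_) rfl
        simp [δ]
        ring
      map_smul' := fun r z => by
        refine Prod.ext (funext fun e => ?_) rfl
        simp [δ]
        ring }
  have hV : ∀ x, V (G.σ₀ x) = V x := fun x => Quotient.sound
    ⟨-1, by rw [zpow_neg_one, Equiv.Perm.inv_eq_iff_eq]⟩
  have hinj : Function.Injective Φ := by
    rw [← LinearMap.ker_eq_bot, LinearMap.ker_eq_bot']
    intro z hz
    have hz1 : ∀ e : G.Edge, δ z e.out = 0 := fun e => congrFun (congrArg Prod.fst hz) e
    have hδ : ∀ x, δ z x = 0 := by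
      intro x
      -- `δ z` changes sign under `σ₁`, so its vanishing at one half-edge of every edge suffices.
      have hx : G.edge x = G.edge (G.edge x).out := (Quotient.out_eq _).symm
      rcases G.edge_eq_iff.1 hx with h | h
      · rw [h]
        exact hz1 _
      · rw [h, ← neg_eq_zero, ← hz1 (G.edge x)]
        simp only [δ, G.σ₁_invol]
        ring
    have horth := G.sum_coboundary_mul (u := fun x => z.1 (V x)) (y := fun x => z.2 (G.cycle x))
      (fun x => by rw [hV]) (fun x => by rw [cycle_σ₂])
    have hy : ∀ x, z.2 (G.cycle x) - z.2 (G.cycle (G.σ₁ x)) =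
        -(z.1 (V x) - z.1 (V (G.σ₁ x))) := fun x => by
      have := hδ x
      simp only [δ] at this
      linarith
    simp only [hy, mul_neg, Finset.sum_neg_distrib, neg_eq_zero, ← sq] at horth
    have h0 : ∀ x, z.1 (V x) - z.1 (V (G.σ₁ x)) = 0 := fun x =>
      pow_eq_zero_iff two_ne_zero |>.1
        ((Finset.sum_eq_zero_iff_of_nonneg fun x _ => sq_nonneg _).1 horth x (Finset.mem_univ x))
    have hcu := G.eq_of_invariant h (u := fun x => z.1 (V x)) (fun x => by rw [hV])
      fun x => (sub_eq_zero.1 (h0 x)).symm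
    have hy1 : ∀ x, z.2 (G.cycle (G.σ₁ x)) = z.2 (G.cycle x) := fun x => by
      have := hy x
      rw [h0, neg_zero, sub_eq_zero] at this
      exact this.symm
    have hcy := G.eq_of_invariant h (u := fun x => z.2 (G.cycle x)) (fun x => by
        have h3 : G.cycle (G.σ₂ (G.σ₁ (G.σ₀ x))) = G.cycle x := by
          rw [σ₂, Equiv.Perm.mul_apply, G.σ₁_invol, Equiv.Perm.inv_eq_iff_eq.2 rfl]
        rw [← hy1, ← G.cycle_σ₂, h3]) hy1
    refine Prod.ext (funext fun v => ?_) (funext fun q => ?_)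
    · induction v using Quotient.inductionOn with | h x => ?_
      exact (hcu x x₀).trans (congrArg (fun w => w.2.1) hz)
    · induction q using Quotient.inductionOn with | h x => ?_
      exact (hcy x x₀).trans (congrArg (fun w => w.2.2) hz)
  have hle := LinearMap.finrank_le_finrank_of_injective hinj
  rw [Module.finrank_prod, Module.finrank_prod, Module.finrank_prod,
    Module.finrank_fintype_fun_eq_card, Module.finrank_fintype_fun_eq_card,
    Module.finrank_fintype_fun_eq_card, Module.finrank_self] at hle
  rw [numVertices, numEdges, Nat.card_eq_fintype_card, Nat.card_eq_fintype_card,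
    Nat.card_eq_fintype_card]
  omega

open Classical Matrix in
-- A skew form with nonzero determinant lives on a space of even dimension; here this is the kernel
-- of the perimeter map, of dimension `E - C`.
theorem even_card_add (ht : G.Trivalent) : Even (G.numEdges + Nat.card G.Cycle) := by
  obtain ⟨S, hS⟩ := G.exists_section ht
  obtain ⟨e⟩ := nonempty_edge_equiv hS
  have hcard := Fintype.card_congr e
  rw [Fintype.card_sum, Fintype.card_fin] at hcard
  have hdet := abs_det_kontsevichForm ht hS e
  have hne := det_frame_ne_zero hS e
  have hskew : (G.kerMatᵀ * G.kontsevichMat * G.kerMat)ᵀ =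
      -(G.kerMatᵀ * G.kontsevichMat * G.kerMat) := by
    rw [transpose_mul, transpose_mul, transpose_transpose, kontsevichMat, transpose_smul,
      transpose_mul, transpose_mul, transpose_transpose, transpose_sub, transpose_transpose,
      ← neg_sub G.orderMat]
    simp only [Matrix.mul_neg, Matrix.neg_mul, smul_neg, Matrix.mul_assoc]
  have hd := congrArg det hskew
  rw [det_transpose, det_neg, Fintype.card_fin] at hd
  have heven : Even (Module.finrank ℝ (LinearMap.ker G.perimeter)) := by
    by_contra hodd
    rw [(Nat.not_even_iff_odd.1 hodd).neg_one_pow] at hd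
    have h0 : (G.kerMatᵀ * G.kontsevichMat * G.kerMat).det = 0 := by linarith
    rw [h0, abs_zero] at hdet
    exact absurd hdet.symm (by positivity)
  rw [numEdges, Nat.card_eq_fintype_card, Nat.card_eq_fintype_card, ← hcard]
  obtain ⟨k, hk⟩ := heven
  rw [hk]
  exact ⟨k + Fintype.card G.Cycle, by ring⟩

/-- `card_vertex_add_card_cycle_le` gives `2 - V + E - C ≥ 0`, and `even_card_add`, with `V` even by
`2E = 3V`, makes it even; the genus is half of it. -/
theorem exists_genus (h : G.Connected) (ht : G.Trivalent) :
    ∃ g : ℕ, G.numVertices + 4 = 4 * g + 2 * Nat.card G.Cycle := by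
  have h1 := G.card_eq_two_mul_numEdges
  have h2 := G.card_eq_three_mul_numVertices ht
  have h3 := G.card_vertex_add_card_cycle_le h
  obtain ⟨k, hk⟩ := G.even_card_add ht
  exact ⟨(G.numEdges + 2 - G.numVertices - Nat.card G.Cycle) / 2, by omega⟩

end RibbonGraph

/-! ## Face-marked graphs and colored graphs -/

section FaceMarked

variable {H H' X Y : Type}

theorem IsStr.eq_of_sameCycle {s t : Equiv.Perm H} {c : H → Option X} (h : IsStr s t c) {x y : H}
    (hxy : Equiv.Perm.SameCycle (s⁻¹ * t) x y) : c x = c y := by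
  have := sameCycle_map (σ' := (1 : Equiv.Perm (Option X))) c
    (fun x => by rw [Equiv.Perm.mul_apply, h.2.2.1]) hxy
  simpa using this

/-- The coloring of the faces by `X` is bijective. -/
def IsMarked (s t : Equiv.Perm H) (c : H → Option X) : Prop :=
  (∀ i, ∃ x, c x = some i) ∧
    ∀ x y i, c x = some i → c y = some i → Equiv.Perm.SameCycle (s⁻¹ * t) x y

/-- The faces of a structure. -/
abbrev StrFace (s t : Equiv.Perm H) (c : H → Option X) : Type :=
  CyclesIn (s⁻¹ * t) fun x => c x ≠ none

/-- Composition of the coloring with a map of colors. -/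
def Str.map {s : Equiv.Perm H} (φ : X → Y) (p : Str s X) : Str s Y :=
  ⟨(p.1.1, fun x => (p.1.2 x).map φ), p.2.1, p.2.2.1,
    fun x => congrArg (Option.map φ) (p.2.2.2.1 x), fun x hx => by
      rw [Option.map_eq_none_iff] at hx
      rw [Ne, Option.map_eq_none_iff]
      exact p.2.2.2.2 x hx⟩

theorem strWeight_map [Fintype H] {s : Equiv.Perm H} (lam : Y → ℝ) (Q : ℂ) (φ : X → Y)
    (p : Str s X) : strWeight lam Q s (p.map φ).1.1 (p.map φ).1.2 =
      strWeight (fun i => lam (φ i)) Q s p.1.1 p.1.2 := by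
  have h1 : numBdry s (p.map φ).1.1 (p.map φ).1.2 = numBdry s p.1.1 p.1.2 := by
    simp only [numBdry, Str.map, Option.map_eq_none_iff]
  have h2 : ∀ o : Option X, (o.map φ).elim 0 lam = o.elim 0 fun i => lam (φ i) := by
    rintro (_ | i) <;> rfl
  rw [strWeight, strWeight, h1]
  simp only [Str.map, edgeFactor, h2]

/-- A coloring is a marking of the faces together with a map of colors. -/
theorem card_marked_of_map [Finite H] {s : Equiv.Perm H} {n : ℕ} (P : Str s X) :
    Nat.card {z : (Fin n → X) × Str s (Fin n) //
      IsMarked s z.2.1.1 z.2.1.2 ∧ z.2.map z.1 = P} =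
      if Nat.card (StrFace s P.1.1 P.1.2) = n then n.factorial else 0 := by
  obtain ⟨⟨t, C⟩, hP⟩ := P
  have hcard : Nat.card (StrFace s t C ≃ Fin n) =
      if Nat.card (StrFace s t C) = n then n.factorial else 0 := by
    classical
    cases nonempty_fintype (StrFace s t C)
    split_ifs with h
    · have e : StrFace s t C ≃ Fin n := Finite.equivFinOfCardEq h
      rw [Nat.card_eq_fintype_card, Fintype.card_equiv e, ← Nat.card_eq_fintype_card, h]
    · have : IsEmpty (StrFace s t C ≃ Fin n) := ⟨fun e => h (by
        rw [Nat.card_congr e, Nat.card_fin])⟩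
      exact Nat.card_of_isEmpty
  refine Eq.trans ?_ hcard
  symm
  let mk : ∀ x, C x ≠ none → StrFace s t C := fun x hx => ⟨Quotient.mk _ x, x, hx, rfl⟩
  have hr : ∀ q : StrFace s t C, ∃ x, ∃ h : C x ≠ none, mk x h = q := fun ⟨q, x, hx, hq⟩ =>
    ⟨x, hx, Subtype.ext hq⟩
  choose r hr hmk using hr
  have hmk_eq : ∀ x y hx hy, Equiv.Perm.SameCycle (s⁻¹ * t) x y → mk x hx = mk y hy :=
    fun x y hx hy h => Subtype.ext (Quotient.sound h)
  have hcyc : ∀ x y hx hy, mk x hx = mk y hy → Equiv.Perm.SameCycle (s⁻¹ * t) x y :=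
    fun x y hx hy h => Quotient.exact (congrArg Subtype.val h)
  have hcol : ∀ q, ∃ i, C (r q) = some i := fun q => Option.ne_none_iff_exists'.1 (hr q)
  choose col hcol using hcol
  have hcol' : ∀ x hx, C x = some (col (mk x hx)) := fun x hx => by
    rw [← hcol]
    exact hP.eq_of_sameCycle (hcyc _ _ hx (hr _) (hmk _).symm)
  classical
  -- A numbering `θ` of the faces determines the marking `c θ` and then the only map of colors `φ`
  -- that recovers `C`; every pair arises in this way. The count is therefore that of the
  -- numberings.
  let c : (StrFace s t C ≃ Fin n) → H → Option (Fin n) := fun θ x =>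
    if h : C x = none then none else some (θ (mk x h))
  have hc0 : ∀ θ x, c θ x = none ↔ C x = none := fun θ x => by
    by_cases h : C x = none <;> simp [c, h]
  have hc1 : ∀ θ x (h : C x ≠ none), c θ x = some (θ (mk x h)) := fun θ x h => dif_neg h
  have hstr : ∀ θ, IsStr s t (c θ) := fun θ => by
    refine ⟨hP.1, hP.2.1, fun x => ?_, fun x hx => ?_⟩
    · have h3 : C (s⁻¹ (t x)) = C x := hP.2.2.1 x
      by_cases h : C x = none
      · rw [(hc0 θ x).2 h, hc0, h3, h]
      · rw [hc1 θ x h, hc1 θ _ (h3 ▸ h), hmk_eq _ x (h3 ▸ h) h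
          ⟨-1, by rw [zpow_neg_one, Equiv.Perm.inv_eq_iff_eq]; rfl⟩]
    · rw [Ne, hc0]
      exact hP.2.2.2 x ((hc0 θ x).1 hx)
  have hmark : ∀ θ, IsMarked s t (c θ) := fun θ => by
    refine ⟨fun i => ⟨r (θ.symm i), ?_⟩, fun x y i hx hy => ?_⟩
    · rw [hc1 _ _ (hr _), hmk, θ.apply_symm_apply]
    · have hx' : C x ≠ none := fun h => by simp [(hc0 θ x).2 h] at hx
      have hy' : C y ≠ none := fun h => by simp [(hc0 θ y).2 h] at hy
      rw [hc1 _ _ hx'] at hx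
      rw [hc1 _ _ hy'] at hy
      exact hcyc _ _ hx' hy' (θ.injective (Option.some_injective _ (hx.trans hy.symm)))
  have hmap : ∀ θ : StrFace s t C ≃ Fin n,
      Str.map (fun i => col (θ.symm i)) ⟨(t, c θ), hstr θ⟩ = ⟨(t, C), hP⟩ := fun θ => by
    refine Subtype.ext (Prod.ext rfl (funext fun x => ?_))
    change (c θ x).map _ = C x
    by_cases h : C x = none
    · rw [h, Option.map_eq_none_iff, hc0, h]
    · rw [hc1 _ _ h, Option.map_some, θ.symm_apply_apply, ← hcol' _ h]
  refine Nat.card_eq_of_bijective (fun θ => ⟨(fun i => col (θ.symm i), ⟨(t, c θ), hstr θ⟩),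
    hmark θ, hmap θ⟩) ⟨fun θ θ' h => ?_, ?_⟩
  · have h' : c θ = c θ' := congrArg (fun z => z.1.2.1.2) h
    ext1 q
    have := congrFun h' (r q)
    rwa [hc1 _ _ (hr q), hc1 _ _ (hr q), hmk, Option.some_inj] at this
  · rintro ⟨⟨φ, ⟨⟨t', c'⟩, hp⟩⟩, hm, hz⟩
    obtain rfl : t' = t := congrArg (fun z => z.1.1) hz
    replace hm : IsMarked s t' c' := hm
    have hC : ∀ x, (c' x).map φ = C x := fun x => congrFun (congrArg (fun z => z.1.2) hz) x
    have hv : ∀ q, ∃ i, c' (r q) = some i := fun q => Option.ne_none_iff_exists'.1 fun h =>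
      hr q (by rw [← hC, h]; rfl)
    choose v hv using hv
    have hv' : ∀ x hx, c' x = some (v (mk x hx)) := fun x hx => by
      rw [← hv]
      exact hp.eq_of_sameCycle (hcyc _ _ hx (hr _) (hmk _).symm)
    let θ : StrFace s t' C ≃ Fin n := Equiv.ofBijective v ⟨fun q q' h => by
        have := hm.2 (r q) (r q') (v q) (hv q) (h ▸ hv q')
        exact (hmk q).symm.trans ((hmk_eq _ _ (hr q) (hr q') this).trans (hmk q')), fun i => by
        obtain ⟨x, hx⟩ := hm.1 i
        have hx' : C x ≠ none := by rw [← hC, hx]; simp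
        refine ⟨mk x hx', ?_⟩
        have := hv' x hx'
        rw [hx, Option.some_inj] at this
        exact this.symm⟩
    have hθ : c θ = c' := funext fun x => by
      by_cases h : C x = none
      · rw [(hc0 θ x).2 h]
        rw [← hC, Option.map_eq_none_iff] at h
        exact h.symm
      · rw [hc1 _ _ h, hv' x h]
        rfl
    have hφ : (fun i => col (θ.symm i)) = φ := funext fun i => by
      obtain ⟨q, rfl⟩ := θ.surjective i
      rw [θ.symm_apply_apply]
      have h1 := hC (r q)
      rw [hv q, hcol q, Option.map_some, Option.some_inj] at h1
      exact h1.symm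
    exact ⟨θ, Subtype.ext (Prod.ext hφ (Subtype.ext (Prod.ext rfl hθ)))⟩

end FaceMarked

/-! ## Top cells as marked structures, and the genus expansion -/

section TopCellStructures

variable {H H' X : Type}

theorem isMarked_conj {s : Equiv.Perm H} {s' : Equiv.Perm H'} (e : H ≃ H')
    (he : ∀ x, e (s x) = s' (e x)) {t : Equiv.Perm H} {t' : Equiv.Perm H'}
    (ht : ∀ x, e (t x) = t' (e x)) {c : H → Option X} {c' : H' → Option X}
    (hc : ∀ x, c' (e x) = c x) : IsMarked s' t' c' ↔ IsMarked s t c := by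
  have h' : ∀ x, e ((s⁻¹ * t) x) = (s'⁻¹ * t') (e x) := fun y => by
    rw [Equiv.Perm.mul_apply, Equiv.Perm.mul_apply, Equiv.Perm.eq_inv_iff_eq, ← he, ← ht,
      perm_apply_inv]
  refine and_congr (forall_congr' fun i => ?_) ?_
  · rw [← e.exists_congr_right]
    simp only [hc]
  · rw [← e.forall_congr_right]
    refine forall_congr' fun x => ?_
    rw [← e.forall_congr_right]
    simp only [hc, sameCycle_map_iff e.injective h']

theorem card_strFace_conj {s : Equiv.Perm H} {s' : Equiv.Perm H'} (e : H ≃ H')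
    (he : ∀ x, e (s x) = s' (e x)) {t : Equiv.Perm H} {t' : Equiv.Perm H'}
    (ht : ∀ x, e (t x) = t' (e x)) {c : H → Option X} {c' : H' → Option X}
    (hc : ∀ x, c' (e x) = c x) : Nat.card (StrFace s' t' c') = Nat.card (StrFace s t c) := by
  have h' : ∀ x, e ((s⁻¹ * t) x) = (s'⁻¹ * t') (e x) := fun y => by
    rw [Equiv.Perm.mul_apply, Equiv.Perm.mul_apply, Equiv.Perm.eq_inv_iff_eq, ← he, ← ht,
      perm_apply_inv]
  refine (card_cyclesIn_congr e (fun x hx => by rwa [hc]) (fun x y _ _ =>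
    sameCycle_map_iff e.injective h') fun y hy => ⟨e.symm y, ?_, ?_⟩).symm
  · rw [← hc]; simpa using hy
  · rw [e.apply_symm_apply]

namespace ColoredRibbonGraph

variable {n g b m : ℕ}

theorem faceMarked_iff (Γ : ColoredRibbonGraph X) :
    Γ.FaceMarked ↔ IsMarked Γ.graph.σ₀ Γ.graph.σ₁ Γ.colorOpt := by
  have hsome : ∀ x i, Γ.colorOpt x = some i ↔ ∃ h, Γ.color ⟨x, h⟩ = i := fun x i => by
    by_cases hx : x ∈ Γ.graph.B
    · simp [colorOpt_eq_none_iff.2 hx, hx]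
    · simp [colorOpt_of_notMem hx, hx]
  refine and_congr (forall_congr' fun i => ?_) ⟨fun h x y i hx hy => ?_, fun h x y hxy => ?_⟩
  · simp only [hsome, Subtype.exists]
  · obtain ⟨hx', rfl⟩ := (hsome _ _).1 hx
    obtain ⟨hy', h'⟩ := (hsome _ _).1 hy
    exact Quotient.exact (h ⟨x, hx'⟩ ⟨y, hy'⟩ h'.symm)
  · exact Quotient.sound (h x y _ ((hsome _ _).2 ⟨x.2, rfl⟩) ((hsome _ _).2 ⟨y.2, hxy.symm⟩))

theorem numFaces_eq (Γ : ColoredRibbonGraph X) :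
    Γ.graph.numFaces = Nat.card (StrFace Γ.graph.σ₀ Γ.graph.σ₁ Γ.colorOpt) := by
  simp only [StrFace, Ne, colorOpt_eq_none_iff]
  rfl

theorem numFaces_add_numBoundaries (Γ : ColoredRibbonGraph X) :
    Γ.graph.numFaces + Γ.graph.numBoundaries = Nat.card Γ.graph.Cycle := by
  classical
  have h : ∀ q : Γ.graph.Cycle, (∃ x, x ∉ Γ.graph.B ∧ Γ.graph.cycle x = q) ↔
      ¬ ∃ x, x ∈ Γ.graph.B ∧ Γ.graph.cycle x = q := by
    intro q
    constructor
    · rintro ⟨x, hx, rfl⟩ ⟨y, hy, hxy⟩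
      rw [← colorOpt_eq_none_iff] at hx hy
      exact hx ((colorOpt_eq_of_cycle_eq hxy).symm.trans hy)
    · intro h
      exact ⟨q.out, fun hq => h ⟨_, hq, Γ.graph.cycle_out q⟩, Γ.graph.cycle_out q⟩
  rw [RibbonGraph.numFaces, RibbonGraph.numBoundaries, Nat.card_congr (Equiv.subtypeEquivRight h),
    add_comm, ← Nat.card_sum]
  exact Nat.card_congr (Equiv.sumCompl _)

/-- A marking already forces the number of faces, and for trivalent graphs the Euler relation only
prescribes the number of vertices. In this form the condition is easily read off a structure on
triangles. -/
theorem isTopCell_iff {Γ : ColoredRibbonGraph (Fin n)} : IsTopCell g b n Γ ↔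
    Γ.graph.Trivalent ∧ Γ.graph.Connected ∧ Γ.FaceMarked ∧ Γ.graph.numBoundaries = b ∧
      Γ.graph.numVertices + 4 = 4 * g + 2 * b + 2 * n := by
  constructor
  · exact fun ⟨h1, h2, h3⟩ => ⟨h3, h1.1, h2, h1.2.2.1, h1.numVertices_eq h3⟩
  · rintro ⟨h1, h2, h3, h4, h5⟩
    have h6 := Γ.graph.card_eq_two_mul_numEdges
    have h7 := Γ.graph.card_eq_three_mul_numVertices h1
    obtain ⟨δ, -⟩ := exists_cycle_equiv h3 (Finite.equivFin Γ.graph.Boundary)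
    have h8 := Nat.card_congr δ
    rw [← numFaces_add_numBoundaries, Nat.card_sum, Nat.card_fin, Nat.card_fin] at h8
    have h9 : Γ.graph.numFaces = n := Nat.add_right_cancel h8.symm
    exact ⟨⟨h2, h9, h4, by omega⟩, h3, h1⟩

theorem isTopCell_ofStr_iff {p : Str (rot (Fin m)) (Fin n)} :
    IsTopCell g b n (ofStr _ rot_degree p) ↔ IsConn (rot (Fin m)) p.1.1 ∧
      IsMarked (rot (Fin m)) p.1.1 p.1.2 ∧ numBdry (rot (Fin m)) p.1.1 p.1.2 = b ∧
      m + 4 = 4 * g + 2 * b + 2 * n := by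
  obtain ⟨h0, h1, h2⟩ := isoFrom_ofStr _ rot_degree p
  rw [isTopCell_iff, connected_ofStr_iff, numVertices_ofStr, faceMarked_iff,
    isMarked_conj _ h0 h1 h2, numBoundaries_eq, numBdry_conj _ h0 h1 h2,
    and_iff_right (trivalent_ofStr p)]

theorem IsIso.isTopCell {Γ Γ' : ColoredRibbonGraph (Fin n)} {a : Fin Γ.size ≃ Fin Γ'.size}
    (h : IsIso Γ Γ' a) (ht : IsTopCell g b n Γ) : IsTopCell g b n Γ' := by
  rw [isTopCell_iff, faceMarked_iff, numBoundaries_eq] at ht ⊢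
  rwa [h.trivalent_iff, h.connected_iff, h.numVertices_eq,
    isMarked_conj a h.1 h.2.1 (isIso_iff.1 h).2.2, numBdry_conj a h.1 h.2.1 (isIso_iff.1 h).2.2]

/-- The genus of a connected structure. -/
theorem exists_genus_str {p : Str (rot (Fin m)) X} (hp : IsConn (rot (Fin m)) p.1.1) :
    ∃ g, m + 4 = 4 * g + 2 * numBdry (rot (Fin m)) p.1.1 p.1.2 +
      2 * Nat.card (StrFace (rot (Fin m)) p.1.1 p.1.2) := by
  obtain ⟨h0, h1, h2⟩ := isoFrom_ofStr _ rot_degree p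
  obtain ⟨g, hg⟩ := (ofStr _ rot_degree p).graph.exists_genus
    ((connected_ofStr_iff p).2 hp) (trivalent_ofStr p)
  rw [numVertices_ofStr, ← numFaces_add_numBoundaries, numFaces_eq, numBoundaries_eq,
    numBdry_conj _ h0 h1 h2, card_strFace_conj _ h0 h1 h2] at hg
  exact ⟨g, by omega⟩

end ColoredRibbonGraph

open Classical in
theorem openW_eq_sum {m g b n : ℕ} {μ : Fin n → ℝ} (hμ : ∀ i, 0 < μ i) (Q : ℂ)
    (hm : m + 4 = 4 * g + 2 * b + 2 * n) :
    Q ^ b * (openW g b n μ : ℂ) = (∑ p : Str (rot (Fin m)) (Fin n) with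
      IsConn (rot (Fin m)) p.1.1 ∧ IsMarked (rot (Fin m)) p.1.1 p.1.2 ∧
        numBdry (rot (Fin m)) p.1.1 p.1.2 = b,
      strWeight μ Q (rot (Fin m)) p.1.1 p.1.2) / (m.factorial * 6 ^ m) := by
  have h := ColoredRibbonGraph.finsum_weight m hμ Q (fun Γ => IsTopCell g b n Γ)
    (fun Γ Γ' a h => h.isTopCell) fun Γ h => ⟨h.2.2, by
      have := h.1.numVertices_eq h.2.2
      omega⟩
  simp only [ColoredRibbonGraph.isTopCell_ofStr_iff, hm, and_true] at h
  refine Eq.trans ?_ h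
  have hT := finite_topCells g b n
  rw [openW_eq g b n hμ,
    show (∑ᶠ (q : ColoredRibbonGraph.IsoClass (Fin n)) (_ : IsTopCell g b n q.out),
      q.out.weight μ) = _ from finsum_mem_eq_finite_toFinset_sum _ hT,
    show (∑ᶠ (q : ColoredRibbonGraph.IsoClass (Fin n)) (_ : IsTopCell g b n q.out),
      Q ^ q.out.graph.numBoundaries * (q.out.weight μ : ℂ)) = _ from
      finsum_mem_eq_finite_toFinset_sum _ hT, Complex.ofReal_sum, Finset.mul_sum]
  refine Finset.sum_congr rfl fun q hq => ?_
  rw [(hT.mem_toFinset.1 hq).1.2.2.1]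

open Classical in
-- The pairs `(φ, p)` are grouped by the colored structure `p.map φ`, which has the same weight;
-- `card_marked_of_map` says that each one with `n` faces occurs `n!` times and all others never.
theorem sum_marked [Fintype X] {m n : ℕ} (lam : X → ℝ) (Q : ℂ) (b : ℕ) :
    ∑ φ : Fin n → X, ∑ p : Str (rot (Fin m)) (Fin n) with
      IsConn (rot (Fin m)) p.1.1 ∧ IsMarked (rot (Fin m)) p.1.1 p.1.2 ∧
        numBdry (rot (Fin m)) p.1.1 p.1.2 = b,
      strWeight (fun i => lam (φ i)) Q (rot (Fin m)) p.1.1 p.1.2 =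
    n.factorial * ∑ P : Str (rot (Fin m)) X with IsConn (rot (Fin m)) P.1.1 ∧
        numBdry (rot (Fin m)) P.1.1 P.1.2 = b ∧
        Nat.card (StrFace (rot (Fin m)) P.1.1 P.1.2) = n,
      strWeight lam Q (rot (Fin m)) P.1.1 P.1.2 := by
  let w : Str (rot (Fin m)) X → ℂ := fun P =>
    if IsConn (rot (Fin m)) P.1.1 ∧ numBdry (rot (Fin m)) P.1.1 P.1.2 = b then
      strWeight lam Q (rot (Fin m)) P.1.1 P.1.2 else 0
  have h1 : ∀ (φ : Fin n → X) (p : Str (rot (Fin m)) (Fin n)),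
      (if IsConn (rot (Fin m)) p.1.1 ∧ IsMarked (rot (Fin m)) p.1.1 p.1.2 ∧
        numBdry (rot (Fin m)) p.1.1 p.1.2 = b then
        strWeight (fun i => lam (φ i)) Q (rot (Fin m)) p.1.1 p.1.2 else 0) =
      if IsMarked (rot (Fin m)) p.1.1 p.1.2 then w (p.map φ) else 0 := by
    intro φ p
    have hb : numBdry (rot (Fin m)) (p.map φ).1.1 (p.map φ).1.2 =
        numBdry (rot (Fin m)) p.1.1 p.1.2 := by
      simp only [numBdry, Str.map, Option.map_eq_none_iff]
    have hw : w (p.map φ) = if IsConn (rot (Fin m)) p.1.1 ∧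
        numBdry (rot (Fin m)) p.1.1 p.1.2 = b then
        strWeight (fun i => lam (φ i)) Q (rot (Fin m)) p.1.1 p.1.2 else 0 := by
      simp only [w, hb, strWeight_map]
      rfl
    rw [hw]
    simp only [ite_and]
    split_ifs <;> rfl
  have h2 : ∀ P : Str (rot (Fin m)) X,
      ((Finset.univ.filter fun z : (Fin n → X) × Str (rot (Fin m)) (Fin n) =>
        IsMarked (rot (Fin m)) z.2.1.1 z.2.1.2 ∧ z.2.map z.1 = P).card : ℂ) * w P =
      n.factorial * if IsConn (rot (Fin m)) P.1.1 ∧ numBdry (rot (Fin m)) P.1.1 P.1.2 = b ∧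
        Nat.card (StrFace (rot (Fin m)) P.1.1 P.1.2) = n then
        strWeight lam Q (rot (Fin m)) P.1.1 P.1.2 else 0 := by
    intro P
    rw [← Nat.subtype_card _ fun z => Finset.mem_filter_univ z, card_marked_of_map]
    simp only [w, ite_and]
    split_ifs <;> simp
  simp only [Finset.sum_filter, h1]
  rw [Finset.mul_sum, ← Finset.sum_product', Finset.univ_product_univ, ← Finset.sum_filter,
    ← Finset.sum_fiberwise _ fun z : (Fin n → X) × Str (rot (Fin m)) (Fin n) => z.2.map z.1]
  refine Finset.sum_congr rfl fun P _ => ?_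
  rw [← h2, Finset.sum_congr rfl fun z hz => congrArg w (Finset.mem_filter.1 hz).2,
    Finset.sum_const, nsmul_eq_mul, Finset.filter_filter]

theorem coeff_freeEnergy_eq_sum_openW {N : ℕ} {lam : Fin N → ℝ} (hlam : ∀ i, 0 < lam i) (Q : ℂ)
    (m : ℕ) : PowerSeries.coeff m (freeEnergy lam Q) =
      ∑ p ∈ (Finset.range (m + 5) ×ˢ Finset.range (m + 5) ×ˢ Finset.range (m + 5)).filter
          (fun p : ℕ × ℕ × ℕ => 4 * p.1 + 2 * p.2.1 + 2 * p.2.2 = m + 4),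
        Q ^ p.2.1 / (p.2.2.factorial : ℂ) *
          ∑ φ : Fin p.2.2 → Fin N, (openW p.1 p.2.1 p.2.2 (fun i => lam (φ i)) : ℂ) := by
  classical
  have hterm : ∀ p ∈ (Finset.range (m + 5) ×ˢ Finset.range (m + 5) ×ˢ Finset.range (m + 5)).filter
      (fun p : ℕ × ℕ × ℕ => 4 * p.1 + 2 * p.2.1 + 2 * p.2.2 = m + 4),
      Q ^ p.2.1 / (p.2.2.factorial : ℂ) *
          ∑ φ : Fin p.2.2 → Fin N, (openW p.1 p.2.1 p.2.2 (fun i => lam (φ i)) : ℂ) =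
      ∑ P : Str (rot (Fin m)) (Fin N) with IsConn (rot (Fin m)) P.1.1,
        if numBdry (rot (Fin m)) P.1.1 P.1.2 = p.2.1 ∧
          Nat.card (StrFace (rot (Fin m)) P.1.1 P.1.2) = p.2.2 then
          strWeight lam Q (rot (Fin m)) P.1.1 P.1.2 / (m.factorial * 6 ^ m) else 0 := by
    intro p hp
    have hm := (Finset.mem_filter.1 hp).2
    have hn : (p.2.2.factorial : ℂ) ≠ 0 := Nat.cast_ne_zero.2 (Nat.factorial_ne_zero _)
    rw [div_mul_eq_mul_div, Finset.mul_sum, Finset.sum_congr rfl fun φ _ =>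
      openW_eq_sum (fun i => hlam (φ i)) Q hm.symm, ← Finset.sum_div, sum_marked, mul_div_assoc,
      mul_div_cancel_left₀ _ hn, Finset.sum_div, ← Finset.sum_filter, Finset.filter_filter]
  rw [Finset.sum_congr rfl hterm, Finset.sum_comm, coeff_freeEnergy hlam, strConn, Finset.sum_div]
  refine Finset.sum_congr rfl fun P hP => ?_
  obtain ⟨g, hg⟩ := ColoredRibbonGraph.exists_genus_str (Finset.mem_filter.1 hP).2
  -- Each connected structure is counted for exactly one triple, its own `(g, b, n)`. The ranges up
  -- to `m + 4` lose nothing, since `4g + 2b + 2n = m + 4`.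
  rw [Finset.sum_eq_single (g, numBdry (rot (Fin m)) P.1.1 P.1.2,
    Nat.card (StrFace (rot (Fin m)) P.1.1 P.1.2))]
  · simp
  · intro p hp hne
    refine if_neg fun h => hne ?_
    have hm := (Finset.mem_filter.1 hp).2
    rw [h.1, h.2] at hg
    exact Prod.ext (by omega) (Prod.ext h.1.symm h.2.symm)
  · intro h
    refine absurd ?_ h
    simp only [Finset.mem_filter, Finset.mem_product, Finset.mem_range]
    omega

end TopCellStructures

end KontsevichPenner

theorem mainTheorem2 {N : ℕ} (lam : Fin N → ℝ) (hlam : ∀ i, 0 < lam i) (Q : ℂ) :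
    -- the coefficients of `τ_Q` are convergent integrals, and `τ_Q` has constant term `1`
    (∀ m : ℕ, MeasureTheory.Integrable fun u : Fin N × Fin N → ℝ =>
      PowerSeries.coeff m (expInteraction lam Q (hermitian u)) *
        gaussianWeight lam (hermitian u)) ∧
    PowerSeries.constantCoeff (tau lam Q) = 1 ∧
    -- `F_Q` is the sum over the connected trivalent `N`-colored ribbon graphs
    (∀ m : ℕ, PowerSeries.coeff m (freeEnergy lam Q) =
      ∑ᶠ (q : ColoredRibbonGraph.IsoClass (Fin N))
        (_ : q.out.graph.Connected ∧ q.out.graph.Trivalent ∧ q.out.graph.numVertices = m),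
        Q ^ q.out.graph.numBoundaries * (q.out.weight lam : ℂ)) ∧
    -- `F_Q = ∑_{g,b,n} Q^b / n! ∑_φ W_{(g,b),n} (λ_φ(1), …, λ_φ(n))`
    (∀ m : ℕ, PowerSeries.coeff m (freeEnergy lam Q) =
      ∑ p ∈ (Finset.range (m + 5) ×ˢ Finset.range (m + 5) ×ˢ Finset.range (m + 5)).filter
          (fun p : ℕ × ℕ × ℕ => 4 * p.1 + 2 * p.2.1 + 2 * p.2.2 = m + 4),
        Q ^ p.2.1 / (p.2.2.factorial : ℂ) *
          ∑ φ : Fin p.2.2 → Fin N, (openW p.1 p.2.1 p.2.2 (fun i => lam (φ i)) : ℂ)) ∧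
    -- `W` converges, is the sum over trivalent face-marked graphs, and is homogeneous
    (∀ (g b n : ℕ) (μ : Fin n → ℝ), (∀ i, 0 < μ i) →
      MeasureTheory.IntegrableOn (laplaceIntegrand g b n μ) (orthant n b) ∧
      openW g b n μ =
        ∑ᶠ (q : ColoredRibbonGraph.IsoClass (Fin n)) (_ : IsTopCell g b n q.out),
          q.out.weight μ ∧
      ∀ s : ℝ, 0 < s →
        openW g b n (fun i => s * μ i) =
          s ^ (6 - (6 * g + 3 * b + 3 * n) : ℤ) * openW g b n μ) := by
  refine ⟨fun m => integrable_coeff_expInteraction hlam Q m, constantCoeff_tau hlam Q,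
    coeff_freeEnergy_eq_finsum hlam Q, coeff_freeEnergy_eq_sum_openW hlam Q,
    fun g b n μ hμ => ⟨integrableOn_laplaceIntegrand g b n hμ, openW_eq g b n hμ,
      fun s hs => ?_⟩⟩
  exact openW_smul g b n hμ hs
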